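/- **Setting.** Let $n\ge 1$, $s_1,s_2\in\mathbb C$, $s_3>0$, and suppose that the quadrature domain $\Omega_1=\{z:\ |(z-s_1)^n-s_2|<s_3\}$ is contained in $D_1=\{z:\ 0<\arg z<\pi/2,\ |z|>1\}$. Let $r_1$ be analytic in $\Omega_1$ and continuous on $\overline{\Omega_1}$, and suppose that $(z-s_1)^n=s_2$ has $n$ distinct solutions $\zeta_1,\dots,\zeta_n$ (i.e. $s_2\ne0$ or $n=1$). A star denotes complex conjugation, $r_1^*(\zeta)=\overline{r_1(\zeta)}$, and $\partial\Omega_1$ is oriented counterclockwise. Put $$k(z)=\tfrac i2\Big(z-\tfrac1z\Big),\quad \lambda(z)=\tfrac12\Big(z+\tfrac1z\Big),\quad \theta(z)=\theta(y,t;z)=\tfrac i2k(z)\big(y-2\lambda(z)^{-2}t\big),\qquad c_j=\frac{s_3^2\,r_1(\zeta_j)}{\prod_{k\ne j}(\zeta_j-\zeta_k)} .$$ To $z\in D_1$ and $c\in\mathbb C$ attach the points and constants $$\big(p_1^+,p_2^+,p_3^+,p_4^+\big)(z)=\big(z,-z^*,\tfrac1{z^*},-\tfrac1z\big),\qquad \big(C_1^+,\dots,C_4^+\big)(c,z)=\big(c,\,c^*,\,-\tfrac{c^*}{z^{*2}},\,-\tfrac{c}{z^2}\big),$$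 $$\big(p_1^-,p_2^-,p_3^-,p_4^-\big)(z)=\big(z^*,-z,\tfrac1z,-\tfrac1{z^*}\big),\qquad \big(C_1^-,\dots,C_4^-\big)(c,z)=\big(-c^*,\,-c,\,\tfrac{c}{z^2},\,\tfrac{c^*}{z^{*2}}\big).$$ Let $\Gamma_{k\pm}$ ($k=1,\dots,4$) be rectifiable Jordan curves, oriented counterclockwise, bounding domains $G_{k\pm}$ whose closures are pairwise disjoint and do not contain $i$, with $p_k^\pm(\overline{\Omega_1})\subset G_{k\pm}$. **Normalization (N).** A $2\times2$ matrix function $M$ satisfies (N) if $M=\mathbb I+O(1/z)$ as $z\to\infty$ and, for some real $m,h$ and some matrix $\mu$, with $q=\sqrt{m^2+1}$, $$M(z)=\sqrt{\tfrac{(q+1)^2}{m^2+(q+1)^2}}\begin{pmatrix}1&\frac{im}{q+1}\\ \frac{im}{q+1}&1\end{pmatrix}\big[\mathbb I+\mu(z-i)\big]e^{\frac h2\sigma_3}+O\big((z-i)^2\big),\qquad z\to i .$$ **Limit problem (RH3)** (the Riemann–Hilbert problem of the $N_\infty$-soliton limit). $M(y,t;\cdot)$ is analytic off $\bigcup_k(\Gamma_{k+}\cup\Gamma_{k-})$,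 has continuous boundary values $M_+$ (from inside) and $M_-$ (from outside) on each contour, satisfies (N), and $M_+=M_-\begin{pmatrix}1&0\\v_k^+&1\end{pmatrix}$ on $\Gamma_{k+}$, $M_+=M_-\begin{pmatrix}1&v_k^-\\0&1\end{pmatrix}$ on $\Gamma_{k-}$, where $$\begin{aligned} v_1^+&=-\int_{\partial\Omega_1}\!\frac{(\zeta^*-s_1^*)^nr_1(\zeta)e^{-2i\theta(\zeta)}}{2\pi i(z-\zeta)}d\zeta,& v_2^+&=\int_{\partial\Omega_1}\!\frac{(\zeta-s_1)^nr_1^*(\zeta)e^{-2i\theta(-\zeta^*)}}{2\pi i(z+\zeta^*)}d\zeta^*,\\ v_3^+&=-\int_{\partial\Omega_1}\!\frac{(\zeta-s_1)^nr_1^*(\zeta)e^{-2i\theta(1/\zeta^*)}}{2\pi i(z-\frac1{\zeta^*})\zeta^{*2}}d\zeta^*,& v_4^+&=\int_{\partial\Omega_1}\!\frac{(\zeta^*-s_1^*)^nr_1(\zeta)e^{-2i\theta(-1/\zeta)}}{2\pi i(z+\frac1\zeta)\zeta^2}d\zeta,\\ v_1^-&=-\int_{\partial\Omega_1}\!\frac{(\zeta-s_1)^nr_1^*(\zeta)e^{2i\theta(\zeta^*)}}{2\pi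 i(z-\zeta^*)}d\zeta^*,& v_2^-&=\int_{\partial\Omega_1}\!\frac{(\zeta^*-s_1^*)^nr_1(\zeta)e^{2i\theta(-\zeta)}}{2\pi i(z+\zeta)}d\zeta,\\ v_3^-&=-\int_{\partial\Omega_1}\!\frac{(\zeta^*-s_1^*)^nr_1(\zeta)e^{2i\theta(1/\zeta)}}{2\pi i(z-\frac1\zeta)\zeta^2}d\zeta,& v_4^-&=\int_{\partial\Omega_1}\!\frac{(\zeta-s_1)^nr_1^*(\zeta)e^{2i\theta(-1/\zeta^*)}}{2\pi i(z+\frac1{\zeta^*})\zeta^{*2}}d\zeta^*. \end{aligned}$$ **Soliton problem (RH1)** with discrete spectrum $\zeta_1,\dots,\zeta_n$ and norming constants $c_1,\dots,c_n$ (zero reflection coefficient). $M^{(0)}(y,t;\cdot)$ is analytic in $\mathbb C$ except for at most simple poles at the points $p_k^\pm(\zeta_j)$, satisfies (N), and $$\mathop{\mathrm{Res}}_{z=p}M^{(0)}=\lim_{z\to p}M^{(0)}\begin{pmatrix}0&0\\C_k^+(c_j,\zeta_j)e^{-2i\theta(p)}&0\end{pmatrix}\ (p=p_k^+(\zeta_j)),\qquad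 \mathop{\mathrm{Res}}_{z=p}M^{(0)}=\lim_{z\to p}M^{(0)}\begin{pmatrix}0&C_k^-(c_j,\zeta_j)e^{2i\theta(p)}\\0&0\end{pmatrix}\ (p=p_k^-(\zeta_j)).$$ **Reconstruction.** A function $u:\mathbb R^2\to\mathbb R$ is recovered from $M(y,t;z)$ if there is a real change of variables $x=x(y,t)$, bijective $\mathbb R\to\mathbb R$ in $y$ for every $t$, such that for all $(y,t)$ $$x(y,t)=y-\ln\frac{M_{12}(i)+M_{22}(i)}{M_{11}(i)+M_{21}(i)},\qquad u(x(y,t),t)=\lim_{z\to i}\frac1{z-i}\left(1-\frac{(M_{11}(z)+M_{21}(z))(M_{12}(z)+M_{22}(z))}{(M_{11}(i)+M_{21}(i))(M_{12}(i)+M_{22}(i))}\right).$$ A function $u$ is the $n$-soliton solution of the mCH equation with discrete spectrum $\zeta_j$ and norming constants $c_j$ if $u$ is $C^\infty$, satisfies $$m_t+\big(m(u^2-u_x^2)\big)_x+2u_x=0,\quad m=u-u_{xx},\qquad \lim_{x\to\pm\infty}u(x,t)=0,$$ and is recovered from some $M^{(0)}(y,t;z)$ that solves (RH1) for all $(y,t)\in\mathbb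 R^2$. **Statement.** 1. For all real $y,t$, all $k$ and both signs, and every $z\notin p_k^\pm(\overline{\Omega_1})$ (in particular on $\Gamma_{k\pm}$), the boundary integrals reduce to finite sums of poles: $$v_k^{\pm}(z)=-\sum_{j=1}^n\frac{C_k^\pm(c_j,\zeta_j)\,e^{\mp2i\theta(p_k^\pm(\zeta_j))}}{z-p_k^\pm(\zeta_j)} .$$ 2. For every $(y,t)$: to every solution $M$ of (RH3) there is a solution $M^{(0)}$ of (RH1) with $M=M^{(0)}$ outside all the closed domains $\overline{G_{k\pm}}$ and, away from the poles, $M=M^{(0)}\begin{pmatrix}1&0\\v&1\end{pmatrix}$ in $G_{k+}$ and $M=M^{(0)}\begin{pmatrix}1&v\\0&1\end{pmatrix}$ in $G_{k-}$, where $v$ is the sum on the right-hand side of part 1 for that contour; and to every solution $M^{(0)}$ of (RH1) there is a solution $M$ of (RH3) related to it in this way. 3. If $M(y,t;\cdot)$ solves (RH3) for all $(y,t)\in\mathbb R^2$, then exactly one function $u$ is recovered from $M$, and it is the $n$-soliton solution of the mCH equation with discrete spectrum $\zeta_1,\dots,\zeta_n$ and norming constants $c_1,\dots,c_n$ ("soliton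 shielding"). -/

import Mathlib

open scoped ComplexConjugate Topology ContDiff

noncomputable section

namespace MCH

/-- `2 × 2` complex matrices. -/
abbrev Mat := Matrix (Fin 2) (Fin 2) ℂ

/-! ### The modified Camassa-Holm equation -/

/-- The momentum density `m = u - u_xx`. -/
def momentum (u : ℝ → ℝ → ℝ) (x t : ℝ) : ℝ :=
  u x t - deriv (fun ξ => deriv (fun η => u η t) ξ) x

/-- `u = u(x,t)` is a smooth solution of the mCH equation with linear dispersion (`κ = 2`)
`m_t + (m (u² - u_x²))_x + 2 u_x = 0`, `m = u - u_xx`, `u → 0` as `x → ±∞`. -/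
structure IsMCHSolution (u : ℝ → ℝ → ℝ) : Prop where
  smooth : ContDiff ℝ ∞ (fun p : ℝ × ℝ => u p.1 p.2)
  equation : ∀ x t : ℝ,
    deriv (fun τ => momentum u x τ) t
      + deriv (fun ξ => momentum u ξ t * (u ξ t ^ 2 - deriv (fun η => u η t) ξ ^ 2)) x
      + 2 * deriv (fun ξ => u ξ t) x = 0
  vanish_right : ∀ t : ℝ, Filter.Tendsto (fun x => u x t) Filter.atTop (𝓝 0)
  vanish_left : ∀ t : ℝ, Filter.Tendsto (fun x => u x t) Filter.atBot (𝓝 0)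

/-! ### Spectral functions -/

/-- `k(z) = (i/2)(z - 1/z)`. -/
def kFun (z : ℂ) : ℂ := Complex.I / 2 * (z - 1 / z)

/-- `λ(z) = (1/2)(z + 1/z)`. -/
def lamFun (z : ℂ) : ℂ := 1 / 2 * (z + 1 / z)

/-- `θ(y,t;z) = (i/2) k(z) (y - 2 λ(z)⁻² t)`. -/
def theta (y t : ℝ) (z : ℂ) : ℂ :=
  Complex.I / 2 * kFun z * ((y : ℂ) - 2 * (lamFun z ^ 2)⁻¹ * (t : ℂ))

/-- The points of the upper half plane attached to a spectral point `z`. -/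
def upperPole (z : ℂ) : Fin 4 → ℂ := ![z, -conj z, 1 / conj z, -1 / z]

/-- The points of the lower half plane attached to a spectral point `z`. -/
def lowerPole (z : ℂ) : Fin 4 → ℂ := ![conj z, -z, 1 / z, -1 / conj z]

/-- Constants in the residue conditions at the points `upperPole z`, for the norming constant `c`
of the spectral point `z`. -/
def upperConst (c z : ℂ) : Fin 4 → ℂ := ![c, conj c, -(conj c / conj z ^ 2), -(c / z ^ 2)]

/-- Constants in the residue conditions at the points `lowerPole z`. -/
def lowerConst (c z : ℂ) : Fin 4 → ℂ := ![-conj c, -c, c / z ^ 2, conj c / conj z ^ 2]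

/-! ### Normalization and residues -/

/-- `M = I + O(1/z)` as `z → ∞`. -/
def NormalizedAtInfinity (M : ℂ → Mat) : Prop :=
  ∀ a b, (fun z => M z a b - (1 : Mat) a b) =O[Bornology.cobounded ℂ] (fun z => z⁻¹)

/-- With `q = √(m² + 1)`: the unimodular matrix
`√((q+1)² / (m² + (q+1)²)) · [1, i m/(q+1); i m/(q+1), 1]`. -/
def gaugeMatrix (m : ℝ) : Mat :=
  let q : ℝ := Real.sqrt (m ^ 2 + 1)
  ((Real.sqrt ((q + 1) ^ 2 / (m ^ 2 + (q + 1) ^ 2)) : ℝ) : ℂ) •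
    !![1, Complex.I * ((m / (q + 1) : ℝ) : ℂ); Complex.I * ((m / (q + 1) : ℝ) : ℂ), 1]

/-- `e^{(h/2) σ₃}`. -/
def expHalfSigma3 (h : ℝ) : Mat :=
  !![Complex.exp ((h : ℂ) / 2), 0; 0, Complex.exp (-((h : ℂ) / 2))]

/-- The normalization as `z → i`: for some real numbers `m`, `h` and some matrix `μ`,
`M(z) = gaugeMatrix m · [I + μ (z - i)] · e^{(h/2)σ₃} + O((z - i)²)`. -/
def NormalizedAtI (M : ℂ → Mat) : Prop :=
  ∃ (m h : ℝ) (μ : Mat), ∀ a b,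
    (fun z => M z a b
        - (gaugeMatrix m * (1 + (z - Complex.I) • μ) * expHalfSigma3 h) a b)
      =O[𝓝 Complex.I] (fun z => (z - Complex.I) ^ 2)

/-- At `p`, `M` has at most a simple pole and `Res_{z=p} M = lim_{z→p} M(z) N`. -/
def HasResidueCondition (M : ℂ → Mat) (p : ℂ) (N : Mat) : Prop :=
  ∃ A : Mat, Filter.Tendsto (fun z => M z * N) (𝓝[≠] p) (𝓝 A) ∧
    Filter.Tendsto (fun z => (z - p) • M z) (𝓝[≠] p) (𝓝 A)

/-! ### The soliton Riemann-Hilbert problem -/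

/-- All points of the discrete spectrum generated by `ζ₁, …, ζₙ`. -/
def spectrumSet {n : ℕ} (ζ : Fin n → ℂ) : Set ℂ :=
  {z | ∃ (j : Fin n) (k : Fin 4), z = upperPole (ζ j) k ∨ z = lowerPole (ζ j) k}

/-- The reflectionless Riemann-Hilbert problem (zero reflection coefficient, hence no jump across
the real line) with discrete spectrum generated by `ζ₁, …, ζₙ` and norming constants
`c₁, …, cₙ`, at the point `(y,t)`. -/
structure IsSolitonRH {n : ℕ} (ζ c : Fin n → ℂ) (y t : ℝ) (M : ℂ → Mat) : Prop where
  analytic : ∀ a b, DifferentiableOn ℂ (fun z => M z a b) (spectrumSet ζ)ᶜ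
  residue_upper : ∀ j k, HasResidueCondition M (upperPole (ζ j) k)
    !![0, 0; upperConst (c j) (ζ j) k
        * Complex.exp (-2 * Complex.I * theta y t (upperPole (ζ j) k)), 0]
  residue_lower : ∀ j k, HasResidueCondition M (lowerPole (ζ j) k)
    !![0, lowerConst (c j) (ζ j) k
        * Complex.exp (2 * Complex.I * theta y t (lowerPole (ζ j) k)); 0, 0]
  norm_infinity : NormalizedAtInfinity M
  norm_I : NormalizedAtI M

/-- `M₁₁ + M₂₁`. -/
def colSum1 (M : ℂ → Mat) (z : ℂ) : ℂ := M z 0 0 + M z 1 0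

/-- `M₁₂ + M₂₂`. -/
def colSum2 (M : ℂ → Mat) (z : ℂ) : ℂ := M z 0 1 + M z 1 1

/-- The function `u(x,t)` is recovered from the matrices `M(y,t;z)`: there is a change of variables
`x = x(y,t)`, bijective in `y` for every `t`, with
`x(y,t) = y - ln ((M₁₂(i) + M₂₂(i)) / (M₁₁(i) + M₂₁(i)))` and
`u(x(y,t),t) = lim_{z→i} (z-i)⁻¹ (1 - (M₁₁+M₂₁)(z) (M₁₂+M₂₂)(z) / ((M₁₁+M₂₁)(i) (M₁₂+M₂₂)(i)))`. -/
def Recovers (M : ℝ → ℝ → ℂ → Mat) (u : ℝ → ℝ → ℝ) : Prop :=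
  ∃ x : ℝ → ℝ → ℝ, (∀ t, Function.Bijective (fun y => x y t)) ∧
    ∀ y t,
      ((x y t : ℝ) : ℂ) = (y : ℂ)
          - Complex.log (colSum2 (M y t) Complex.I / colSum1 (M y t) Complex.I) ∧
      Filter.Tendsto
        (fun z => 1 / (z - Complex.I) *
          (1 - colSum1 (M y t) z * colSum2 (M y t) z
            / (colSum1 (M y t) Complex.I * colSum2 (M y t) Complex.I)))
        (𝓝[≠] Complex.I) (𝓝 ((u (x y t) t : ℝ) : ℂ))

/-- `u` is the `n`-soliton solution of the mCH equation with discrete spectrum `ζ₁, …, ζₙ` and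
norming constants `c₁, …, cₙ`: it solves the mCH equation, and it is recovered from the solution
of the soliton Riemann-Hilbert problem with these data. -/
def IsNSolitonSolution {n : ℕ} (ζ c : Fin n → ℂ) (u : ℝ → ℝ → ℝ) : Prop :=
  IsMCHSolution u ∧
    ∃ M : ℝ → ℝ → ℂ → Mat, (∀ y t, IsSolitonRH ζ c y t (M y t)) ∧ Recovers M u

/-! ### The quadrature domain and integrals over its boundary -/

/-- The quadrature domain `{z : |(z - s₁)ⁿ - s₂| < s₃}`. -/
def quadDomain (n : ℕ) (s₁ s₂ : ℂ) (s₃ : ℝ) : Set ℂ := {z | ‖(z - s₁) ^ n - s₂‖ < s₃}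

/-- The region `{z : 0 < arg z < π/2, |z| > 1}`. -/
def regionD : Set ℂ := {z | 0 < z.arg ∧ z.arg < Real.pi / 2 ∧ 1 < ‖z‖}

/-- The boundary of the quadrature domain consists of the points `z` with
`(z - s₁)ⁿ = s₂ + s₃ e^{iφ}`, `0 ≤ φ ≤ 2π`. The `n` branches of
`z = s₁ + (s₂ + s₃ e^{iφ})^{1/n}` that are continuous in `φ` are `n` arcs which together run once
through the boundary, counterclockwise. The principal power is continuous here, because
`1 + (s₂/s₃) e^{-iφ}` (respectively `1 + (s₃/s₂) e^{iφ}`) is `0` or has positive real part. -/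
def boundaryArc (n : ℕ) (s₁ s₂ : ℂ) (s₃ : ℝ) (j : Fin n) (φ : ℝ) : ℂ :=
  s₁ + Complex.exp (2 * (Real.pi : ℂ) * Complex.I * (j : ℂ) / (n : ℂ)) *
    (if ‖s₂‖ ≤ s₃ then
      (s₃ : ℂ) ^ ((n : ℂ)⁻¹) * Complex.exp (Complex.I * (φ : ℂ) / (n : ℂ))
        * (1 + s₂ / (s₃ : ℂ) * Complex.exp (-(Complex.I * (φ : ℂ)))) ^ ((n : ℂ)⁻¹)
    else
      s₂ ^ ((n : ℂ)⁻¹) * (1 + (s₃ : ℂ) / s₂ * Complex.exp (Complex.I * (φ : ℂ))) ^ ((n : ℂ)⁻¹))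

theorem boundaryArc_spec (n : ℕ) (hn : 0 < n) (s₁ s₂ : ℂ) (s₃ : ℝ) (hs₃ : 0 < s₃)
    (j : Fin n) (φ : ℝ) :
    (boundaryArc n s₁ s₂ s₃ j φ - s₁) ^ n
      = s₂ + (s₃ : ℂ) * Complex.exp (Complex.I * (φ : ℂ)) := by
  have hn0 : n ≠ 0 := hn.ne'
  have hnC : (n : ℂ) ≠ 0 := Nat.cast_ne_zero.mpr hn0
  have h3 : (s₃ : ℂ) ≠ 0 := Complex.ofReal_ne_zero.mpr hs₃.ne'
  have hw : Complex.exp (2 * (Real.pi : ℂ) * Complex.I * (j : ℂ) / (n : ℂ)) ^ n = 1 := by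
    rw [← Complex.exp_nat_mul, Complex.exp_eq_one_iff]
    exact ⟨(j : ℕ), by push_cast; field_simp⟩
  have he : Complex.exp (Complex.I * (φ : ℂ) / (n : ℂ)) ^ n
      = Complex.exp (Complex.I * (φ : ℂ)) := by
    rw [← Complex.exp_nat_mul]
    congr 1
    field_simp
  unfold boundaryArc
  rw [add_sub_cancel_left, mul_pow, hw, one_mul]
  split_ifs with h
  · rw [mul_pow, mul_pow, he, Complex.cpow_nat_inv_pow _ hn0, Complex.cpow_nat_inv_pow _ hn0,
      Complex.exp_neg]
    have := Complex.exp_ne_zero (Complex.I * (φ : ℂ))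
    field_simp
    ring
  · have h2 : s₂ ≠ 0 := by
      rintro rfl
      exact h (by simpa using hs₃.le)
    rw [mul_pow, Complex.cpow_nat_inv_pow _ hn0, Complex.cpow_nat_inv_pow _ hn0]
    field_simp

/-- `∫_{∂Ω} g(ζ) dζ` over the counterclockwise boundary of the quadrature domain. -/
def boundaryIntegral (n : ℕ) (s₁ s₂ : ℂ) (s₃ : ℝ) (g : ℂ → ℂ) : ℂ :=
  ∑ j : Fin n, ∫ φ in (0 : ℝ)..(2 * Real.pi),
    g (boundaryArc n s₁ s₂ s₃ j φ) * deriv (boundaryArc n s₁ s₂ s₃ j) φ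

/-- `∫_{∂Ω} g(ζ) dζ*` over the counterclockwise boundary of the quadrature domain. -/
def boundaryIntegralConj (n : ℕ) (s₁ s₂ : ℂ) (s₃ : ℝ) (g : ℂ → ℂ) : ℂ :=
  ∑ j : Fin n, ∫ φ in (0 : ℝ)..(2 * Real.pi),
    g (boundaryArc n s₁ s₂ s₃ j φ) * conj (deriv (boundaryArc n s₁ s₂ s₃ j) φ)

/-! ### The limiting Riemann-Hilbert problem -/

/-- The lower left entries of the jump matrices on the four contours in the upper half plane. -/
def upperJump (n : ℕ) (s₁ s₂ : ℂ) (s₃ : ℝ) (r₁ : ℂ → ℂ) (y t : ℝ) (z : ℂ) : Fin 4 → ℂ := ![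
  -boundaryIntegral n s₁ s₂ s₃ (fun w => (conj w - conj s₁) ^ n * r₁ w
      * Complex.exp (-2 * Complex.I * theta y t w)
      / (2 * Real.pi * Complex.I * (z - w))),
  boundaryIntegralConj n s₁ s₂ s₃ (fun w => (w - s₁) ^ n * conj (r₁ w)
      * Complex.exp (-2 * Complex.I * theta y t (-conj w))
      / (2 * Real.pi * Complex.I * (z + conj w))),
  -boundaryIntegralConj n s₁ s₂ s₃ (fun w => (w - s₁) ^ n * conj (r₁ w)
      * Complex.exp (-2 * Complex.I * theta y t (1 / conj w))
      / (2 * Real.pi * Complex.I * (z - 1 / conj w) * conj w ^ 2)),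
  boundaryIntegral n s₁ s₂ s₃ (fun w => (conj w - conj s₁) ^ n * r₁ w
      * Complex.exp (-2 * Complex.I * theta y t (-1 / w))
      / (2 * Real.pi * Complex.I * (z + 1 / w) * w ^ 2))]

/-- The upper right entries of the jump matrices on the four contours in the lower half plane. -/
def lowerJump (n : ℕ) (s₁ s₂ : ℂ) (s₃ : ℝ) (r₁ : ℂ → ℂ) (y t : ℝ) (z : ℂ) : Fin 4 → ℂ := ![
  -boundaryIntegralConj n s₁ s₂ s₃ (fun w => (w - s₁) ^ n * conj (r₁ w)
      * Complex.exp (2 * Complex.I * theta y t (conj w))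
      / (2 * Real.pi * Complex.I * (z - conj w))),
  boundaryIntegral n s₁ s₂ s₃ (fun w => (conj w - conj s₁) ^ n * r₁ w
      * Complex.exp (2 * Complex.I * theta y t (-w))
      / (2 * Real.pi * Complex.I * (z + w))),
  -boundaryIntegral n s₁ s₂ s₃ (fun w => (conj w - conj s₁) ^ n * r₁ w
      * Complex.exp (2 * Complex.I * theta y t (1 / w))
      / (2 * Real.pi * Complex.I * (z - 1 / w) * w ^ 2)),
  boundaryIntegralConj n s₁ s₂ s₃ (fun w => (w - s₁) ^ n * conj (r₁ w)
      * Complex.exp (2 * Complex.I * theta y t (-1 / conj w))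
      / (2 * Real.pi * Complex.I * (z + 1 / conj w) * conj w ^ 2))]

/-- `G` is the bounded domain enclosed by a rectifiable Jordan curve: it is a bounded domain whose
boundary is a simple closed curve with a Lipschitz parametrization. -/
def IsJordanDomain (G : Set ℂ) : Prop :=
  IsOpen G ∧ IsConnected G ∧ Bornology.IsBounded G ∧
    ∃ γ : ℝ → ℂ, (∃ K, LipschitzWith K γ) ∧ Function.Periodic γ 1 ∧
      Set.InjOn γ (Set.Ico 0 1) ∧ frontier G = Set.range γ

/-- The eight contours are the boundaries of the Jordan domains `Gp k` and `Gm k`. Their closures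
are pairwise disjoint and do not contain `i`, and `Gp k` (resp. `Gm k`) contains the image of the
closed quadrature domain under the map `upperPole · k` (resp. `lowerPole · k`). -/
structure IsContourSystem (n : ℕ) (s₁ s₂ : ℂ) (s₃ : ℝ) (Gp Gm : Fin 4 → Set ℂ) : Prop where
  jordan_upper : ∀ k, IsJordanDomain (Gp k)
  jordan_lower : ∀ k, IsJordanDomain (Gm k)
  subset_upper : ∀ k, (fun z => upperPole z k) '' closure (quadDomain n s₁ s₂ s₃) ⊆ Gp k
  subset_lower : ∀ k, (fun z => lowerPole z k) '' closure (quadDomain n s₁ s₂ s₃) ⊆ Gm k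
  disjoint_upper : ∀ k l, k ≠ l → Disjoint (closure (Gp k)) (closure (Gp l))
  disjoint_lower : ∀ k l, k ≠ l → Disjoint (closure (Gm k)) (closure (Gm l))
  disjoint_cross : ∀ k l, Disjoint (closure (Gp k)) (closure (Gm l))
  I_notMem_upper : ∀ k, Complex.I ∉ closure (Gp k)
  I_notMem_lower : ∀ k, Complex.I ∉ closure (Gm k)

/-- On the contour `∂G` (counterclockwise, so that the `+` side is the inside) the matrix `M` has
continuous boundary values `M₊`, `M₋` from both sides, and `M₊ = M₋ V`. -/
def HasJump (M : ℂ → Mat) (G : Set ℂ) (V : ℂ → Mat) : Prop :=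
  ∃ Mplus Mminus : ℂ → Mat,
    ContinuousOn Mplus (frontier G) ∧ ContinuousOn Mminus (frontier G) ∧
    ∀ z ∈ frontier G,
      Filter.Tendsto M (𝓝[G] z) (𝓝 (Mplus z)) ∧
      Filter.Tendsto M (𝓝[(closure G)ᶜ] z) (𝓝 (Mminus z)) ∧
      Mplus z = Mminus z * V z

/-- The Riemann-Hilbert problem of the `N_∞`-soliton limit at the point `(y,t)`. -/
structure IsLimitRH (n : ℕ) (s₁ s₂ : ℂ) (s₃ : ℝ) (r₁ : ℂ → ℂ) (Gp Gm : Fin 4 → Set ℂ)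
    (y t : ℝ) (M : ℂ → Mat) : Prop where
  analytic : ∀ a b, DifferentiableOn ℂ (fun z => M z a b)
    ((⋃ k, frontier (Gp k)) ∪ (⋃ k, frontier (Gm k)))ᶜ
  jump_upper : ∀ k, HasJump M (Gp k)
    (fun z => !![1, 0; upperJump n s₁ s₂ s₃ r₁ y t z k, 1])
  jump_lower : ∀ k, HasJump M (Gm k)
    (fun z => !![1, lowerJump n s₁ s₂ s₃ r₁ y t z k; 0, 1])
  norm_infinity : NormalizedAtInfinity M
  norm_I : NormalizedAtI M

/-! ### Finite pole sums -/

/-- `c_j = s₃² r₁(ζ_j) / ∏_{k ≠ j} (ζ_j - ζ_k)`. -/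
def normingConst {n : ℕ} (s₃ : ℝ) (r₁ : ℂ → ℂ) (ζ : Fin n → ℂ) (j : Fin n) : ℂ :=
  (s₃ : ℂ) ^ 2 * r₁ (ζ j) / ∏ k ∈ Finset.univ.erase j, (ζ j - ζ k)

/-- The sum of poles `∑_j C_j e^{-2iθ(p_j)} / (z - p_j)` over the points `p_j = upperPole (ζ j) k`,
with `C_j` the constants of the residue conditions there. -/
def upperPoleSum {n : ℕ} (ζ c : Fin n → ℂ) (y t : ℝ) (k : Fin 4) (z : ℂ) : ℂ :=
  ∑ j, upperConst (c j) (ζ j) k * Complex.exp (-2 * Complex.I * theta y t (upperPole (ζ j) k))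
    / (z - upperPole (ζ j) k)

/-- The sum of poles `∑_j C_j e^{2iθ(p_j)} / (z - p_j)` over the points `p_j = lowerPole (ζ j) k`. -/
def lowerPoleSum {n : ℕ} (ζ c : Fin n → ℂ) (y t : ℝ) (k : Fin 4) (z : ℂ) : ℂ :=
  ∑ j, lowerConst (c j) (ζ j) k * Complex.exp (2 * Complex.I * theta y t (lowerPole (ζ j) k))
    / (z - lowerPole (ζ j) k)

/-- The transformation between the soliton Riemann-Hilbert problem (`M0`) and the problem with
jumps (`M`): they agree outside the contours, and inside the contours `M` is `M0` times the
triangular matrix that removes the poles. -/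
structure IsInterpolation {n : ℕ} (ζ c : Fin n → ℂ) (Gp Gm : Fin 4 → Set ℂ) (y t : ℝ)
    (M0 M : ℂ → Mat) : Prop where
  outside : ∀ z, (∀ k, z ∉ closure (Gp k)) → (∀ k, z ∉ closure (Gm k)) → M z = M0 z
  inside_upper : ∀ k, ∀ z ∈ Gp k, z ∉ spectrumSet ζ →
    M z = M0 z * !![1, 0; -upperPoleSum ζ c y t k z, 1]
  inside_lower : ∀ k, ∀ z ∈ Gm k, z ∉ spectrumSet ζ →
    M z = M0 z * !![1, -lowerPoleSum ζ c y t k z; 0, 1]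

end MCH

end

/-! Boundary integrals. On `∂Ω₁` put `w = (ζ - s₁)ⁿ = s₂ + s₃ e^{iφ}`. There the antiholomorphic
factor `(ζ* - s₁*)ⁿ` equals `s₂* + s₃²/(w - s₂)`, which is meromorphic in `w`. Summing `F(ζ) dζ`
over the `n` preimages (`pushforward`) gives a function on the disc that is holomorphic up to a
removable singularity at the branch point `w = 0`. Cauchy's formula at `s₂` then leaves `s₃² ∑
F(ζ_j) / (n (ζ_j - s₁)^{n-1})`, whose denominators are `∏_{k≠j}(ζ_j - ζ_k)` (`boundaryIntegral_eq`,
`prod_erase_sub`). The boundary may pass through the branch point, so the formula is proved on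
smaller circles and carried to the boundary by dominated convergence.

Jumps versus poles. Multiplying by a unipotent triangular matrix built from the pole sum trades the
poles inside a contour for a jump across it. Passing from jumps to poles yields a matrix continuous
across the contours and holomorphic off them; Lipschitz curves are removable for such functions
(`rectInt_eq_zero_of_lipschitz` and Morera). The two directions are `exists_poles_of_jumps` and
`exists_jumps_of_poles`.

The mCH equation. Reconstruction only uses the column sums of `M`. The first one at `z` and the
second one at `-z` solve the same scalar problem: poles at points `p` of the upper half plane with
residue `γ_p D(-p)`, and limit `1` at infinity. Uniqueness (`eq_zero_of_residue_conditions`) follows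
by applying Liouville to `D(z) D(z*)* + D(-z) D(-z*)*`, which on the real line is a sum of two
squares. Hence the residues are given by Cramer's rule with a nonzero determinant, and depend
smoothly on `(y,t)`.

Uniqueness also yields everything else. It gives the symmetries `conj_sol` and `sol_inv` under `z ↦
-z*` and `z ↦ -1/z`. It gives the Lax equations: `∂_y` and `∂_t` of the solution, corrected by
explicit multiples of `P(z)` and `P(-1/z)`, satisfy the same residue conditions and have only
removable further singularities, so they are constant multiples of the solution `P`
(`exists_y_evolution`, `t_evolution`). Evaluated at `0` and `±i` these become ordinary differential
equations for `C + i s = P(0)`, for the logarithmic derivatives `a`, `b` at `±i`, and for the shift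
`h = x - y` (`FlowData`). With `u = -(a + b)`, `u_x = a - b`, `m = s/C`, `x_y = C` and `x_t = u² -
u_x²`, the mCH equation is then an algebraic identity (`FlowData.isMCHSolution`).

The normalization at `i` enters through `Regular`: it forces `C > 0`, so that `y ↦ x` is increasing.
As `y → +∞` the coupling constants vanish; as `y → -∞` the nonzero ones blow up, and rescaling the
residue conditions turns them into conditions `P(-p) = 0`. Both limit problems ignore the sign of
the couplings, which forces `P(-1/z) = P(z)`. So `P` is stationary at `±i` and `u → 0`
(`tendsto_data`). -/

noncomputable section

namespace MCH

open Filter Set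

section

/-! ### Removable singularities and Liouville's theorem -/

/-- The function obtained from `f` by filling in removable singularities. -/
def fillIn (f : ℂ → ℂ) (z : ℂ) : ℂ := limUnder (𝓝[≠] z) f

theorem fillIn_eq_of_continuousAt {f : ℂ → ℂ} {z : ℂ} (h : ContinuousAt f z) :
    fillIn f z = f z :=
  (h.tendsto.mono_left nhdsWithin_le_nhds).limUnder_eq

theorem isLittleO_sub_inv_of_tendsto_mul {f : ℂ → ℂ} {c : ℂ}
    (h : Tendsto (fun z => (z - c) * f z) (𝓝[≠] c) (𝓝 0)) :
    (fun z => f z - f c) =o[𝓝[≠] c] fun z => (z - c)⁻¹ := by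
  refine (Asymptotics.isLittleO_iff_tendsto' ?_).2 ?_
  · filter_upwards [self_mem_nhdsWithin] with z hz h0
    exact absurd (inv_eq_zero.1 h0) (sub_ne_zero.2 hz)
  · have h2 : Tendsto (fun z => (z - c) * f c) (𝓝[≠] c) (𝓝 0) := by
      have : ContinuousAt (fun z : ℂ => (z - c) * f c) c := by fun_prop
      simpa using this.tendsto.mono_left (nhdsWithin_le_nhds (s := {c}ᶜ))
    have := h.sub h2
    simp only [sub_zero] at this
    refine this.congr fun z => ?_
    rw [div_inv_eq_mul]; ring

theorem tendsto_fillIn {f : ℂ → ℂ} {c : ℂ} (hd : ∀ᶠ z in 𝓝[≠] c, DifferentiableAt ℂ f z)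
    (h : Tendsto (fun z => (z - c) * f z) (𝓝[≠] c) (𝓝 0)) :
    Tendsto f (𝓝[≠] c) (𝓝 (fillIn f c)) :=
  Complex.tendsto_limUnder_of_differentiable_on_punctured_nhds_of_isLittleO hd
    (isLittleO_sub_inv_of_tendsto_mul h)

/-- Near `c` the function `fillIn f` is `f` with its value at `c` alone replaced by the limit,
because `f` is continuous at the neighbouring points; Riemann's theorem applies to that update. -/
theorem differentiableAt_fillIn {f : ℂ → ℂ} {c : ℂ}
    (hd : ∀ᶠ z in 𝓝[≠] c, DifferentiableAt ℂ f z)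
    (h : Tendsto (fun z => (z - c) * f z) (𝓝[≠] c) (𝓝 0)) :
    DifferentiableAt ℂ (fillIn f) c := by
  have hd' := hd
  rw [eventually_nhdsWithin_iff] at hd
  have h1 : DifferentiableOn ℂ f ({z | z ≠ c → DifferentiableAt ℂ f z} \ {c}) := fun z hz =>
    (hz.1 hz.2).differentiableWithinAt
  have H := (Complex.differentiableOn_update_limUnder_of_isLittleO hd h1
    (isLittleO_sub_inv_of_tendsto_mul h)).differentiableAt hd
  refine H.congr_of_eventuallyEq ?_
  filter_upwards [hd] with z hz
  by_cases hzc : z = c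
  · subst hzc; simp [fillIn]
  · rw [Function.update_of_ne hzc, fillIn_eq_of_continuousAt (hz hzc).continuousAt]

theorem tendsto_mul_of_differentiableAt {f : ℂ → ℂ} {c : ℂ} (h : ContinuousAt f c) :
    Tendsto (fun z => (z - c) * f z) (𝓝[≠] c) (𝓝 0) := by
  have : ContinuousAt (fun z : ℂ => (z - c) * f z) c := by fun_prop
  simpa using this.tendsto.mono_left (nhdsWithin_le_nhds (s := {c}ᶜ))

theorem eventually_notMem_of_finite {T : Set ℂ} (hT : T.Finite) (c : ℂ) :
    ∀ᶠ z in 𝓝[≠] c, z ∉ T := by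
  have : (T \ {c})ᶜ ∈ 𝓝 c := (hT.subset sdiff_subset).isClosed.isOpen_compl.mem_nhds (by simp)
  filter_upwards [mem_nhdsWithin_of_mem_nhds this, self_mem_nhdsWithin] with z hz hzc hzT
  exact hz ⟨hzT, hzc⟩

/-- A function with finitely many singularities, all of them removable, that has a limit at
infinity is constant. -/
theorem eq_of_removable_of_tendsto {T : Set ℂ} (hT : T.Finite) {f : ℂ → ℂ} {L : ℂ}
    (hd : ∀ z ∉ T, DifferentiableAt ℂ f z)
    (hs : ∀ s ∈ T, Tendsto (fun z => (z - s) * f z) (𝓝[≠] s) (𝓝 0))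
    (hL : Tendsto f (Bornology.cobounded ℂ) (𝓝 L)) : ∀ z ∉ T, f z = L := by
  have hfd : Differentiable ℂ (fillIn f) := fun c => by
    refine differentiableAt_fillIn ((eventually_notMem_of_finite hT c).mono hd) ?_
    by_cases hc : c ∈ T
    · exact hs c hc
    · exact tendsto_mul_of_differentiableAt (hd c hc).continuousAt
  have heq : ∀ z ∉ T, fillIn f z = f z := fun z hz =>
    fillIn_eq_of_continuousAt (hd z hz).continuousAt
  intro z hz
  rw [← heq z hz]
  refine hfd.apply_eq_of_tendsto_cocompact z ?_
  rw [← Metric.cobounded_eq_cocompact]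
  refine hL.congr' ?_
  have : Tᶜ ∈ Bornology.cobounded ℂ := Bornology.isBounded_def.1 hT.isBounded
  filter_upwards [this] with w hw
  exact (heq w hw).symm

theorem tendsto_neg_punctured (c : ℂ) : Tendsto (fun z : ℂ => -z) (𝓝[≠] c) (𝓝[≠] (-c)) := by
  refine tendsto_nhdsWithin_iff.2 ⟨continuousAt_neg.tendsto.mono_left nhdsWithin_le_nhds, ?_⟩
  filter_upwards [self_mem_nhdsWithin] with z hz h
  exact hz (neg_injective h)

theorem tendsto_neg_conj_punctured (c : ℂ) :
    Tendsto (fun z : ℂ => -conj z) (𝓝[≠] c) (𝓝[≠] (-conj c)) := by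
  refine tendsto_nhdsWithin_iff.2 ⟨?_, ?_⟩
  · exact (Complex.continuous_conj.neg.tendsto c).mono_left nhdsWithin_le_nhds
  · filter_upwards [self_mem_nhdsWithin] with z hz h
    exact hz (star_injective (neg_injective h))

theorem differentiableAt_conj_conj {f : ℂ → ℂ} {z : ℂ} (hf : DifferentiableAt ℂ f (conj z)) :
    DifferentiableAt ℂ (fun w => conj (f (conj w))) z := by
  have := DifferentiableAt.conj_conj hf
  simpa [Function.comp_def] using this

/-! ### Uniqueness for the scalar problem -/

section Vanishing

variable {ι : Type*} [Finite ι] {p : ι → ℂ} {τ : ι → ι}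

/-- Uniqueness for the scalar Riemann-Hilbert problem with poles at the points `p a` of the upper
half plane: a solution that vanishes at infinity is zero. -/
theorem eq_zero_of_residue_conditions (him : ∀ a, 0 < (p a).im) (hτ : ∀ a, p (τ a) = -conj (p a))
    {D : ℂ → ℂ} {ϖ δ γ : ι → ℂ} (hD : ∀ z ∉ range p, DifferentiableAt ℂ D z)
    (hres : ∀ a, Tendsto (fun z => (z - p a) * D z) (𝓝[≠] (p a)) (𝓝 (ϖ a)))
    (hcond : ∀ a, δ a * ϖ a = γ a * D (-p a)) (hne : ∀ a, δ a ≠ 0 ∨ γ a ≠ 0)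
    (hδ : ∀ a, δ (τ a) = conj (δ a)) (hγ : ∀ a, γ (τ a) = conj (γ a))
    (hinf : Tendsto D (Bornology.cobounded ℂ) (𝓝 0)) : ∀ z ∉ range p, D z = 0 := by
  have hlow : ∀ z : ℂ, z.im ≤ 0 → z ∉ range p := by
    rintro _ hz ⟨a, rfl⟩
    exact absurd (him a) (not_lt.2 hz)
  -- The two products have poles at the same points, and the residue conditions make the residues
  -- cancel in the sum. Evenness halves the work: only the poles at `p a` need checking.
  set H : ℂ → ℂ := fun z => D z * conj (D (conj z)) + D (-z) * conj (D (-conj z)) with hH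
  have hHneg : ∀ z, H (-z) = H z := fun z => by simp [hH]; ring
  have hHd : ∀ z ∉ range p ∪ range (fun a => -p a), DifferentiableAt ℂ H z := by
    intro z hz
    have h1 : z ∉ range p := fun h => hz (Or.inl h)
    have h2 : -z ∉ range p := by
      rintro ⟨a, ha⟩
      exact hz (Or.inr ⟨a, by simp [ha]⟩)
    have h3 : conj z ∉ range p := by
      rintro ⟨a, ha⟩
      exact hz (Or.inr ⟨τ a, by simp [hτ, ha]⟩)
    have h4 : -conj z ∉ range p := by
      rintro ⟨a, ha⟩
      exact hz (Or.inl ⟨τ a, by simp [hτ, ha]⟩)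
    have d2 : DifferentiableAt ℂ (fun w => D (-w)) z :=
      DifferentiableAt.comp z (hD _ h2) differentiableAt_id.neg
    have d2' : DifferentiableAt ℂ (fun w => D (-w)) (conj z) :=
      DifferentiableAt.comp (conj z) (hD _ h4) differentiableAt_id.neg
    exact ((hD z h1).mul (differentiableAt_conj_conj (hD _ h3))).add
      (d2.mul (differentiableAt_conj_conj d2'))
  have hHp : ∀ a, Tendsto (fun z => (z - p a) * H z) (𝓝[≠] (p a)) (𝓝 0) := by
    intro a
    have c1 : Tendsto (fun z => conj (D (conj z))) (𝓝[≠] (p a)) (𝓝 (conj (D (conj (p a))))) := by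
      have : DifferentiableAt ℂ D (conj (p a)) := hD _ (hlow _ (by simpa using (him a).le))
      exact (differentiableAt_conj_conj this).continuousAt.tendsto.mono_left nhdsWithin_le_nhds
    have c2 : Tendsto (fun z => D (-z)) (𝓝[≠] (p a)) (𝓝 (D (-p a))) := by
      have : DifferentiableAt ℂ D (-p a) := hD _ (hlow _ (by simpa using (him a).le))
      exact this.continuousAt.tendsto.comp ((tendsto_neg_punctured _).mono_right nhdsWithin_le_nhds)
    have c3 : Tendsto (fun z => (z - p a) * conj (D (-conj z))) (𝓝[≠] (p a))
        (𝓝 (-conj (ϖ (τ a)))) := by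
      have h := hres (τ a)
      rw [hτ] at h
      have h' := h.comp (tendsto_neg_conj_punctured (p a))
      have h'' := ((Complex.continuous_conj.tendsto _).comp h').neg
      refine h''.congr fun z => ?_
      simp only [Function.comp, map_mul, map_sub, map_neg, Complex.conj_conj]
      ring
    have := ((hres a).mul c1).add (c2.mul c3)
    -- This is the determinant of the two relations `e1` and `e2`, which are linear in `(δ a, γ a) ≠
    -- 0`; hence it vanishes. The homogeneous form admits `δ a = 0`, the case of an infinite
    -- coupling constant.
    have hz : ϖ a * conj (D (conj (p a))) + D (-p a) * -conj (ϖ (τ a)) = 0 := by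
      have e1 := hcond a
      have e2 : δ a * conj (ϖ (τ a)) = γ a * conj (D (conj (p a))) := by
        have := congrArg conj (hcond (τ a))
        simpa [hδ, hγ, hτ] using this
      rcases hne a with h0 | h0
      · refine (mul_right_inj' h0).1 ?_
        linear_combination conj (D (conj (p a))) * e1 - D (-p a) * e2
      · refine (mul_right_inj' h0).1 ?_
        linear_combination conj (ϖ (τ a)) * e1 - ϖ a * e2
    rw [hz] at this
    refine this.congr fun z => ?_
    simp only [hH]; ring
  have hHinf : Tendsto H (Bornology.cobounded ℂ) (𝓝 0) := by
    have n1 : Tendsto (fun z : ℂ => -z) (Bornology.cobounded ℂ) (Bornology.cobounded ℂ) := by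
      simp [← tendsto_norm_atTop_iff_cobounded, tendsto_norm_cobounded_atTop]
    have n2 : Tendsto (fun z : ℂ => conj z) (Bornology.cobounded ℂ) (Bornology.cobounded ℂ) := by
      simp [← tendsto_norm_atTop_iff_cobounded, tendsto_norm_cobounded_atTop]
    have k : Tendsto (fun z : ℂ => conj z) (𝓝 0) (𝓝 0) := by
      simpa using Complex.continuous_conj.tendsto 0
    have := (hinf.mul (k.comp (hinf.comp n2))).add
      ((hinf.comp n1).mul (k.comp (hinf.comp (n1.comp n2))))
    simpa [hH, Function.comp_def] using this
  have hH0 := eq_of_removable_of_tendsto ((finite_range p).union (finite_range _)) hHd (by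
    rintro s (⟨a, rfl⟩ | ⟨a, rfl⟩)
    · exact hHp a
    · have := ((hHp a).comp (tendsto_neg_punctured (-p a) |>.mono_right (by simp))).neg
      simp only [neg_zero] at this
      refine this.congr fun z => ?_
      simp only [Function.comp, hHneg]; ring) hHinf
  -- On the real axis `H x = |D x|² + |D (-x)|²`, so `H = 0` kills `D` there, and the identity
  -- theorem on the connected complement of the poles finishes.
  have hreal : ∀ x : ℝ, D x = 0 := by
    intro x
    have := hH0 x (by
      rintro (h | ⟨a, ha⟩)
      · exact hlow _ (by simp) h
      · have := congrArg Complex.im ha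
        simp at this
        exact (him a).ne' this)
    simp only [hH, Complex.conj_ofReal, Complex.mul_conj] at this
    have h' : Complex.normSq (D x) + Complex.normSq (D (-x)) = 0 := by exact_mod_cast this
    have h0 : Complex.normSq (D x) = 0 :=
      le_antisymm (by linarith [Complex.normSq_nonneg (D (-x))]) (Complex.normSq_nonneg _)
    exact Complex.normSq_eq_zero.1 h0
  have hopen : IsOpen (range p)ᶜ := (finite_range p).isClosed.isOpen_compl
  have hconn : IsPreconnected (range p)ᶜ :=
    ((finite_range p).countable.isPathConnected_compl_of_one_lt_rank (by
      simp [Complex.rank_real_complex])).isConnected.isPreconnected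
  have han : AnalyticOnNhd ℂ D (range p)ᶜ :=
    DifferentiableOn.analyticOnNhd (fun z hz => (hD z hz).differentiableWithinAt) hopen
  have := han.eqOn_zero_of_preconnected_of_frequently_eq_zero hconn (z₀ := 0)
    (hlow 0 (by simp)) (by
      have ht : Tendsto (fun x : ℝ => (x : ℂ)) (𝓝[≠] 0) (𝓝[≠] 0) := by
        refine tendsto_nhdsWithin_iff.2 ⟨?_, ?_⟩
        · simpa using (Complex.continuous_ofReal.tendsto 0).mono_left
            (nhdsWithin_le_nhds (s := {0}ᶜ))
        · filter_upwards [self_mem_nhdsWithin] with x hx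
          simpa using hx
      exact ht.frequently (Eventually.frequently (Eventually.of_forall fun x => hreal x)))
  exact fun z hz => this hz

/-- The version of `eq_zero_of_residue_conditions` that allows for further removable
singularities. -/
theorem eq_zero_of_residue_conditions' (him : ∀ a, 0 < (p a).im)
    (hτ : ∀ a, p (τ a) = -conj (p a)) {T : Set ℂ} (hT : T.Finite)
    {D : ℂ → ℂ} {ϖ δ γ ℓ : ι → ℂ} (hD : ∀ z ∉ T, DifferentiableAt ℂ D z)
    (hs : ∀ s ∈ T, s ∉ range p → Tendsto (fun z => (z - s) * D z) (𝓝[≠] s) (𝓝 0))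
    (hres : ∀ a, Tendsto (fun z => (z - p a) * D z) (𝓝[≠] (p a)) (𝓝 (ϖ a)))
    (hlim : ∀ a, Tendsto D (𝓝[≠] (-p a)) (𝓝 (ℓ a)))
    (hcond : ∀ a, δ a * ϖ a = γ a * ℓ a) (hne : ∀ a, δ a ≠ 0 ∨ γ a ≠ 0)
    (hδ : ∀ a, δ (τ a) = conj (δ a)) (hγ : ∀ a, γ (τ a) = conj (γ a))
    (hinf : Tendsto D (Bornology.cobounded ℂ) (𝓝 0)) : ∀ z ∉ T, z ∉ range p → D z = 0 := by
  have heq : ∀ z ∉ T, fillIn D z = D z := fun z hz =>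
    fillIn_eq_of_continuousAt (hD z hz).continuousAt
  have hev : ∀ c, ∀ᶠ z in 𝓝[≠] c, fillIn D z = D z := fun c =>
    (eventually_notMem_of_finite hT c).mono heq
  intro z hz hzp
  rw [← heq z hz]
  refine eq_zero_of_residue_conditions him hτ (D := fillIn D) (ϖ := ϖ) (δ := δ) (γ := γ) ?_ ?_ ?_
    hne hδ hγ ?_ z hzp
  · intro c hc
    refine differentiableAt_fillIn ((eventually_notMem_of_finite hT c).mono hD) ?_
    by_cases hcT : c ∈ T
    · exact hs c hcT hc
    · exact tendsto_mul_of_differentiableAt (hD c hcT).continuousAt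
  · intro a
    refine (hres a).congr' ?_
    filter_upwards [hev (p a)] with w hw
    rw [hw]
  · intro a
    rw [hcond, fillIn, (hlim a).limUnder_eq]
  · refine hinf.congr' ?_
    have : Tᶜ ∈ Bornology.cobounded ℂ := Bornology.isBounded_def.1 hT.isBounded
    filter_upwards [this] with w hw
    exact (heq w hw).symm

end Vanishing

end

section

/-! ### The scalar problem and its rational solution -/

/-- A configuration of poles in the upper half plane that is symmetric under `z ↦ -conj z` and
`z ↦ -1/z`. -/
structure PoleSystem (ι : Type*) where
  pt : ι → ℂ
  refl : ι → ι
  inv : ι → ι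
  injective : Function.Injective pt
  im_pos : ∀ a, 0 < (pt a).im
  pt_refl : ∀ a, pt (refl a) = -conj (pt a)
  pt_inv : ∀ a, pt (inv a) = -1 / pt a
  ne_I : ∀ a, pt a ≠ Complex.I

namespace PoleSystem

variable {ι : Type*} [Fintype ι] [DecidableEq ι] (S : PoleSystem ι)

/-- Coefficients that are symmetric under the reflection `z ↦ -conj z`. -/
def Symm (γ : ι → ℂ) : Prop := ∀ a, γ (S.refl a) = conj (γ a)

/-- The sum of simple poles with residues `ϖ`. -/
def poleSum (ϖ : ι → ℂ) (z : ℂ) : ℂ := ∑ a, ϖ a / (z - S.pt a)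

/-- The matrix of the linear system for the residues. -/
def sysMatrix (δ γ : ι → ℂ) : Matrix ι ι ℂ :=
  Matrix.of fun a b => (if a = b then δ a else 0) + γ a / (S.pt a + S.pt b)

/-- The residues of the solution of the scalar problem. -/
def resid (δ γ : ι → ℂ) : ι → ℂ :=
  fun a => ((S.sysMatrix δ γ).det)⁻¹ * (S.sysMatrix δ γ).cramer γ a

variable {S}

omit [Fintype ι] [DecidableEq ι] in
theorem pt_ne_zero (a : ι) : S.pt a ≠ 0 := fun h => by
  have := S.im_pos a
  simp [h] at this

omit [Fintype ι] [DecidableEq ι] in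
theorem neg_notMem_range {z : ℂ} (hz : 0 ≤ z.im) : -z ∉ range S.pt := by
  rintro ⟨a, ha⟩
  have := S.im_pos a
  rw [ha] at this
  simp at this
  linarith

omit [Fintype ι] [DecidableEq ι] in
theorem notMem_range {z : ℂ} (hz : z.im ≤ 0) : z ∉ range S.pt := by
  simpa using neg_notMem_range (S := S) (z := -z) (by simpa using hz)

omit [DecidableEq ι] in
theorem differentiableAt_poleSum (ϖ : ι → ℂ) {z : ℂ} (hz : z ∉ range S.pt) :
    DifferentiableAt ℂ (S.poleSum ϖ) z := by
  unfold poleSum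
  refine DifferentiableAt.fun_sum fun a _ => ?_
  have : z - S.pt a ≠ 0 := sub_ne_zero.2 fun h => hz ⟨a, h.symm⟩
  fun_prop (disch := assumption)

theorem tendsto_poleSum_residue (ϖ : ι → ℂ) (a : ι) :
    Tendsto (fun z => (z - S.pt a) * S.poleSum ϖ z) (𝓝[≠] (S.pt a)) (𝓝 (ϖ a)) := by
  have h1 : ContinuousAt (fun z => ϖ a + (z - S.pt a) *
      ∑ b ∈ Finset.univ.erase a, ϖ b / (z - S.pt b)) (S.pt a) := by
    refine continuousAt_const.add (ContinuousAt.mul (by fun_prop) ?_)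
    refine tendsto_finsetSum _ fun b hb => ?_
    have : S.pt a - S.pt b ≠ 0 := sub_ne_zero.2 fun h =>
      (Finset.ne_of_mem_erase hb) (S.injective h).symm
    exact ContinuousAt.div (by fun_prop) (by fun_prop) this
  have h2 := h1.tendsto.mono_left (nhdsWithin_le_nhds (s := {S.pt a}ᶜ))
  simp only [sub_self, zero_mul, add_zero] at h2
  refine h2.congr' ?_
  filter_upwards [self_mem_nhdsWithin] with z hz
  have : z - S.pt a ≠ 0 := sub_ne_zero.2 hz
  rw [poleSum, ← Finset.add_sum_erase _ _ (Finset.mem_univ a), mul_add]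
  congr 1
  field_simp

omit [DecidableEq ι] in
theorem tendsto_poleSum_infinity (ϖ : ι → ℂ) :
    Tendsto (S.poleSum ϖ) (Bornology.cobounded ℂ) (𝓝 0) := by
  have : ∀ a, Tendsto (fun z => ϖ a / (z - S.pt a)) (Bornology.cobounded ℂ) (𝓝 0) := by
    intro a
    have h1 : Tendsto (fun z : ℂ => z - S.pt a) (Bornology.cobounded ℂ)
        (Bornology.cobounded ℂ) := by
      simp [sub_eq_add_neg]
    simpa [div_eq_mul_inv] using (tendsto_inv₀_cobounded.comp h1).const_mul (ϖ a)
  simpa using! tendsto_finsetSum Finset.univ fun a _ => this a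

omit [DecidableEq ι] in
theorem tendsto_mul_poleSum_infinity (ϖ : ι → ℂ) :
    Tendsto (fun z => z * S.poleSum ϖ z) (Bornology.cobounded ℂ) (𝓝 (∑ a, ϖ a)) := by
  have h := (tendsto_poleSum_infinity (S := S) fun a => ϖ a * S.pt a).const_add (∑ a, ϖ a)
  rw [add_zero] at h
  refine h.congr' ?_
  have : (range S.pt)ᶜ ∈ Bornology.cobounded ℂ :=
    Bornology.isBounded_def.1 (finite_range S.pt).isBounded
  filter_upwards [this] with z hz
  rw [poleSum, poleSum, Finset.mul_sum, ← Finset.sum_add_distrib]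
  refine Finset.sum_congr rfl fun a _ => ?_
  have : z - S.pt a ≠ 0 := sub_ne_zero.2 fun h => hz ⟨a, h.symm⟩
  field_simp; ring

/-- The entries `1 / (p_a + p_b)` are `-1 / (-p_a - p_b)`, so the matrix evaluates the pole sum at
the reflected points. The linear system with right-hand side `γ` therefore states the residue
conditions for `1 + poleSum`. -/
theorem sysMatrix_mulVec (δ γ v : ι → ℂ) (a : ι) :
    (S.sysMatrix δ γ).mulVec v a = δ a * v a - γ a * S.poleSum v (-S.pt a) := by
  simp only [Matrix.mulVec, dotProduct, sysMatrix, Matrix.of_apply, add_mul,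
    Finset.sum_add_distrib, poleSum]
  simp only [ite_mul, zero_mul, Finset.sum_ite_eq, Finset.mem_univ, if_true, sub_eq_add_neg]
  congr 1
  rw [Finset.mul_sum, ← Finset.sum_neg_distrib]
  refine Finset.sum_congr rfl fun b _ => ?_
  rw [show -S.pt a + -S.pt b = -(S.pt a + S.pt b) by ring, div_neg]
  ring

/-- A kernel vector is the residue vector of a solution of the homogeneous scalar problem, which
vanishes by uniqueness. -/
theorem det_sysMatrix_ne_zero {δ γ : ι → ℂ} (hne : ∀ a, δ a ≠ 0 ∨ γ a ≠ 0) (hδ : S.Symm δ)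
    (hγ : S.Symm γ) : (S.sysMatrix δ γ).det ≠ 0 := by
  intro h
  obtain ⟨v, hv0, hv⟩ := Matrix.exists_mulVec_eq_zero_iff.2 h
  refine hv0 (funext fun a => ?_)
  have hz := eq_zero_of_residue_conditions S.im_pos S.pt_refl (D := S.poleSum v) (ϖ := v)
    (δ := δ) (γ := γ) (fun z hz => differentiableAt_poleSum v hz)
    (fun a => tendsto_poleSum_residue v a) (fun a => by
      have := congrFun hv a
      rw [sysMatrix_mulVec] at this
      exact sub_eq_zero.1 this) hne hδ hγ (tendsto_poleSum_infinity v)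
  have h0 : Tendsto (fun z => (z - S.pt a) * S.poleSum v z) (𝓝[≠] (S.pt a)) (𝓝 0) := by
    refine tendsto_const_nhds.congr' ?_
    filter_upwards [eventually_notMem_of_finite (finite_range S.pt) (S.pt a)] with z hzr
    rw [hz z hzr, mul_zero]
  exact tendsto_nhds_unique (tendsto_poleSum_residue v a) h0

theorem resid_spec {δ γ : ι → ℂ} (hne : ∀ a, δ a ≠ 0 ∨ γ a ≠ 0) (hδ : S.Symm δ)
    (hγ : S.Symm γ) (a : ι) :
    δ a * S.resid δ γ a = γ a * (1 + S.poleSum (S.resid δ γ) (-S.pt a)) := by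
  have hdet := det_sysMatrix_ne_zero hne hδ hγ
  have h : (S.sysMatrix δ γ).mulVec (S.resid δ γ) = γ := by
    have : S.resid δ γ = ((S.sysMatrix δ γ).det)⁻¹ • (S.sysMatrix δ γ).cramer γ := rfl
    rw [this, Matrix.mulVec_smul, Matrix.mulVec_cramer, smul_smul, inv_mul_cancel₀ hdet, one_smul]
  have := congrFun h a
  rw [sysMatrix_mulVec] at this
  linear_combination this

/-- The tool behind all symmetry identities: to identify a transformed pole sum it suffices to check
its residue equations and its constant term `c`. -/
theorem resid_unique {δ γ v : ι → ℂ} {c : ℂ} (hne : ∀ a, δ a ≠ 0 ∨ γ a ≠ 0) (hδ : S.Symm δ)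
    (hγ : S.Symm γ) (hv : ∀ a, δ a * v a = γ a * (c + S.poleSum v (-S.pt a))) :
    v = c • S.resid δ γ := by
  have hdet := det_sysMatrix_ne_zero hne hδ hγ
  by_contra h
  refine hdet (Matrix.exists_mulVec_eq_zero_iff.1 ⟨v - c • S.resid δ γ, sub_ne_zero.2 h, ?_⟩)
  funext a
  have h1 := hv a
  have h2 := resid_spec hne hδ hγ a
  rw [Matrix.mulVec_sub, Matrix.mulVec_smul, Pi.sub_apply, Pi.smul_apply, sysMatrix_mulVec,
    sysMatrix_mulVec]
  simp only [Pi.zero_apply, smul_eq_mul]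
  linear_combination h1 - c * h2

/-- In the decoupled case the sign of the coupling constants is irrelevant. -/
theorem resid_neg_of_mul_eq_zero {δ γ : ι → ℂ} (hne : ∀ a, δ a ≠ 0 ∨ γ a ≠ 0) (hδ : S.Symm δ)
    (hγ : S.Symm γ) (h0 : ∀ a, δ a * γ a = 0) : S.resid δ (-γ) = S.resid δ γ := by
  have hγ' : S.Symm (-γ) := fun a => by simp [hγ a]
  rw [← one_smul ℂ (S.resid δ (-γ))]
  refine (resid_unique (by simpa using hne) hδ hγ' fun a => ?_).symm
  have := resid_spec hne hδ hγ a
  rcases mul_eq_zero.1 (h0 a) with h | h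
  · rw [h, zero_mul] at this ⊢
    rw [Pi.neg_apply, neg_mul, ← this, neg_zero]
  · simp only [h, zero_mul, Pi.neg_apply, neg_zero] at this ⊢
    exact this

/-- Only the ratio `δ a : γ a` matters. This permits rescaling couplings that tend to infinity
before passing to the limit. -/
theorem resid_smul {δ γ ε : ι → ℂ} (hne : ∀ a, δ a ≠ 0 ∨ γ a ≠ 0) (hδ : S.Symm δ)
    (hγ : S.Symm γ) (hε : S.Symm ε) (hε0 : ∀ a, ε a ≠ 0) :
    S.resid (ε * δ) (ε * γ) = S.resid δ γ := by
  rw [← one_smul ℂ (S.resid (ε * δ) (ε * γ))]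
  refine (resid_unique (fun a => ?_) (fun a => ?_) (fun a => ?_) fun a => ?_).symm
  · simpa [hε0 a] using hne a
  · simp [hε a, hδ a]
  · simp [hε a, hγ a]
  · simp only [Pi.mul_apply]
    rw [mul_assoc, mul_assoc, resid_spec hne hδ hγ a]

omit [DecidableEq ι] in
theorem tendsto_det {α : Type*} [DecidableEq ι] {l : Filter α} {A : α → Matrix ι ι ℂ}
    {B : Matrix ι ι ℂ} (h : Tendsto A l (𝓝 B)) : Tendsto (fun x => (A x).det) l (𝓝 B.det) :=
  ((continuous_id.matrix_det).tendsto B).comp h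

/-- Cramer's rule is a quotient of polynomials in the data, so only the determinant of the limit
problem has to be nonzero; symmetry is needed for `δ₀` and `γ₀` alone. -/
theorem tendsto_resid {α : Type*} {l : Filter α} {δ γ : α → ι → ℂ} {δ₀ γ₀ : ι → ℂ}
    (hne : ∀ a, δ₀ a ≠ 0 ∨ γ₀ a ≠ 0) (hδ₀ : S.Symm δ₀) (hγ₀ : S.Symm γ₀)
    (hδ : ∀ a, Tendsto (fun x => δ x a) l (𝓝 (δ₀ a)))
    (hγ : ∀ a, Tendsto (fun x => γ x a) l (𝓝 (γ₀ a))) (a : ι) :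
    Tendsto (fun x => S.resid (δ x) (γ x) a) l (𝓝 (S.resid δ₀ γ₀ a)) := by
  have hA : Tendsto (fun x => S.sysMatrix (δ x) (γ x)) l (𝓝 (S.sysMatrix δ₀ γ₀)) := by
    refine tendsto_pi_nhds.2 fun b => tendsto_pi_nhds.2 fun c => ?_
    simp only [sysMatrix, Matrix.of_apply]
    refine Tendsto.add ?_ ((hγ b).div_const _)
    split_ifs
    · exact hδ b
    · exact tendsto_const_nhds
  refine ((tendsto_det hA).inv₀ (det_sysMatrix_ne_zero hne hδ₀ hγ₀)).mul ?_
  simp only [Matrix.cramer_apply]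
  refine tendsto_det (tendsto_pi_nhds.2 fun b => tendsto_pi_nhds.2 fun c => ?_)
  simp only [Matrix.updateCol_apply]
  split_ifs
  · exact hγ b
  · exact tendsto_pi_nhds.1 (tendsto_pi_nhds.1 hA b) c

theorem contDiff_det {E : Type*} [NormedAddCommGroup E] [NormedSpace ℝ E] {n : WithTop ℕ∞}
    {A : E → Matrix ι ι ℂ} (h : ∀ a b, ContDiff ℝ n fun x => A x a b) :
    ContDiff ℝ n fun x => (A x).det := by
  simp only [Matrix.det_apply]
  exact ContDiff.sum fun σ _ => (contDiff_prod fun a _ => h _ _).const_smul _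

theorem contDiff_resid {E : Type*} [NormedAddCommGroup E] [NormedSpace ℝ E] {n : WithTop ℕ∞}
    {γ : E → ι → ℂ} (hγ : ∀ x, S.Symm (γ x)) (h : ∀ a, ContDiff ℝ n fun x => γ x a) (a : ι) :
    ContDiff ℝ n fun x => S.resid 1 (γ x) a := by
  have hA : ∀ b c, ContDiff ℝ n fun x => S.sysMatrix 1 (γ x) b c := by
    intro b c
    simp only [sysMatrix, Matrix.of_apply]
    exact contDiff_const.add ((h b).div_const _)
  refine ((contDiff_det hA).inv fun x => ?_).mul ?_
  · exact det_sysMatrix_ne_zero (by simp) (fun a => by simp) (hγ x)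
  · simp only [Matrix.cramer_apply]
    refine contDiff_det fun b c => ?_
    simp only [Matrix.updateCol_apply]
    split_ifs
    · exact h b
    · exact hA b c

end PoleSystem

end

/-! ### Symmetries and characterization of the scalar solution -/

section

namespace PoleSystem

variable {ι : Type*} [Fintype ι] [DecidableEq ι] {S : PoleSystem ι}

/-- The solution of the scalar problem that is normalized to `1` at infinity. -/
def sol (S : PoleSystem ι) (γ : ι → ℂ) (z : ℂ) : ℂ := 1 + S.poleSum (S.resid 1 γ) z

theorem resid_one_spec {γ : ι → ℂ} (hγ : S.Symm γ) (a : ι) :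
    S.resid 1 γ a = γ a * S.sol γ (-S.pt a) := by
  have := resid_spec (S := S) (δ := 1) (by simp) (fun a => by simp) hγ a
  rwa [Pi.one_apply, one_mul] at this

theorem resid_one_unique {γ v : ι → ℂ} {c : ℂ} (hγ : S.Symm γ)
    (hv : ∀ a, v a = γ a * (c + S.poleSum v (-S.pt a))) : v = c • S.resid 1 γ :=
  resid_unique (by simp) (fun a => by simp) hγ (by simpa using hv)

theorem differentiableAt_sol (γ : ι → ℂ) {z : ℂ} (hz : z ∉ range S.pt) :
    DifferentiableAt ℂ (S.sol γ) z :=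
  (differentiableAt_poleSum _ hz).const_add 1

theorem tendsto_sol_infinity (γ : ι → ℂ) :
    Tendsto (S.sol γ) (Bornology.cobounded ℂ) (𝓝 1) := by
  simpa using! (tendsto_poleSum_infinity (S := S) (S.resid 1 γ)).const_add 1

omit [Fintype ι] [DecidableEq ι] in
theorem refl_refl (a : ι) : S.refl (S.refl a) = a :=
  S.injective (by simp [S.pt_refl])

omit [Fintype ι] [DecidableEq ι] in
theorem inv_inv (a : ι) : S.inv (S.inv a) = a :=
  S.injective (by simp [S.pt_inv])

/-- `S.refl` as a permutation. -/
def reflEquiv (S : PoleSystem ι) : ι ≃ ι := ⟨S.refl, S.refl, refl_refl, refl_refl⟩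

/-- `S.inv` as a permutation. -/
def invEquiv (S : PoleSystem ι) : ι ≃ ι := ⟨S.inv, S.inv, inv_inv, inv_inv⟩

omit [DecidableEq ι] in
theorem poleSum_refl (ϖ : ι → ℂ) (z : ℂ) :
    S.poleSum (fun a => -conj (ϖ (S.refl a))) z = conj (S.poleSum ϖ (-conj z)) := by
  simp only [poleSum, map_sum]
  refine Fintype.sum_equiv S.reflEquiv _ _ fun a => ?_
  simp only [reflEquiv, Equiv.coe_fn_mk, map_div₀, map_sub, map_neg, Complex.conj_conj, S.pt_refl]
  rw [neg_div, ← div_neg]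
  congr 1; ring

/-- Reflection maps the poles to themselves but negates residues up to conjugation, so the reflected
function solves the problem with coupling `-γ`; uniqueness identifies it. -/
theorem conj_sol {γ : ι → ℂ} (hγ : S.Symm γ) (z : ℂ) :
    conj (S.sol γ (-conj z)) = S.sol (-γ) z := by
  have hγ' : S.Symm (-γ) := fun a => by simp [hγ a]
  have := resid_one_unique (S := S) (γ := -γ) (c := 1)
    (v := fun a => -conj (S.resid 1 γ (S.refl a))) hγ' (fun a => by
      rw [poleSum_refl, resid_one_spec hγ, S.pt_refl, hγ]
      simp [sol])
  rw [one_smul] at this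
  simp only [sol, ← this, poleSum_refl, map_add, map_one]

omit [DecidableEq ι] in
theorem poleSum_inv (ϖ : ι → ℂ) {z : ℂ} (hz0 : z ≠ 0) (hz : z ∉ range S.pt) :
    S.poleSum ϖ (-1 / z) =
      S.poleSum ϖ 0 + S.poleSum (fun a => ϖ (S.inv a) * S.pt a ^ 2) z := by
  have : S.poleSum (fun a => ϖ (S.inv a) * S.pt a ^ 2) z
      = ∑ a, ϖ a * S.pt (S.inv a) ^ 2 / (z - S.pt (S.inv a)) := by
    refine Fintype.sum_equiv S.invEquiv _ _ fun a => ?_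
    simp only [invEquiv, Equiv.coe_fn_mk, inv_inv]
  rw [this, poleSum, poleSum, ← Finset.sum_add_distrib]
  refine Finset.sum_congr rfl fun a _ => ?_
  have hp := pt_ne_zero (S := S) a
  have h1 : z - S.pt (S.inv a) ≠ 0 := sub_ne_zero.2 fun h => hz ⟨_, h.symm⟩
  rw [S.pt_inv] at h1 ⊢
  have h2 : z * S.pt a + 1 ≠ 0 := by
    intro h
    apply h1
    field_simp
    linear_combination h
  have h3 : -1 / z - S.pt a ≠ 0 := by
    intro h
    apply h2
    field_simp at h
    linear_combination -h
  have h4 : -1 - z * S.pt a ≠ 0 := by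
    intro h
    apply h2
    linear_combination -h
  rw [show -1 / z - S.pt a = (-1 - z * S.pt a) / z by field_simp,
    show z - -1 / S.pt a = (z * S.pt a + 1) / S.pt a by field_simp; ring]
  rw [show -1 - z * S.pt a = -(z * S.pt a + 1) by ring]
  field_simp
  ring

/-- Coefficients that are symmetric under the inversion `z ↦ -1/z`. -/
def InvSymm (S : PoleSystem ι) (γ : ι → ℂ) : Prop := ∀ a, γ (S.inv a) = -(γ a / S.pt a ^ 2)

/-- Under `z ↦ -1/z` the residues pick up the factor `p²`, which `InvSymm` compensates up to a sign.
The transformed function thus solves the problem for `-γ`, with the value at infinity equal to the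
old value at `0`. -/
theorem sol_inv {γ : ι → ℂ} (hγ : S.Symm γ) (hγi : S.InvSymm γ) {z : ℂ} (hz0 : z ≠ 0)
    (hz : z ∉ range S.pt) : S.sol γ (-1 / z) = S.sol γ 0 * S.sol (-γ) z := by
  have hγ' : S.Symm (-γ) := fun a => by simp [hγ a]
  have := resid_one_unique (S := S) (γ := -γ) (c := S.sol γ 0)
    (v := fun a => S.resid 1 γ (S.inv a) * S.pt a ^ 2) hγ' (fun a => by
      have hp := pt_ne_zero (S := S) a
      have h := poleSum_inv (S := S) (S.resid 1 γ) (neg_ne_zero.2 hp)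
        (neg_notMem_range (S.im_pos a).le)
      rw [resid_one_spec hγ, S.pt_inv, hγi]
      simp only [sol, Pi.neg_apply]
      rw [add_assoc, ← h, show -(-1 / S.pt a) = -1 / -S.pt a by rw [div_neg, neg_div]]
      field_simp)
  rw [sol, poleSum_inv _ hz0 hz, this, ← add_assoc]
  change S.sol γ 0 + _ = _
  simp only [sol, poleSum, Pi.smul_apply, smul_eq_mul, mul_add, mul_one, Finset.mul_sum,
    mul_div_assoc]

/-! ### Residue conditions -/

/-- `D` has at most simple poles at the points `S.pt a`, with residues `γ a * D (-S.pt a)`. -/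
def ResidueConditions (S : PoleSystem ι) (γ : ι → ℂ) (D : ℂ → ℂ) : Prop :=
  ∀ a, ∃ ℓ, Tendsto D (𝓝[≠] (-S.pt a)) (𝓝 ℓ) ∧
    Tendsto (fun z => (z - S.pt a) * D z) (𝓝[≠] (S.pt a)) (𝓝 (γ a * ℓ))

omit [Fintype ι] [DecidableEq ι] in
theorem ResidueConditions.add {γ : ι → ℂ} {D E : ℂ → ℂ} (hD : S.ResidueConditions γ D)
    (hE : S.ResidueConditions γ E) : S.ResidueConditions γ (fun z => D z + E z) := by
  intro a
  obtain ⟨ℓ, h1, h2⟩ := hD a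
  obtain ⟨m, h3, h4⟩ := hE a
  exact ⟨ℓ + m, h1.add h3, by simpa [mul_add] using h2.add h4⟩

omit [Fintype ι] [DecidableEq ι] in
theorem ResidueConditions.mul_even {γ : ι → ℂ} {c D : ℂ → ℂ} (hD : S.ResidueConditions γ D)
    (hc : ∀ a, ContinuousAt c (S.pt a)) (hc' : ∀ a, ContinuousAt c (-S.pt a))
    (he : ∀ a, c (-S.pt a) = c (S.pt a)) : S.ResidueConditions γ (fun z => c z * D z) := by
  intro a
  obtain ⟨ℓ, h1, h2⟩ := hD a
  refine ⟨c (-S.pt a) * ℓ, ((hc' a).tendsto.mono_left nhdsWithin_le_nhds).mul h1, ?_⟩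
  have := ((hc a).tendsto.mono_left (nhdsWithin_le_nhds (s := {S.pt a}ᶜ))).mul h2
  rw [he, show γ a * (c (S.pt a) * ℓ) = c (S.pt a) * (γ a * ℓ) by ring]
  refine this.congr fun z => by ring

-- An odd multiplier absorbs the sign of the coupling. This is how the companion solution `sol
-- (-γ)`, that is `z ↦ sol γ (-1/z)` up to a constant, can enter the evolution equations for `sol
-- γ`.
omit [Fintype ι] [DecidableEq ι] in
theorem ResidueConditions.mul_odd {γ : ι → ℂ} {c D : ℂ → ℂ} (hD : S.ResidueConditions (-γ) D)
    (hc : ∀ a, ContinuousAt c (S.pt a)) (hc' : ∀ a, ContinuousAt c (-S.pt a))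
    (ho : ∀ a, c (-S.pt a) = -c (S.pt a)) : S.ResidueConditions γ (fun z => c z * D z) := by
  intro a
  obtain ⟨ℓ, h1, h2⟩ := hD a
  refine ⟨c (-S.pt a) * ℓ, ((hc' a).tendsto.mono_left nhdsWithin_le_nhds).mul h1, ?_⟩
  have := ((hc a).tendsto.mono_left (nhdsWithin_le_nhds (s := {S.pt a}ᶜ))).mul h2
  rw [ho, show γ a * (-c (S.pt a) * ℓ) = c (S.pt a) * ((-γ) a * ℓ) by simp; ring]
  refine this.congr fun z => by ring

theorem tendsto_sol_residue (γ : ι → ℂ) (a : ι) :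
    Tendsto (fun z => (z - S.pt a) * S.sol γ z) (𝓝[≠] (S.pt a)) (𝓝 (S.resid 1 γ a)) := by
  have h : Tendsto (fun z => (z - S.pt a) * 1) (𝓝[≠] (S.pt a)) (𝓝 0) :=
    tendsto_mul_of_differentiableAt (f := fun _ => 1) continuousAt_const
  simpa [sol, mul_add] using h.add (tendsto_poleSum_residue (S.resid 1 γ) a)

omit [Fintype ι] [DecidableEq ι] in
theorem tendsto_neg_pt {D : ℂ → ℂ} {a : ι} (hD : ∀ z ∉ range S.pt, DifferentiableAt ℂ D z) :
    Tendsto D (𝓝[≠] (-S.pt a)) (𝓝 (D (-S.pt a))) :=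
  (hD _ (neg_notMem_range (S.im_pos a).le)).continuousAt.tendsto.mono_left nhdsWithin_le_nhds

theorem residueConditions_sol {γ : ι → ℂ} (hγ : S.Symm γ) :
    S.ResidueConditions γ (S.sol γ) := fun a =>
  ⟨_, tendsto_neg_pt fun _ hz => differentiableAt_sol γ hz, by
    rw [← resid_one_spec hγ]; exact tendsto_sol_residue γ a⟩

/-- If the coupling constants evolve by `γ' = -2 c(p) γ` with an odd function `c`, then
`∂ + c` preserves the residue conditions. -/
theorem residueConditions_evolution {γ ϖ' : ι → ℂ} {c : ℂ → ℂ} (hγ : S.Symm γ)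
    (hc : ∀ a, ContinuousAt c (S.pt a)) (hc' : ∀ a, ContinuousAt c (-S.pt a))
    (ho : ∀ a, c (-S.pt a) = -c (S.pt a))
    (h : ∀ a, ϖ' a = -2 * c (S.pt a) * γ a * S.sol γ (-S.pt a)
      + γ a * S.poleSum ϖ' (-S.pt a)) :
    S.ResidueConditions γ (fun z => S.poleSum ϖ' z + c z * S.sol γ z) := by
  intro a
  refine ⟨S.poleSum ϖ' (-S.pt a) + c (-S.pt a) * S.sol γ (-S.pt a), ?_, ?_⟩
  · exact (tendsto_neg_pt fun _ hz => differentiableAt_poleSum ϖ' hz).add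
      (((hc' a).tendsto.mono_left nhdsWithin_le_nhds).mul
        (tendsto_neg_pt fun _ hz => differentiableAt_sol γ hz))
  · have h1 := (tendsto_poleSum_residue (S := S) ϖ' a).add
      (((hc a).tendsto.mono_left (nhdsWithin_le_nhds (s := {S.pt a}ᶜ))).mul
        (tendsto_sol_residue γ a))
    rw [show γ a * (S.poleSum ϖ' (-S.pt a) + c (-S.pt a) * S.sol γ (-S.pt a))
      = ϖ' a + c (S.pt a) * S.resid 1 γ a by rw [h, ho, resid_one_spec hγ]; ring]
    refine h1.congr fun z => by ring

/-- Subtract `L * sol γ` and apply uniqueness. The set `T` accommodates the extra points `0`, `±i`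
where the multipliers built from `k` and `λ` are singular. -/
theorem eq_mul_sol {γ : ι → ℂ} (hγ : S.Symm γ) {T : Set ℂ} (hT : T.Finite) {F : ℂ → ℂ} {L : ℂ}
    (hF : ∀ z ∉ T, DifferentiableAt ℂ F z)
    (hs : ∀ s ∈ T, s ∉ range S.pt → Tendsto (fun z => (z - s) * F z) (𝓝[≠] s) (𝓝 0))
    (hres : S.ResidueConditions γ F) (hinf : Tendsto F (Bornology.cobounded ℂ) (𝓝 L)) :
    ∀ z ∉ T, z ∉ range S.pt → F z = L * S.sol γ z := by
  have h2 := ((residueConditions_sol hγ).mul_even (c := fun _ => -L)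
    (fun _ => continuousAt_const) (fun _ => continuousAt_const) fun _ => rfl)
  choose ℓ hl hr using hres.add h2
  intro z hz hzp
  have := eq_zero_of_residue_conditions' S.im_pos S.pt_refl (T := T ∪ range S.pt)
    (hT.union (finite_range S.pt)) (D := fun z => F z + -L * S.sol γ z) (δ := fun _ => 1)
    (γ := γ) (ℓ := ℓ) (ϖ := fun a => γ a * ℓ a) ?_ ?_ hr hl (by simp) (by simp) (by simp) hγ ?_ z
    (by simpa using ⟨hz, by simpa using hzp⟩) hzp
  · linear_combination this
  · intro w hw
    have hw1 : w ∉ T := fun h => hw (Or.inl h)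
    have hw2 : w ∉ range S.pt := fun h => hw (Or.inr h)
    exact (hF w hw1).add ((differentiableAt_sol γ hw2).const_mul _)
  · rintro s (hsT | hsp) hsr
    · have h1 := hs s hsT hsr
      have h3 := tendsto_mul_of_differentiableAt (c := s)
        ((differentiableAt_sol γ hsr).const_mul (-L)).continuousAt
      simpa [mul_add] using h1.add h3
    · exact absurd hsp hsr
  · simpa using hinf.add ((tendsto_sol_infinity (S := S) γ).const_mul (-L))

end PoleSystem

end

section

/-! ### The pole system of a discrete spectrum -/

theorem re_pos_of_mem_regionD {z : ℂ} (h : z ∈ regionD) : 0 < z.re := by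
  obtain ⟨h1, h2, h3⟩ := h
  rw [← Complex.norm_mul_cos_arg]
  exact mul_pos (by linarith) (Real.cos_pos_of_mem_Ioo ⟨by linarith [Real.pi_pos], h2⟩)

theorem im_pos_of_mem_regionD {z : ℂ} (h : z ∈ regionD) : 0 < z.im := by
  obtain ⟨h1, h2, h3⟩ := h
  rw [← Complex.norm_mul_sin_arg]
  exact mul_pos (by linarith) (Real.sin_pos_of_pos_of_lt_pi h1 (by linarith [Real.pi_pos]))

theorem ne_zero_of_mem_regionD {z : ℂ} (h : z ∈ regionD) : z ≠ 0 := fun h0 => by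
  have := re_pos_of_mem_regionD h
  simp [h0] at this

/-- The reflection on the indices of `upperPole`. -/
def reflIdx : Fin 4 → Fin 4 := ![1, 0, 3, 2]

/-- The inversion on the indices of `upperPole`. -/
def invIdx : Fin 4 → Fin 4 := ![3, 2, 1, 0]

theorem upperPole_reflIdx (z : ℂ) (k : Fin 4) :
    upperPole z (reflIdx k) = -conj (upperPole z k) := by
  fin_cases k <;> simp [upperPole, reflIdx, neg_div]

theorem upperPole_invIdx (z : ℂ) (k : Fin 4) :
    upperPole z (invIdx k) = -1 / upperPole z k := by
  fin_cases k <;> simp [upperPole, invIdx, div_neg, neg_div]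

theorem lowerPole_eq_conj (z : ℂ) (k : Fin 4) : lowerPole z k = conj (upperPole z k) := by
  fin_cases k <;> simp [upperPole, lowerPole]

theorem lowerPole_reflIdx (z : ℂ) (k : Fin 4) : lowerPole z (reflIdx k) = -upperPole z k := by
  rw [lowerPole_eq_conj, upperPole_reflIdx]; simp

theorem reflIdx_reflIdx (k : Fin 4) : reflIdx (reflIdx k) = k := by
  fin_cases k <;> rfl

theorem upperPole_im_pos {z : ℂ} (hz : z ∈ regionD) (k : Fin 4) : 0 < (upperPole z k).im := by
  have h1 := im_pos_of_mem_regionD hz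
  have h2 : 0 < z.im / Complex.normSq z :=
    div_pos h1 (Complex.normSq_pos.2 (ne_zero_of_mem_regionD hz))
  fin_cases k <;> simpa [upperPole, Complex.inv_im, neg_div, neg_neg] using by assumption

theorem upperPole_ne_I {z : ℂ} (hz : z ∈ regionD) (k : Fin 4) : upperPole z k ≠ Complex.I := by
  intro h
  have h1 : ‖upperPole z k‖ = 1 := by rw [h]; simp
  have h2 := hz.2.2
  fin_cases k <;> simp [upperPole] at h1 <;> linarith

/-- The four images of the region are separated by the sign of the real part and by whether the
modulus exceeds `1`. -/
theorem upperPole_injective {z w : ℂ} (hz : z ∈ regionD) (hw : w ∈ regionD) {k l : Fin 4}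
    (h : upperPole z k = upperPole w l) : z = w ∧ k = l := by
  have a1 := re_pos_of_mem_regionD hz
  have a2 := re_pos_of_mem_regionD hw
  have b1 : 0 < z.re / Complex.normSq z :=
    div_pos a1 (Complex.normSq_pos.2 (ne_zero_of_mem_regionD hz))
  have b2 : 0 < w.re / Complex.normSq w :=
    div_pos a2 (Complex.normSq_pos.2 (ne_zero_of_mem_regionD hw))
  have c1 := hz.2.2
  have c2 := hw.2.2
  have d1 : ‖z‖⁻¹ < 1 := inv_lt_one_of_one_lt₀ c1
  have d2 : ‖w‖⁻¹ < 1 := inv_lt_one_of_one_lt₀ c2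
  have hre := congrArg Complex.re h
  have hn := congrArg norm h
  fin_cases k <;> fin_cases l <;>
    simp [upperPole, Complex.inv_re, neg_div] at h hre hn ⊢ <;>
    first
      | exact h
      | exact (by linarith : False).elim
      | exact star_injective h

variable {n : ℕ}

/-- The poles in the upper half plane generated by `ζ`. -/
def poleSystem (ζ : Fin n → ℂ) (hinj : Function.Injective ζ) (hζ : ∀ j, ζ j ∈ regionD) :
    PoleSystem (Fin n × Fin 4) where
  pt a := upperPole (ζ a.1) a.2
  refl a := (a.1, reflIdx a.2)
  inv a := (a.1, invIdx a.2)
  injective a b h := by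
    obtain ⟨h1, h2⟩ := upperPole_injective (hζ _) (hζ _) h
    exact Prod.ext (hinj h1) h2
  im_pos a := upperPole_im_pos (hζ _) _
  pt_refl a := upperPole_reflIdx _ _
  pt_inv a := upperPole_invIdx _ _
  ne_I a := upperPole_ne_I (hζ _) _

theorem spectrumSet_eq (ζ : Fin n → ℂ) (hinj : Function.Injective ζ)
    (hζ : ∀ j, ζ j ∈ regionD) :
    spectrumSet ζ = range (poleSystem ζ hinj hζ).pt ∪
      range fun a => -(poleSystem ζ hinj hζ).pt a := by
  ext z
  simp only [spectrumSet, mem_ofPred_eq, mem_union, mem_range, Prod.exists, poleSystem]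
  constructor
  · rintro ⟨j, k, rfl | rfl⟩
    · exact Or.inl ⟨j, k, rfl⟩
    · refine Or.inr ⟨j, reflIdx k, ?_⟩
      rw [← lowerPole_reflIdx, reflIdx_reflIdx]
  · rintro (⟨j, k, rfl⟩ | ⟨j, k, rfl⟩)
    · exact ⟨j, k, Or.inl rfl⟩
    · exact ⟨j, reflIdx k, Or.inr (lowerPole_reflIdx _ _).symm⟩

theorem finite_spectrumSet (ζ : Fin n → ℂ) : (spectrumSet ζ).Finite := by
  have : spectrumSet ζ ⊆ range (fun a : Fin n × Fin 4 => upperPole (ζ a.1) a.2) ∪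
      range (fun a : Fin n × Fin 4 => lowerPole (ζ a.1) a.2) := by
    rintro z ⟨j, k, rfl | rfl⟩
    · exact Or.inl ⟨(j, k), rfl⟩
    · exact Or.inr ⟨(j, k), rfl⟩
  exact ((finite_range _).union (finite_range _)).subset this

/-! ### Symmetries of the phase -/

theorem kFun_neg (z : ℂ) : kFun (-z) = -kFun z := by
  simp only [kFun, div_neg]; ring

theorem lamFun_neg (z : ℂ) : lamFun (-z) = -lamFun z := by
  simp only [lamFun, div_neg]; ring

theorem theta_neg (y t : ℝ) (z : ℂ) : theta y t (-z) = -theta y t z := by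
  simp only [theta, kFun_neg, lamFun_neg, neg_sq]; ring

theorem theta_inv (y t : ℝ) (z : ℂ) : theta y t (1 / z) = -theta y t z := by
  have h1 : kFun (1 / z) = -kFun z := by simp only [kFun, one_div_one_div]; ring
  have h2 : lamFun (1 / z) = lamFun z := by simp only [lamFun, one_div_one_div]; ring
  simp only [theta, h1, h2]; ring

theorem theta_inv' (y t : ℝ) (z : ℂ) : theta y t z⁻¹ = -theta y t z := by
  rw [← one_div, theta_inv]

theorem theta_neg_inv (y t : ℝ) (z : ℂ) : theta y t (-1 / z) = theta y t z := by
  rw [neg_div, theta_neg, theta_inv, neg_neg]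

theorem theta_conj (y t : ℝ) (z : ℂ) : theta y t (conj z) = conj (theta y t z) := by
  simp only [theta, kFun, lamFun, map_mul, map_div₀, map_sub, map_add, map_one, map_inv₀, map_pow,
    Complex.conj_I, Complex.conj_ofReal, map_ofNat]
  ring

/-- The phase is odd under `z ↦ -z` and `z ↦ 1/z` and commutes with conjugation, so the four
exponentials take just one value and its conjugate. Both symmetries of the couplings are read off
from this. -/
theorem exp_theta_upperPole (y t : ℝ) (z : ℂ) (k : Fin 4) :
    Complex.exp (-2 * Complex.I * theta y t (upperPole z k)) =
      ![Complex.exp (-2 * Complex.I * theta y t z), conj (Complex.exp (-2 * Complex.I * theta y t z)),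
        conj (Complex.exp (-2 * Complex.I * theta y t z)),
        Complex.exp (-2 * Complex.I * theta y t z)] k := by
  rw [← Complex.exp_conj]
  fin_cases k <;> simp [upperPole, theta_neg, theta_conj, theta_neg_inv, theta_inv',
    Complex.conj_ofNat]

/-- The coupling constants at the poles in the upper half plane. -/
def coupling (ζ c : Fin n → ℂ) (y t : ℝ) (a : Fin n × Fin 4) : ℂ :=
  upperConst (c a.1) (ζ a.1) a.2 *
    Complex.exp (-2 * Complex.I * theta y t (upperPole (ζ a.1) a.2))

/-- The lower poles are the negatives of the upper ones, with the index reflected. Reindexed this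
way, the lower residue constants are the negated upper couplings, so one family governs both half
planes. -/
theorem lower_coupling (ζ c : Fin n → ℂ) (y t : ℝ) (j : Fin n) (k : Fin 4) :
    lowerConst (c j) (ζ j) (reflIdx k) *
      Complex.exp (2 * Complex.I * theta y t (lowerPole (ζ j) (reflIdx k)))
      = -coupling ζ c y t (j, k) := by
  rw [lowerPole_reflIdx, theta_neg, coupling, mul_neg, ← neg_mul, ← neg_mul, ← neg_mul]
  congr 1
  fin_cases k <;> simp [lowerConst, upperConst, reflIdx]

variable {ζ : Fin n → ℂ} {hinj : Function.Injective ζ} {hζ : ∀ j, ζ j ∈ regionD}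

theorem symm_coupling (c : Fin n → ℂ) (y t : ℝ) :
    (poleSystem ζ hinj hζ).Symm (coupling ζ c y t) := by
  rintro ⟨j, k⟩
  simp only [poleSystem, coupling, exp_theta_upperPole]
  fin_cases k <;> simp [upperConst, reflIdx]

theorem invSymm_coupling (c : Fin n → ℂ) (y t : ℝ) :
    (poleSystem ζ hinj hζ).InvSymm (coupling ζ c y t) := by
  rintro ⟨j, k⟩
  have h0 := ne_zero_of_mem_regionD (hζ j)
  have h0' : conj (ζ j) ≠ 0 := by simpa using h0
  simp only [poleSystem, coupling, exp_theta_upperPole]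
  fin_cases k <;> simp [upperConst, upperPole, invIdx] <;> field_simp

/-! ### Row combinations of a solution of the soliton problem -/

/-- The residue matrix has a zero second column, so the second column of `M` has only a removable
singularity at the point; its limit then determines the residue of the first column. -/
theorem IsSolitonRH.upper_limits {c : Fin n → ℂ} {y t : ℝ} {M : ℂ → Mat}
    (hM : IsSolitonRH ζ c y t M) (j : Fin n) (k : Fin 4) (r : Fin 2) :
    ∃ ℓ, Tendsto (fun z => M z r 1) (𝓝[≠] (upperPole (ζ j) k)) (𝓝 ℓ) ∧
      Tendsto (fun z => (z - upperPole (ζ j) k) * M z r 0) (𝓝[≠] (upperPole (ζ j) k))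
        (𝓝 (coupling ζ c y t (j, k) * ℓ)) := by
  obtain ⟨A, h1, h2⟩ := hM.residue_upper j k
  have e1 := fun s => tendsto_pi_nhds.1 (tendsto_pi_nhds.1 h1 r) s
  have e2 := fun s => tendsto_pi_nhds.1 (tendsto_pi_nhds.1 h2 r) s
  have hA : A r 1 = 0 := by
    refine tendsto_nhds_unique (e1 1) ?_
    simp [Matrix.mul_apply, Fin.sum_univ_two]
  have h3 := e2 1
  rw [hA] at h3
  have h4 := tendsto_fillIn (f := fun z => M z r 1) (c := upperPole (ζ j) k)
    ((eventually_notMem_of_finite (finite_spectrumSet ζ) _).mono fun z hz =>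
      (hM.analytic r 1).differentiableAt
        ((finite_spectrumSet ζ).isClosed.isOpen_compl.mem_nhds hz)) (by simpa using h3)
  refine ⟨_, h4, ?_⟩
  have h5 : A r 0 = coupling ζ c y t (j, k) * fillIn (fun z => M z r 1) (upperPole (ζ j) k) := by
    refine tendsto_nhds_unique (e1 0) ?_
    simp only [Matrix.mul_apply, Fin.sum_univ_two]
    simpa [coupling, mul_comm] using h4.mul_const (coupling ζ c y t (j, k))
  rw [← h5]
  simpa using e2 0

theorem IsSolitonRH.lower_limits {c : Fin n → ℂ} {y t : ℝ} {M : ℂ → Mat}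
    (hM : IsSolitonRH ζ c y t M) (j : Fin n) (k : Fin 4) (r : Fin 2) :
    ∃ ℓ, Tendsto (fun z => M z r 0) (𝓝[≠] (-upperPole (ζ j) k)) (𝓝 ℓ) ∧
      Tendsto (fun z => (z + upperPole (ζ j) k) * M z r 1) (𝓝[≠] (-upperPole (ζ j) k))
        (𝓝 (-coupling ζ c y t (j, k) * ℓ)) := by
  obtain ⟨A, h1, h2⟩ := hM.residue_lower j (reflIdx k)
  rw [lower_coupling, lowerPole_reflIdx] at h1
  rw [lowerPole_reflIdx] at h2
  have e1 := fun s => tendsto_pi_nhds.1 (tendsto_pi_nhds.1 h1 r) s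
  have e2 := fun s => tendsto_pi_nhds.1 (tendsto_pi_nhds.1 h2 r) s
  have hA : A r 0 = 0 := by
    refine tendsto_nhds_unique (e1 0) ?_
    simp [Matrix.mul_apply, Fin.sum_univ_two]
  have h3 := e2 0
  rw [hA] at h3
  have h4 := tendsto_fillIn (f := fun z => M z r 0) (c := -upperPole (ζ j) k)
    ((eventually_notMem_of_finite (finite_spectrumSet ζ) _).mono fun z hz =>
      (hM.analytic r 0).differentiableAt
        ((finite_spectrumSet ζ).isClosed.isOpen_compl.mem_nhds hz)) (by simpa using h3)
  refine ⟨_, h4, ?_⟩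
  have h5 : A r 1 = -coupling ζ c y t (j, k) *
      fillIn (fun z => M z r 0) (-upperPole (ζ j) k) := by
    refine tendsto_nhds_unique (e1 1) ?_
    simp only [Matrix.mul_apply, Fin.sum_univ_two]
    simpa [mul_comm] using (h4.mul_const (coupling ζ c y t (j, k))).neg
  rw [← h5]
  simpa using e2 1

theorem NormalizedAtInfinity.tendsto {M : ℂ → Mat} (h : NormalizedAtInfinity M) (a b : Fin 2) :
    Tendsto (fun z => M z a b) (Bornology.cobounded ℂ) (𝓝 ((1 : Mat) a b)) := by
  have := ((h a b).trans_tendsto tendsto_inv₀_cobounded).add_const ((1 : Mat) a b)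
  simpa using this

/-- The residue conditions at `p` and `-p` interchange the functions `colSum1 M z` and `colSum2 M
(-z)` with the same coupling. Their sum and difference therefore satisfy closed scalar problems with
couplings `±γ` and limits `2` and `0` at infinity. -/
theorem IsSolitonRH.colSum_add {c : Fin n → ℂ} {y t : ℝ} {M : ℂ → Mat}
    (hM : IsSolitonRH ζ c y t M) {ε : ℂ} (hε : ε = 1 ∨ ε = -1) {z : ℂ} (hz : z ∉ spectrumSet ζ) :
    colSum1 M z + ε * colSum2 M (-z) =
      (1 + ε) * (poleSystem ζ hinj hζ).sol (fun a => ε * coupling ζ c y t a) z := by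
  have hεε : ε * ε = 1 := by rcases hε with rfl | rfl <;> simp
  have hneg : ∀ w, w ∉ spectrumSet ζ → -w ∉ spectrumSet ζ := by
    intro w hw
    rw [spectrumSet_eq ζ hinj hζ] at hw ⊢
    rintro (⟨a, ha⟩ | ⟨a, ha⟩)
    · exact hw (Or.inr ⟨a, by simp [ha]⟩)
    · exact hw (Or.inl ⟨a, by simpa using ha⟩)
  have hd : ∀ w, w ∉ spectrumSet ζ → ∀ r s, DifferentiableAt ℂ (fun z => M z r s) w :=
    fun w hw r s => (hM.analytic r s).differentiableAt
      ((finite_spectrumSet ζ).isClosed.isOpen_compl.mem_nhds hw)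
  have hz' : z ∉ range (poleSystem ζ hinj hζ).pt := fun h => hz (by
    rw [spectrumSet_eq ζ hinj hζ]; exact Or.inl h)
  have hres : ∀ a, ∃ ℓ, Tendsto (fun z => colSum1 M z + ε * colSum2 M (-z))
        (𝓝[≠] (-(poleSystem ζ hinj hζ).pt a)) (𝓝 ℓ) ∧
      Tendsto (fun z => (z - (poleSystem ζ hinj hζ).pt a) * (colSum1 M z + ε * colSum2 M (-z)))
        (𝓝[≠] ((poleSystem ζ hinj hζ).pt a)) (𝓝 (ε * coupling ζ c y t a * ℓ)) := by
    rintro ⟨j, k⟩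
    obtain ⟨u0, hu0, hu0'⟩ := hM.upper_limits j k 0
    obtain ⟨u1, hu1, hu1'⟩ := hM.upper_limits j k 1
    obtain ⟨l0, hl0, hl0'⟩ := hM.lower_limits j k 0
    obtain ⟨l1, hl1, hl1'⟩ := hM.lower_limits j k 1
    have n1 : Tendsto (fun z : ℂ => -z) (𝓝[≠] (-upperPole (ζ j) k))
        (𝓝[≠] (upperPole (ζ j) k)) := by
      simpa using tendsto_neg_punctured (-upperPole (ζ j) k)
    have n2 := tendsto_neg_punctured (upperPole (ζ j) k)
    refine ⟨l0 + l1 + ε * (u0 + u1), ?_, ?_⟩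
    · exact (hl0.add hl1).add (((hu0.add hu1).comp n1).const_mul ε)
    · have := (hu0'.add hu1').add (((hl0'.add hl1').comp n2).const_mul (-ε))
      rw [show ε * coupling ζ c y t (j, k) * (l0 + l1 + ε * (u0 + u1)) =
        coupling ζ c y t (j, k) * u0 + coupling ζ c y t (j, k) * u1
          + -ε * (-coupling ζ c y t (j, k) * l0 + -coupling ζ c y t (j, k) * l1) by
        -- The sign `ε` squares to `1`; no other value would close the system.
        linear_combination coupling ζ c y t (j, k) * (u0 + u1) * hεε]
      refine this.congr fun z => ?_
      simp only [Function.comp, colSum1, colSum2, poleSystem]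
      ring
  refine PoleSystem.eq_mul_sol (S := poleSystem ζ hinj hζ) (T := spectrumSet ζ)
    (F := fun z => colSum1 M z + ε * colSum2 M (-z)) ?_ (finite_spectrumSet ζ) ?_ ?_ hres ?_ z hz
    hz'
  · intro a
    simp only [symm_coupling c y t a, map_mul]
    rcases hε with rfl | rfl <;> simp
  · intro w hw
    have d2 : ∀ r s, DifferentiableAt ℂ (fun z => M (-z) r s) w := fun r s =>
      DifferentiableAt.comp w (hd _ (hneg w hw) r s) differentiableAt_id.neg
    exact ((hd w hw 0 0).add (hd w hw 1 0)).add (((d2 0 1).add (d2 1 1)).const_mul ε)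
  · intro s hs hsr
    rw [spectrumSet_eq ζ hinj hζ] at hs
    rcases hs with h | ⟨a, rfl⟩
    · exact absurd h hsr
    · obtain ⟨ℓ, h, -⟩ := hres a
      have h0 : Tendsto (fun z => z - -(poleSystem ζ hinj hζ).pt a)
          (𝓝[≠] (-(poleSystem ζ hinj hζ).pt a)) (𝓝 0) := by
        have := tendsto_mul_of_differentiableAt (f := fun _ => 1)
          (c := -(poleSystem ζ hinj hζ).pt a) continuousAt_const
        simpa using this
      simpa using h0.mul h
  · have n1 : Tendsto (fun z : ℂ => -z) (Bornology.cobounded ℂ) (Bornology.cobounded ℂ) := by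
      simp [← tendsto_norm_atTop_iff_cobounded, tendsto_norm_cobounded_atTop]
    have h := hM.norm_infinity.tendsto
    have := ((h 0 0).add (h 1 0)).add ((((h 0 1).add (h 1 1)).comp n1).const_mul ε)
    simpa [colSum1, colSum2, Function.comp_def] using this

theorem IsSolitonRH.colSum1_eq {c : Fin n → ℂ} {y t : ℝ} {M : ℂ → Mat}
    (hM : IsSolitonRH ζ c y t M) {z : ℂ} (hz : z ∉ spectrumSet ζ) :
    colSum1 M z = (poleSystem ζ hinj hζ).sol (coupling ζ c y t) z := by
  have h1 := hM.colSum_add (hinj := hinj) (hζ := hζ) (Or.inl rfl) hz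
  have h2 := hM.colSum_add (hinj := hinj) (hζ := hζ) (Or.inr rfl) hz
  simp only [one_mul] at h1
  linear_combination (h1 + h2) / 2

theorem IsSolitonRH.colSum2_neg_eq {c : Fin n → ℂ} {y t : ℝ} {M : ℂ → Mat}
    (hM : IsSolitonRH ζ c y t M) {z : ℂ} (hz : z ∉ spectrumSet ζ) :
    colSum2 M (-z) = (poleSystem ζ hinj hζ).sol (coupling ζ c y t) z := by
  have h1 := hM.colSum_add (hinj := hinj) (hζ := hζ) (Or.inl rfl) hz
  have h2 := hM.colSum_add (hinj := hinj) (hζ := hζ) (Or.inr rfl) hz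
  simp only [one_mul] at h1
  linear_combination (h1 - h2) / 2

end

section

/-! ### The normalization at `i` -/

theorem NormalizedAtI.apply_I {M : ℂ → Mat} (hM : NormalizedAtI M) :
    ∃ m h : ℝ, M Complex.I = gaugeMatrix m * expHalfSigma3 h := by
  obtain ⟨m, h, μ, hO⟩ := hM
  refine ⟨m, h, ?_⟩
  ext a b
  have h1 := (hO a b).eq_zero_imp.self_of_nhds (by simp)
  simpa [sub_eq_zero] using h1

/-- The values of the column sums at `i` for a matrix function that is normalized at `i`. -/
theorem NormalizedAtI.colSums {M : ℂ → Mat} (hM : NormalizedAtI M) :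
    ∃ (s α h : ℝ), α ^ 2 < 1 ∧ s ^ 2 * (1 + α ^ 2) = 1 ∧
      colSum1 M Complex.I = s * (1 + α * Complex.I) * Real.exp (h / 2) ∧
      colSum2 M Complex.I = s * (1 + α * Complex.I) * Real.exp (-(h / 2)) := by
  obtain ⟨m, h, hMI⟩ := hM.apply_I
  set q : ℝ := Real.sqrt (m ^ 2 + 1) with hq
  have hq0 : 0 ≤ q := Real.sqrt_nonneg _
  have hq2 : q ^ 2 = m ^ 2 + 1 := Real.sq_sqrt (by positivity)
  have hq1 : 0 < q + 1 := by linarith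
  -- Here `α = m / (q + 1)`, and `α² < 1` because `m² = q² - 1 < (q + 1)²`. This strict bound will
  -- give the positivity of `x_y`.
  refine ⟨Real.sqrt ((q + 1) ^ 2 / (m ^ 2 + (q + 1) ^ 2)), m / (q + 1), h, ?_, ?_, ?_, ?_⟩
  · rw [div_pow, div_lt_one (by positivity)]
    nlinarith
  · rw [Real.sq_sqrt (by positivity)]
    have : m ^ 2 + (q + 1) ^ 2 ≠ 0 := by positivity
    field_simp
    ring
  · simp only [colSum1, hMI, gaugeMatrix, expHalfSigma3, ← hq]
    simp [Matrix.mul_apply, Fin.sum_univ_two]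
    ring
  · simp only [colSum2, hMI, gaugeMatrix, expHalfSigma3, ← hq]
    simp [Matrix.mul_apply, Fin.sum_univ_two]
    ring

namespace PoleSystem

variable {ι : Type*} [Fintype ι] [DecidableEq ι] {S : PoleSystem ι}

omit [Fintype ι] [DecidableEq ι] in
theorem I_notMem : Complex.I ∉ range S.pt := by
  rintro ⟨a, ha⟩
  exact S.ne_I a ha

omit [Fintype ι] [DecidableEq ι] in
theorem neg_I_notMem : -Complex.I ∉ range S.pt := neg_notMem_range (by simp)

/-- Both points `±i` are fixed by `z ↦ -1/z`. -/
theorem sol_zero_mul_neg_I {γ : ι → ℂ} (hγ : S.Symm γ) (hγi : S.InvSymm γ) :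
    S.sol γ 0 * S.sol (-γ) Complex.I = S.sol γ Complex.I ∧
      S.sol γ 0 * S.sol (-γ) (-Complex.I) = S.sol γ (-Complex.I) := by
  rw [← sol_inv hγ hγi Complex.I_ne_zero I_notMem,
    ← sol_inv hγ hγi (neg_ne_zero.2 Complex.I_ne_zero) neg_I_notMem]
  constructor <;> congr 1 <;> field_simp <;> simp

/-- The point `i` is also fixed by `z ↦ -conj z`, so the two symmetries combine. The value at `0` is
thereby the phase of the value at `i` squared, in particular unimodular once the latter is nonzero.
-/
theorem sol_zero_mul_conj_I {γ : ι → ℂ} (hγ : S.Symm γ) (hγi : S.InvSymm γ) :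
    S.sol γ 0 * conj (S.sol γ Complex.I) = S.sol γ Complex.I := by
  have := (sol_zero_mul_neg_I hγ hγi).1
  rw [← conj_sol hγ] at this
  simpa using this

/-- The properties of the scalar solution that follow from the normalization at `i`. -/
structure Regular (S : PoleSystem ι) (γ : ι → ℂ) : Prop where
  ne_zero : S.sol γ Complex.I ≠ 0
  ratio : ∃ h : ℝ, S.sol γ Complex.I = Real.exp h * S.sol γ (-Complex.I)
  re_pos : 0 < (S.sol γ 0).re
  prod : S.sol γ Complex.I * S.sol γ (-Complex.I) = S.sol γ 0

theorem Regular.norm_sol_zero {γ : ι → ℂ} (h : S.Regular γ) (hγ : S.Symm γ)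
    (hγi : S.InvSymm γ) : ‖S.sol γ 0‖ = 1 := by
  have := congrArg norm (sol_zero_mul_conj_I hγ hγi)
  rw [norm_mul, Complex.norm_conj] at this
  exact mul_right_cancel₀ (norm_ne_zero_iff.2 h.ne_zero) (by rw [this, one_mul])

theorem Regular.ne_zero' {γ : ι → ℂ} (h : S.Regular γ) : S.sol γ (-Complex.I) ≠ 0 := by
  obtain ⟨x, hx⟩ := h.ratio
  intro h0
  rw [h0, mul_zero] at hx
  exact h.ne_zero hx

end PoleSystem

variable {n : ℕ} {ζ : Fin n → ℂ} {hinj : Function.Injective ζ} {hζ : ∀ j, ζ j ∈ regionD}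

theorem I_notMem_spectrumSet (hinj : Function.Injective ζ) (hζ : ∀ j, ζ j ∈ regionD) :
    Complex.I ∉ spectrumSet ζ := by
  rw [spectrumSet_eq ζ hinj hζ]
  rintro (h | ⟨a, ha⟩)
  · exact PoleSystem.I_notMem h
  · exact PoleSystem.neg_I_notMem (S := poleSystem ζ hinj hζ) ⟨a, by simp [← ha]⟩

theorem neg_I_notMem_spectrumSet (hinj : Function.Injective ζ) (hζ : ∀ j, ζ j ∈ regionD) :
    -Complex.I ∉ spectrumSet ζ := by
  rw [spectrumSet_eq ζ hinj hζ]
  rintro (h | ⟨a, ha⟩)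
  · exact PoleSystem.neg_I_notMem h
  · exact PoleSystem.I_notMem (S := poleSystem ζ hinj hζ) ⟨a, by simpa using ha⟩

/-- At `i` both column sums are positive or negative real multiples of `1 + iα`, which fixes the
value of the scalar solution at `0` as `(1 + iα)/(1 - iα)`. The existence of `M` enters the analysis
of the flow only through this. -/
theorem IsSolitonRH.regular {c : Fin n → ℂ} {y t : ℝ} {M : ℂ → Mat}
    (hM : IsSolitonRH ζ c y t M) :
    (poleSystem ζ hinj hζ).Regular (coupling ζ c y t) := by
  obtain ⟨s, α, h, hα, hs, h1, h2⟩ := hM.norm_I.colSums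
  have e1 := hM.colSum1_eq (hinj := hinj) (hζ := hζ) (I_notMem_spectrumSet hinj hζ)
  have e2 := hM.colSum2_neg_eq (hinj := hinj) (hζ := hζ) (neg_I_notMem_spectrumSet hinj hζ)
  rw [neg_neg] at e2
  have key := PoleSystem.sol_zero_mul_conj_I (S := poleSystem ζ hinj hζ)
    (symm_coupling c y t) (invSymm_coupling c y t)
  rw [h1] at e1
  rw [h2] at e2
  rw [← e1] at key
  have hs0 : (s : ℂ) ≠ 0 := by
    intro h0
    have : s = 0 := by exact_mod_cast h0
    simp [this] at hs
  have hE : ((Real.exp (h / 2) : ℝ) : ℂ) ≠ 0 := by exact_mod_cast (Real.exp_pos _).ne'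
  have hα0 : (1 + α * Complex.I : ℂ) ≠ 0 := by
    intro h0
    have := congrArg Complex.re h0
    simp at this
  have hαc : (1 - α * Complex.I : ℂ) ≠ 0 := by
    intro h0
    have := congrArg Complex.re h0
    simp at this
  simp only [map_mul, map_add, map_one, Complex.conj_ofReal, Complex.conj_I] at key
  have key2 : (poleSystem ζ hinj hζ).sol (coupling ζ c y t) 0 * (1 - α * Complex.I)
      = 1 + α * Complex.I := by
    refine mul_right_cancel₀ (mul_ne_zero hs0 hE) ?_
    linear_combination key
  have hI : Complex.I ^ 2 = -1 := Complex.I_sq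
  have hα1 : (1 + α ^ 2 : ℂ) ≠ 0 := by
    have : (1 + α ^ 2 : ℝ) ≠ 0 := by positivity
    exact_mod_cast this
  have hs' : (s : ℂ) ^ 2 * (1 + (α : ℂ) ^ 2) = 1 := by exact_mod_cast hs
  have hEE : ((Real.exp (h / 2) : ℝ) : ℂ) * ((Real.exp (-(h / 2)) : ℝ) : ℂ) = 1 := by
    rw [← Complex.ofReal_mul, ← Real.exp_add]; simp
  -- Real and imaginary part of `(1 + iα)/(1 - iα)`; the real part is positive exactly because `|α|
  -- < 1`.
  have hP0 : (poleSystem ζ hinj hζ).sol (coupling ζ c y t) 0 =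
      (((1 - α ^ 2) / (1 + α ^ 2) : ℝ) : ℂ) + ((2 * α / (1 + α ^ 2) : ℝ) : ℂ) * Complex.I := by
    refine mul_right_cancel₀ hαc ?_
    rw [key2]
    push_cast
    field_simp
    ring_nf
    simp only [hI]
    ring
  refine ⟨?_, ⟨h, ?_⟩, ?_, ?_⟩
  · rw [← e1]
    exact mul_ne_zero (mul_ne_zero hs0 hα0) hE
  · rw [← e1, ← e2]
    have : ((Real.exp (h / 2) : ℝ) : ℂ) =
        ((Real.exp h : ℝ) : ℂ) * ((Real.exp (-(h / 2)) : ℝ) : ℂ) := by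
      rw [← Complex.ofReal_mul, ← Real.exp_add]; congr 2; ring
    rw [this]; ring
  · rw [hP0]
    simp only [Complex.add_re, Complex.ofReal_re, Complex.mul_re, Complex.I_re, Complex.I_im,
      Complex.ofReal_im, mul_zero, zero_mul, sub_zero, add_zero]
    apply div_pos <;> nlinarith
  · rw [← e1, ← e2]
    refine mul_right_cancel₀ hαc ?_
    rw [key2]
    linear_combination (s : ℂ) ^ 2 * (1 + α * Complex.I) ^ 2 * (1 - α * Complex.I) * hEE
      + (1 + α * Complex.I) * hs' - (s : ℂ) ^ 2 * α ^ 2 * (1 + α * Complex.I) * hI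

end

section

/-! ### Local behaviour of the spectral functions -/

theorem lamFun_eq {z : ℂ} (hz : z ≠ 0) : lamFun z = (z ^ 2 + 1) / (2 * z) := by
  simp only [lamFun]; field_simp

theorem kFun_eq {z : ℂ} (hz : z ≠ 0) : kFun z = Complex.I * (z ^ 2 - 1) / (2 * z) := by
  simp only [kFun]; field_simp

theorem sq_add_one_ne_zero {z : ℂ} (h1 : z ≠ Complex.I) (h2 : z ≠ -Complex.I) :
    z ^ 2 + 1 ≠ 0 := by
  intro h
  have : (z - Complex.I) * (z + Complex.I) = 0 := by
    linear_combination h - Complex.I_sq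
  rcases mul_eq_zero.1 this with h | h
  · exact h1 (sub_eq_zero.1 h)
  · exact h2 (eq_neg_of_add_eq_zero_left h)

theorem lamFun_ne_zero {z : ℂ} (h0 : z ≠ 0) (h1 : z ≠ Complex.I) (h2 : z ≠ -Complex.I) :
    lamFun z ≠ 0 := by
  rw [lamFun_eq h0]
  exact div_ne_zero (sq_add_one_ne_zero h1 h2) (by simpa using h0)

theorem hasDerivAt_neg_one_div {z : ℂ} (hz : z ≠ 0) :
    HasDerivAt (fun z : ℂ => -1 / z) (1 / z ^ 2) z := by
  have := (hasDerivAt_inv hz).const_mul (-1 : ℂ)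
  simpa [div_eq_mul_inv] using this

theorem differentiableAt_kFun {z : ℂ} (hz : z ≠ 0) : DifferentiableAt ℂ kFun z := by
  unfold kFun; fun_prop (disch := assumption)

theorem differentiableAt_lamFun {z : ℂ} (hz : z ≠ 0) : DifferentiableAt ℂ lamFun z := by
  unfold lamFun; fun_prop (disch := assumption)

theorem hasDerivAt_kFun {z : ℂ} (hz : z ≠ 0) :
    HasDerivAt kFun (Complex.I / 2 * (1 + 1 / z ^ 2)) z := by
  have := ((hasDerivAt_id z).add (hasDerivAt_neg_one_div hz)).const_mul (Complex.I / 2)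
  refine this.congr_of_eventuallyEq (Eventually.of_forall fun w => ?_)
  simp [kFun, neg_div, sub_eq_add_neg]

theorem hasDerivAt_lamFun {z : ℂ} (hz : z ≠ 0) :
    HasDerivAt lamFun (1 / 2 * (1 - 1 / z ^ 2)) z := by
  have := ((hasDerivAt_id z).sub (hasDerivAt_neg_one_div hz)).const_mul (1 / 2 : ℂ)
  refine this.congr_of_eventuallyEq (Eventually.of_forall fun w => ?_)
  simp [lamFun, neg_div]

/-! ### Local expansions at the fixed points `±i` of `z ↦ -1/z` -/

section FourthRoot

variable {σ : ℂ} (hσ : σ ^ 2 = -1)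
include hσ

theorem ne_zero_of_sq_eq_neg_one : σ ≠ 0 := by
  rintro rfl
  norm_num at hσ

theorem neg_one_div_of_sq_eq_neg_one : -1 / σ = σ := by
  have := ne_zero_of_sq_eq_neg_one hσ
  field_simp
  rw [hσ]

theorem kFun_of_sq_eq_neg_one : kFun σ = Complex.I * σ := by
  have h := neg_one_div_of_sq_eq_neg_one hσ
  rw [neg_div] at h
  rw [kFun, sub_eq_add_neg, h]; ring

theorem lamFun_of_sq_eq_neg_one : lamFun σ = 0 := by
  rw [lamFun_eq (ne_zero_of_sq_eq_neg_one hσ), hσ]; simp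

theorem hasDerivAt_kFun_zero : HasDerivAt kFun 0 σ := by
  have := hasDerivAt_kFun (ne_zero_of_sq_eq_neg_one hσ)
  rw [hσ] at this
  norm_num at this
  exact this

theorem hasDerivAt_lamFun_one : HasDerivAt lamFun 1 σ := by
  have := hasDerivAt_lamFun (ne_zero_of_sq_eq_neg_one hσ)
  rw [hσ] at this
  norm_num at this
  exact this

/-- The map `z ↦ -1/z` fixes `σ` and has derivative `1/σ² = -1` there. -/
theorem hasDerivAt_comp_neg_one_div {f : ℂ → ℂ} {f' : ℂ} (hf : HasDerivAt f f' σ) :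
    HasDerivAt (fun z => f (-1 / z)) (-f') σ := by
  have h1 := hasDerivAt_neg_one_div (ne_zero_of_sq_eq_neg_one hσ)
  have h2 : HasDerivAt f f' (-1 / σ) := by rwa [neg_one_div_of_sq_eq_neg_one hσ]
  have := HasDerivAt.comp σ h2 h1
  rw [hσ] at this
  simpa [Function.comp_def, div_neg] using this

/-- The finite part at `σ = ± i` of the right hand side of the time evolution. -/
theorem tendsto_time_evolution {f : ℂ → ℂ} (hf : ∀ᶠ z in 𝓝 σ, DifferentiableAt ℂ f z)
    {u w : ℂ} (h0 : 2 * deriv f σ * kFun σ - u * f σ - kFun σ * w * f σ = 0) :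
    Tendsto (fun z => kFun z * (lamFun z ^ 2)⁻¹ * (f z - f (-1 / z))
        - u * (lamFun z)⁻¹ * f (-1 / z) - kFun z * (lamFun z)⁻¹ * w * f z) (𝓝[≠] σ)
      (𝓝 (deriv f σ * (u - kFun σ * w))) := by
  have hσ0 := ne_zero_of_sq_eq_neg_one hσ
  have hσi := neg_one_div_of_sq_eq_neg_one hσ
  set b := deriv f σ with hb
  -- The second-order Taylor remainder. Only its continuity at `σ` is used.
  set r := dslope (dslope f σ) σ with hr
  have hrc : ContinuousAt r σ := by
    refine continuousAt_dslope_same.2 ?_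
    have h1 : DifferentiableOn ℂ f {z | DifferentiableAt ℂ f z} :=
      fun z hz => DifferentiableAt.differentiableWithinAt hz
    exact ((Complex.differentiableOn_dslope hf).2 h1).differentiableAt hf
  have hexp : ∀ z, f z = f σ + b * (z - σ) + (z - σ) ^ 2 * r z := by
    intro z
    have h1 := sub_smul_dslope f σ z
    have h2 := sub_smul_dslope (dslope f σ) σ z
    rw [dslope_same] at h2
    simp only [smul_eq_mul] at h1 h2
    linear_combination (-1 : ℂ) * h1 - (z - σ) * h2
  have hfd : HasDerivAt f b σ := hf.self_of_nhds.hasDerivAt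
  have hfi := hasDerivAt_comp_neg_one_div hσ hfd
  -- The linear Taylor term contributes `b (z² + 1)/z = 2bλ` to `f z - f (-1/z)`, so up to the
  -- quadratic remainder the expression is `N z / λ z`. Both vanish at `σ`, where `λ' = 1`, so the
  -- limit is `N' σ`.
  set N : ℂ → ℂ := fun z => 2 * b * kFun z - u * f (-1 / z) - kFun z * w * f z with hN
  have hN' : HasDerivAt N (b * (u - kFun σ * w)) σ := by
    have hk := hasDerivAt_kFun_zero hσ
    convert! ((hk.const_mul (2 * b)).sub (hfi.const_mul u)).sub ((hk.mul_const w).mul hfd) using 1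
    ring
  have hN0 : N σ = 0 := by
    simp only [hN, hσi]
    linear_combination h0
  have hq : Tendsto (fun z => 2 * z / (z + σ)) (𝓝[≠] σ) (𝓝 1) := by
    have : ContinuousAt (fun z => 2 * z / (z + σ)) σ := by
      have : σ + σ ≠ 0 := by simpa [← two_mul] using hσ0
      exact ContinuousAt.div (by fun_prop) (by fun_prop) this
    have h := this.tendsto.mono_left (nhdsWithin_le_nhds (s := {σ}ᶜ))
    rwa [← two_mul, div_self (by simpa using hσ0)] at h
  have hs := hasDerivAt_iff_tendsto_slope.1 hN'
  -- The quadratic remainders meet the double pole of `λ⁻²`, leaving a bounded factor times this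
  -- bracket; it tends to `r σ + r σ / σ² = 0`.
  have hrr : Tendsto (fun z => r z + r (-1 / z) / z ^ 2) (𝓝[≠] σ) (𝓝 0) := by
    have h1 : ContinuousAt (fun z => r (-1 / z)) σ := by
      refine ContinuousAt.comp (g := r) ?_ (hasDerivAt_neg_one_div hσ0).continuousAt
      rwa [hσi]
    have h2 : ContinuousAt (fun z => r z + r (-1 / z) / z ^ 2) σ :=
      hrc.add (h1.div (by fun_prop) (pow_ne_zero 2 hσ0))
    have h := h2.tendsto.mono_left (nhdsWithin_le_nhds (s := {σ}ᶜ))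
    rw [hσi, hσ] at h
    simpa [div_neg] using h
  have hk : Tendsto kFun (𝓝[≠] σ) (𝓝 (kFun σ)) :=
    (hasDerivAt_kFun_zero hσ).continuousAt.tendsto.mono_left nhdsWithin_le_nhds
  have := (hs.mul hq).add ((hk.mul (hq.pow 2)).mul hrr)
  simp only [mul_one, mul_zero, add_zero] at this
  refine this.congr' ?_
  have e1 : ∀ᶠ z in 𝓝[≠] σ, z ≠ 0 := mem_nhdsWithin_of_mem_nhds (isOpen_ne.mem_nhds hσ0)
  have e2 : ∀ᶠ z in 𝓝[≠] σ, z ≠ -σ := mem_nhdsWithin_of_mem_nhds (isOpen_ne.mem_nhds (by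
    intro h
    have : 2 * σ = 0 := by linear_combination h
    simp at this
    exact hσ0 this))
  filter_upwards [self_mem_nhdsWithin, e1, e2] with z hz hz0 hz2
  have hz1 : z - σ ≠ 0 := sub_ne_zero.2 hz
  have hz3 : z + σ ≠ 0 := fun h => hz2 (eq_neg_of_add_eq_zero_left h)
  have hl : (lamFun z)⁻¹ = 2 * z / (z + σ) / (z - σ) := by
    rw [lamFun_eq hz0, show z ^ 2 + 1 = (z - σ) * (z + σ) by linear_combination hσ, inv_div]
    field_simp
  have hdiff : f z - f (-1 / z) = b * ((z - σ) * (z + σ) / z)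
      + (z - σ) ^ 2 * (r z + r (-1 / z) / z ^ 2) := by
    have h1 := hexp z
    have h2 := hexp (-1 / z)
    have h3 : -1 / z - σ = -σ * (z - σ) / z := by
      field_simp
      linear_combination -hσ
    rw [h3] at h2
    rw [h2, h1]
    generalize r (-1 / z) = ρ
    field_simp
    linear_combination (-(z - σ) ^ 2 * ρ) * hσ
  have hinv : ((lamFun z) ^ 2)⁻¹ = (2 * z / (z + σ) / (z - σ)) ^ 2 := by
    rw [← inv_pow, hl]
  rw [slope_def_field, hN0, sub_zero, hinv, hl, hdiff]
  simp only [hN]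
  generalize r (-1 / z) = ρ
  generalize f (-1 / z) = φ
  field_simp
  ring

end FourthRoot

end

/-! ### Asymptotics of `k` and `λ` at infinity and at `0` -/

section

theorem tendsto_cobounded_ne (w : ℂ) : ∀ᶠ z in Bornology.cobounded ℂ, z ≠ w :=
  Bornology.isBounded_def.1 (Bornology.isBounded_singleton (x := w))

theorem tendsto_inv_sq_cobounded :
    Tendsto (fun z : ℂ => (z ^ 2)⁻¹) (Bornology.cobounded ℂ) (𝓝 0) := by
  simpa [inv_pow] using (tendsto_inv₀_cobounded (α := ℂ)).pow 2

theorem tendsto_kFun_div_infinity :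
    Tendsto (fun z => kFun z / z) (Bornology.cobounded ℂ) (𝓝 (Complex.I / 2)) := by
  have := (tendsto_inv_sq_cobounded.const_sub 1).const_mul (Complex.I / 2)
  rw [sub_zero, mul_one] at this
  refine this.congr' ?_
  filter_upwards [tendsto_cobounded_ne 0] with z hz
  simp only [kFun]; field_simp

theorem tendsto_lamFun_div_infinity :
    Tendsto (fun z => lamFun z / z) (Bornology.cobounded ℂ) (𝓝 (1 / 2)) := by
  have := (tendsto_inv_sq_cobounded.const_add 1).const_mul (1 / 2 : ℂ)
  rw [add_zero, mul_one] at this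
  refine this.congr' ?_
  filter_upwards [tendsto_cobounded_ne 0] with z hz
  simp only [lamFun]; field_simp

theorem tendsto_lamFun_inv_infinity :
    Tendsto (fun z => (lamFun z)⁻¹) (Bornology.cobounded ℂ) (𝓝 0) := by
  have := (tendsto_lamFun_div_infinity.inv₀ (by norm_num)).mul (tendsto_inv₀_cobounded (α := ℂ))
  rw [mul_zero] at this
  refine this.congr' ?_
  filter_upwards [tendsto_cobounded_ne 0] with z hz
  rw [inv_div]
  field_simp

theorem tendsto_kFun_mul_lamFun_inv_infinity :
    Tendsto (fun z => kFun z * (lamFun z)⁻¹) (Bornology.cobounded ℂ) (𝓝 Complex.I) := by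
  have := tendsto_kFun_div_infinity.mul (tendsto_lamFun_div_infinity.inv₀ (by norm_num))
  rw [show Complex.I / 2 * (1 / 2)⁻¹ = Complex.I by norm_num] at this
  refine this.congr' ?_
  filter_upwards [tendsto_cobounded_ne 0] with z hz
  rw [inv_div]
  field_simp

theorem tendsto_kFun_mul_lamFun_inv_sq_infinity :
    Tendsto (fun z => kFun z * (lamFun z ^ 2)⁻¹) (Bornology.cobounded ℂ) (𝓝 0) := by
  have := tendsto_kFun_mul_lamFun_inv_infinity.mul tendsto_lamFun_inv_infinity
  rw [mul_zero] at this
  refine this.congr fun z => ?_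
  rw [sq, mul_inv, mul_assoc]

theorem eventually_ne_zero_punctured : ∀ᶠ z : ℂ in 𝓝[≠] 0, z ≠ 0 := self_mem_nhdsWithin

theorem tendsto_mul_kFun_zero :
    Tendsto (fun z => z * kFun z) (𝓝[≠] 0) (𝓝 (-(Complex.I / 2))) := by
  have : ContinuousAt (fun z : ℂ => Complex.I * (z ^ 2 - 1) / 2) 0 := by fun_prop
  have := this.tendsto.mono_left (nhdsWithin_le_nhds (s := {0}ᶜ))
  rw [show Complex.I * ((0 : ℂ) ^ 2 - 1) / 2 = -(Complex.I / 2) by ring] at this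
  refine this.congr' ?_
  filter_upwards [eventually_ne_zero_punctured] with z hz
  rw [kFun_eq hz]; field_simp

theorem tendsto_mul_lamFun_zero :
    Tendsto (fun z => z * lamFun z) (𝓝[≠] 0) (𝓝 (1 / 2)) := by
  have : ContinuousAt (fun z : ℂ => (z ^ 2 + 1) / 2) 0 := by fun_prop
  have := this.tendsto.mono_left (nhdsWithin_le_nhds (s := {0}ᶜ))
  rw [show ((0 : ℂ) ^ 2 + 1) / 2 = 1 / 2 by ring] at this
  refine this.congr' ?_
  filter_upwards [eventually_ne_zero_punctured] with z hz
  rw [lamFun_eq hz]; field_simp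

theorem tendsto_id_zero : Tendsto (fun z : ℂ => z) (𝓝[≠] 0) (𝓝 0) :=
  tendsto_id.mono_left nhdsWithin_le_nhds

theorem tendsto_lamFun_inv_zero : Tendsto (fun z => (lamFun z)⁻¹) (𝓝[≠] 0) (𝓝 0) := by
  have := (tendsto_mul_lamFun_zero.inv₀ (by norm_num)).mul tendsto_id_zero
  rw [mul_zero] at this
  refine this.congr' ?_
  filter_upwards [eventually_ne_zero_punctured] with z hz
  rw [mul_inv]; field_simp

theorem tendsto_kFun_mul_lamFun_inv_zero :
    Tendsto (fun z => kFun z * (lamFun z)⁻¹) (𝓝[≠] 0) (𝓝 (-Complex.I)) := by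
  have := tendsto_mul_kFun_zero.mul (tendsto_mul_lamFun_zero.inv₀ (by norm_num))
  rw [show -(Complex.I / 2) * (1 / 2)⁻¹ = -Complex.I by norm_num] at this
  refine this.congr' ?_
  filter_upwards [eventually_ne_zero_punctured] with z hz
  rw [mul_inv]; field_simp

theorem tendsto_kFun_mul_lamFun_inv_sq_zero :
    Tendsto (fun z => kFun z * (lamFun z ^ 2)⁻¹) (𝓝[≠] 0) (𝓝 0) := by
  have := tendsto_kFun_mul_lamFun_inv_zero.mul tendsto_lamFun_inv_zero
  rw [mul_zero] at this
  refine this.congr fun z => ?_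
  rw [sq, mul_inv, mul_assoc]

/-! ### The Lax equations in `y` and `t` -/

namespace PoleSystem

variable {ι : Type*} [Fintype ι] [DecidableEq ι] {S : PoleSystem ι}

omit [Fintype ι] [DecidableEq ι] in
theorem zero_notMem : (0 : ℂ) ∉ range S.pt := notMem_range (by simp)

omit [Fintype ι] [DecidableEq ι] in
theorem Symm.neg {γ : ι → ℂ} (hγ : S.Symm γ) : S.Symm (-γ) := fun a => by simp [hγ a]

theorem sol_zero_mul_sol_zero {γ : ι → ℂ} (h : S.Regular γ) (hγ : S.Symm γ)
    (hγi : S.InvSymm γ) : S.sol γ 0 * S.sol (-γ) 0 = 1 := by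
  rw [← conj_sol hγ, map_zero, neg_zero, Complex.mul_conj, Complex.normSq_eq_norm_sq,
    h.norm_sol_zero hγ hγi]
  simp

/-- The evolution in `y` of the scalar solution. -/
theorem exists_y_evolution {γ ϖ' : ι → ℂ} (hγ : S.Symm γ) (hγi : S.InvSymm γ)
    (hreg : S.Regular γ)
    (h : ∀ a, ϖ' a = kFun (S.pt a) * γ a * S.sol γ (-S.pt a) + γ a * S.poleSum ϖ' (-S.pt a)) :
    ∃ ε : ℂ, ∀ z ≠ 0, z ∉ range S.pt →
      S.poleSum ϖ' z - kFun z / 2 * S.sol γ z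
        + (kFun z / 2 * (S.sol γ 0).re + lamFun z / 2 * (S.sol γ 0).im) * S.sol γ (-1 / z)
        = ε * S.sol γ z := by
  set P0 := S.sol γ 0 with hP0
  set C : ℂ := ((P0.re : ℝ) : ℂ) with hC
  set s : ℂ := ((P0.im : ℝ) : ℂ) with hs
  have hP0' : P0 = C + s * Complex.I := (Complex.re_add_im P0).symm
  have hI : Complex.I ^ 2 = -1 := Complex.I_sq
  have hCs : C ^ 2 + s ^ 2 = 1 := by
    have h1 := hreg.norm_sol_zero hγ hγi
    have h2 : P0.re ^ 2 + P0.im ^ 2 = 1 := by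
      have := Complex.normSq_eq_norm_sq P0
      rw [h1, Complex.normSq_apply] at this
      linarith
    rw [hC, hs]
    exact_mod_cast h2
  have hPQ := sol_zero_mul_sol_zero hreg hγ hγi
  rw [← hP0] at hPQ
  -- By `sol_inv` the factor `P0` turns `sol (-γ) z` into `sol γ (-1/z)`. The multiplier is odd, so
  -- its product with `sol (-γ)` obeys the residue conditions for `γ`.
  set κ : ℂ → ℂ := fun z => (kFun z / 2 * C + lamFun z / 2 * s) * P0 with hκ
  set F : ℂ → ℂ := fun z => (S.poleSum ϖ' z + -(kFun z / 2) * S.sol γ z) + κ z * S.sol (-γ) z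
    with hF
  have hkc : ∀ z ≠ 0, DifferentiableAt ℂ (fun z => -(kFun z / 2)) z := fun z hz =>
    ((differentiableAt_kFun hz).div_const 2).neg
  have hκc : ∀ z ≠ 0, DifferentiableAt ℂ κ z := fun z hz =>
    ((((differentiableAt_kFun hz).div_const 2).mul_const C).add
      (((differentiableAt_lamFun hz).div_const 2).mul_const s)).mul_const P0
  have hres : S.ResidueConditions γ F := by
    refine ResidueConditions.add (residueConditions_evolution hγ
      (fun a => (hkc _ (pt_ne_zero a)).continuousAt)
      (fun a => (hkc _ (neg_ne_zero.2 (pt_ne_zero a))).continuousAt)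
      (fun a => by rw [kFun_neg]; ring) (fun a => ?_)) ?_
    · rw [h a]; ring
    · exact ResidueConditions.mul_odd (residueConditions_sol hγ.neg)
        (fun a => (hκc _ (pt_ne_zero a)).continuousAt)
        (fun a => (hκc _ (neg_ne_zero.2 (pt_ne_zero a))).continuousAt)
        (fun a => by simp only [hκ, kFun_neg, lamFun_neg]; ring)
  have hd : ∀ z ≠ 0, z ∉ range S.pt → DifferentiableAt ℂ F z := fun z hz hzp =>
    ((differentiableAt_poleSum ϖ' hzp).add ((hkc z hz).mul (differentiableAt_sol γ hzp))).add
      ((hκc z hz).mul (differentiableAt_sol (-γ) hzp))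
  have hzero : Tendsto (fun z => (z - 0) * F z) (𝓝[≠] 0) (𝓝 0) := by
    have c1 := ((differentiableAt_poleSum ϖ' (S := S) zero_notMem).continuousAt.tendsto.mono_left
      (nhdsWithin_le_nhds (s := {0}ᶜ)))
    have c2 := ((differentiableAt_sol γ (S := S) zero_notMem).continuousAt.tendsto.mono_left
      (nhdsWithin_le_nhds (s := {0}ᶜ)))
    have c3 := ((differentiableAt_sol (-γ) (S := S) zero_notMem).continuousAt.tendsto.mono_left
      (nhdsWithin_le_nhds (s := {0}ᶜ)))
    have hk := tendsto_mul_kFun_zero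
    have hl := tendsto_mul_lamFun_zero
    have := ((tendsto_id_zero.mul c1).add (((hk.div_const 2).neg).mul c2)).add
      (((((hk.div_const 2).mul_const C).add ((hl.div_const 2).mul_const s)).mul_const P0).mul c3)
    -- The simple pole of `k` and `λ` at `0` cancels. The coefficients `C` and `s` in `κ` are chosen
    -- for this and for the cancellation of the linear growth at infinity, which uses `C² + s² = 1`.
    have e : 0 * S.poleSum ϖ' 0 + -(-(Complex.I / 2) / 2) * S.sol γ 0
        + (-(Complex.I / 2) / 2 * C + 1 / 2 / 2 * s) * P0 * S.sol (-γ) 0 = 0 := by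
      rw [mul_assoc _ P0, hPQ, ← hP0, hP0']
      linear_combination s / 4 * hI
    rw [e] at this
    refine this.congr fun z => ?_
    simp only [hF, hκ]; ring
  have hinf : Tendsto F (Bornology.cobounded ℂ)
      (𝓝 (-(Complex.I / 2) / 2 * (∑ a, S.resid 1 γ a)
        + (Complex.I / 2 / 2 * C + 1 / 2 / 2 * s) * P0 * (∑ a, S.resid 1 (-γ) a))) := by
    have hk := tendsto_kFun_div_infinity
    have hl := tendsto_lamFun_div_infinity
    have i1 := tendsto_mul_poleSum_infinity (S := S) (S.resid 1 γ)
    have i2 := tendsto_mul_poleSum_infinity (S := S) (S.resid 1 (-γ))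
    -- After the linear growth has cancelled, the constant term `1` of the two solutions leaves this
    -- multiple of `1/z`.
    have i3 := (tendsto_inv₀_cobounded (α := ℂ)).const_mul
      (Complex.I / 4 - (Complex.I / 4 * C - s / 4) * P0)
    have := (((tendsto_poleSum_infinity (S := S) ϖ').add i3).add
      ((((hk.div_const 2).neg).mul i1).add
      (((((hk.div_const 2).mul_const C).add ((hl.div_const 2).mul_const s)).mul_const P0).mul i2)))
    rw [mul_zero, zero_add, zero_add, show -(Complex.I / 2 / 2) = -(Complex.I / 2) / 2 by ring]
      at this
    refine this.congr' ?_
    filter_upwards [tendsto_cobounded_ne 0] with z hz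
    simp only [hF, hκ, sol, kFun, lamFun]
    field_simp
    rw [hP0']
    linear_combination (-4 * z ^ 2 * Complex.I) * hCs - 4 * z ^ 2 * C * s * hI
  obtain ⟨L, hL⟩ : ∃ L, Tendsto F (Bornology.cobounded ℂ) (𝓝 L) := ⟨_, hinf⟩
  have key := eq_mul_sol hγ (finite_singleton (0 : ℂ) |>.union (finite_range S.pt)) (F := F)
    (fun z hz => hd z (fun h => hz (Or.inl h)) (fun h => hz (Or.inr h)))
    (by
      rintro s (rfl | hs) hsr
      · exact hzero
      · exact absurd hs hsr) hres hL
  refine ⟨L, fun z hz hzp => ?_⟩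
  have := key z (by rintro (h | h); exacts [hz h, hzp h]) hzp
  rw [← this, sol_inv hγ hγi hz hzp]
  simp only [hF, hκ]
  ring

/-- The evolution in `t` of the scalar solution, evaluated at `i`, `-i` and `0`. -/
theorem t_evolution {γ ϖ' : ι → ℂ} (hγ : S.Symm γ) (hγi : S.InvSymm γ)
    (hreg : S.Regular γ)
    (h : ∀ a, ϖ' a = -2 * (kFun (S.pt a) * (lamFun (S.pt a) ^ 2)⁻¹) * γ a * S.sol γ (-S.pt a)
      + γ a * S.poleSum ϖ' (-S.pt a)) {a b : ℂ}
    (ha : deriv (S.sol γ) Complex.I = a * S.sol γ Complex.I)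
    (hb : deriv (S.sol γ) (-Complex.I) = -b * S.sol γ (-Complex.I)) :
    S.poleSum ϖ' Complex.I = (2 * a * b - Complex.I * (a - b)) * S.sol γ Complex.I ∧
    S.poleSum ϖ' (-Complex.I) =
      (-(2 * a * b) - Complex.I * (a - b)) * S.sol γ (-Complex.I) ∧
    S.poleSum ϖ' 0 = -2 * Complex.I * (a - b) * S.sol γ 0 := by
  set P0 := S.sol γ 0 with hP0
  have hPQ := sol_zero_mul_sol_zero hreg hγ hγi
  rw [← hP0] at hPQ
  -- The values of `u` and `w` are the ones for which the simple poles at `i` and `-i` cancel. They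
  -- turn out to be the solution of the mCH equation and its `x`-derivative.
  set u : ℂ := -(a + b) with hu
  set w : ℂ := a - b with hw
  set c : ℂ → ℂ := fun z => kFun z * (lamFun z ^ 2)⁻¹ with hc
  set κ : ℂ → ℂ := fun z => -((c z + u * (lamFun z)⁻¹) * P0) with hκ
  set ν : ℂ → ℂ := fun z => -(kFun z * (lamFun z)⁻¹ * w) with hν
  set F : ℂ → ℂ := fun z => (S.poleSum ϖ' z + c z * S.sol γ z) + κ z * S.sol (-γ) z
    + ν z * S.sol γ z with hF
  have hl0 : ∀ z, z ∉ ({0, Complex.I, -Complex.I} : Set ℂ) → z ≠ 0 ∧ lamFun z ≠ 0 := by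
    intro z hz
    simp only [mem_insert_iff, mem_singleton_iff, not_or] at hz
    exact ⟨hz.1, lamFun_ne_zero hz.1 hz.2.1 hz.2.2⟩
  have hpl : ∀ a, S.pt a ∉ ({0, Complex.I, -Complex.I} : Set ℂ) := by
    intro a h
    rcases h with h | h | h
    · exact pt_ne_zero a h
    · exact S.ne_I a h
    · exact neg_I_notMem (S := S) ⟨a, h⟩
  have hpl' : ∀ a, -S.pt a ∉ ({0, Complex.I, -Complex.I} : Set ℂ) := by
    intro a h
    rcases h with h | h | h
    · exact pt_ne_zero a (neg_eq_zero.1 h)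
    · exact neg_I_notMem (S := S) ⟨a, by rw [← h, neg_neg]⟩
    · exact S.ne_I a (neg_injective h)
  have hcd : ∀ z, z ∉ ({0, Complex.I, -Complex.I} : Set ℂ) → DifferentiableAt ℂ c z := fun z hz =>
    (differentiableAt_kFun (hl0 z hz).1).mul
      (((differentiableAt_lamFun (hl0 z hz).1).pow 2).inv (pow_ne_zero 2 (hl0 z hz).2))
  have hld : ∀ z, z ∉ ({0, Complex.I, -Complex.I} : Set ℂ) →
      DifferentiableAt ℂ (fun z => (lamFun z)⁻¹) z := fun z hz =>
    (differentiableAt_lamFun (hl0 z hz).1).inv (hl0 z hz).2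
  have hκd : ∀ z, z ∉ ({0, Complex.I, -Complex.I} : Set ℂ) → DifferentiableAt ℂ κ z :=
    fun z hz => (((hcd z hz).add ((hld z hz).const_mul u)).mul_const P0).neg
  have hνd : ∀ z, z ∉ ({0, Complex.I, -Complex.I} : Set ℂ) → DifferentiableAt ℂ ν z :=
    fun z hz => (((differentiableAt_kFun (hl0 z hz).1).mul (hld z hz)).mul_const w).neg
  have hres : S.ResidueConditions γ F := by
    refine ResidueConditions.add (ResidueConditions.add (residueConditions_evolution hγ
      (fun a => (hcd _ (hpl a)).continuousAt) (fun a => (hcd _ (hpl' a)).continuousAt)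
      (fun a => by simp only [hc, kFun_neg, lamFun_neg, neg_sq]; ring) h) ?_) ?_
    · exact ResidueConditions.mul_odd (residueConditions_sol hγ.neg)
        (fun a => (hκd _ (hpl a)).continuousAt) (fun a => (hκd _ (hpl' a)).continuousAt)
        (fun a => by simp only [hκ, hc, kFun_neg, lamFun_neg, neg_sq, inv_neg]; ring)
    · exact ResidueConditions.mul_even (residueConditions_sol hγ)
        (fun a => (hνd _ (hpl a)).continuousAt) (fun a => (hνd _ (hpl' a)).continuousAt)
        (fun a => by simp only [hν, kFun_neg, lamFun_neg, inv_neg]; ring)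
  have hd : ∀ z, z ∉ ({0, Complex.I, -Complex.I} : Set ℂ) → z ∉ range S.pt →
      DifferentiableAt ℂ F z := fun z hz hzp =>
    (((differentiableAt_poleSum ϖ' hzp).add ((hcd z hz).mul (differentiableAt_sol γ hzp))).add
      ((hκd z hz).mul (differentiableAt_sol (-γ) hzp))).add
      ((hνd z hz).mul (differentiableAt_sol γ hzp))
  have hzero : Tendsto F (𝓝[≠] 0) (𝓝 (S.poleSum ϖ' 0 + Complex.I * w * P0)) := by
    have c1 := ((differentiableAt_poleSum ϖ' (S := S) zero_notMem).continuousAt.tendsto.mono_left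
      (nhdsWithin_le_nhds (s := {0}ᶜ)))
    have c2 := ((differentiableAt_sol γ (S := S) zero_notMem).continuousAt.tendsto.mono_left
      (nhdsWithin_le_nhds (s := {0}ᶜ)))
    have c3 := ((differentiableAt_sol (-γ) (S := S) zero_notMem).continuousAt.tendsto.mono_left
      (nhdsWithin_le_nhds (s := {0}ᶜ)))
    have k1 := tendsto_kFun_mul_lamFun_inv_sq_zero
    have k2 := tendsto_lamFun_inv_zero
    have k3 := tendsto_kFun_mul_lamFun_inv_zero
    have := ((c1.add (k1.mul c2)).add ((((k1.add (k2.const_mul u)).mul_const P0).neg).mul c3)).add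
      (((k3.mul_const w).neg).mul c2)
    convert this using 2
    rw [← hP0]
    ring
  -- Only `k λ⁻¹ → i` survives at infinity. At `0` the same product tends to `-i`, and this
  -- difference of sign is what makes `sol γ 0` rotate in time.
  have hinf : Tendsto F (Bornology.cobounded ℂ) (𝓝 (-(Complex.I * w))) := by
    have c1 := tendsto_poleSum_infinity (S := S) ϖ'
    have c2 := tendsto_sol_infinity (S := S) γ
    have c3 := tendsto_sol_infinity (S := S) (-γ)
    have k1 := tendsto_kFun_mul_lamFun_inv_sq_infinity
    have k2 := tendsto_lamFun_inv_infinity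
    have k3 := tendsto_kFun_mul_lamFun_inv_infinity
    have := ((c1.add (k1.mul c2)).add ((((k1.add (k2.const_mul u)).mul_const P0).neg).mul c3)).add
      (((k3.mul_const w).neg).mul c2)
    convert this using 2
    ring
  have hloc : ∀ σ : ℂ, σ ^ 2 = -1 → σ ∉ range S.pt →
      2 * deriv (S.sol γ) σ * kFun σ - u * S.sol γ σ - kFun σ * w * S.sol γ σ = 0 →
      Tendsto F (𝓝[≠] σ) (𝓝 (S.poleSum ϖ' σ + deriv (S.sol γ) σ * (u - kFun σ * w))) := by
    intro σ hσ hσp h0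
    have hev : ∀ᶠ z in 𝓝 σ, z ∉ range S.pt :=
      (finite_range S.pt).isClosed.isOpen_compl.mem_nhds hσp
    have h1 := tendsto_time_evolution hσ (hev.mono fun z hz => differentiableAt_sol γ hz) h0
    have h2 := ((differentiableAt_poleSum ϖ' (S := S) hσp).continuousAt.tendsto.mono_left
      (nhdsWithin_le_nhds (s := {σ}ᶜ)))
    refine (h2.add h1).congr' ?_
    filter_upwards [mem_nhdsWithin_of_mem_nhds hev, mem_nhdsWithin_of_mem_nhds
      (isOpen_ne.mem_nhds (ne_zero_of_sq_eq_neg_one hσ))] with z hz hz0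
    rw [sol_inv hγ hγi hz0 hz]
    simp only [hF, hκ, hν, hc]
    ring
  have hII : (-Complex.I) ^ 2 = -1 := by rw [neg_sq, Complex.I_sq]
  have kI : kFun Complex.I = -1 := by
    rw [kFun_of_sq_eq_neg_one Complex.I_sq, Complex.I_mul_I]
  have kI' : kFun (-Complex.I) = 1 := by rw [kFun_neg, kI, neg_neg]
  have hlim1 := hloc Complex.I Complex.I_sq I_notMem (by rw [kI, ha, hu, hw]; ring)
  have hlim2 := hloc (-Complex.I) hII neg_I_notMem (by rw [kI', hb, hu, hw]; ring)
  have hT : ({0, Complex.I, -Complex.I} : Set ℂ).Finite := by simp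
  have hlim : ∀ s ∈ ({0, Complex.I, -Complex.I} : Set ℂ), ∃ ℓ, Tendsto F (𝓝[≠] s) (𝓝 ℓ) := by
    rintro s (rfl | rfl | rfl)
    exacts [⟨_, hzero⟩, ⟨_, hlim1⟩, ⟨_, hlim2⟩]
  have key := eq_mul_sol hγ (hT.union (finite_range S.pt)) (F := F)
    (fun z hz => hd z (fun h => hz (Or.inl h)) (fun h => hz (Or.inr h)))
    (by
      rintro s (hs | hs) hsr
      · obtain ⟨ℓ, hℓ⟩ := hlim s hs
        have h1 := tendsto_mul_of_differentiableAt (f := fun _ => 1) (c := s) continuousAt_const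
        simpa using h1.mul hℓ
      · exact absurd hs hsr) hres hinf
  -- Since `F` is a multiple of the solution off a finite set, its limits at `0` and `±i` can be
  -- computed in two ways; comparing them gives the three evolution formulas.
  have hval : ∀ s ∉ range S.pt, Tendsto F (𝓝[≠] s) (𝓝 (-(Complex.I * w) * S.sol γ s)) := by
    intro s hs
    have h1 := ((differentiableAt_sol γ (S := S) hs).continuousAt.tendsto.mono_left
      (nhdsWithin_le_nhds (s := {s}ᶜ))).const_mul (-(Complex.I * w))
    refine h1.congr' ?_
    filter_upwards [eventually_notMem_of_finite (hT.union (finite_range S.pt)) s] with z hz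
    exact (key z hz fun h => hz (Or.inr h)).symm
  refine ⟨?_, ?_, ?_⟩
  · have := tendsto_nhds_unique hlim1 (hval _ I_notMem)
    rw [kI, ha] at this
    rw [hu, hw] at this
    linear_combination this
  · have := tendsto_nhds_unique hlim2 (hval _ neg_I_notMem)
    rw [kI', hb] at this
    rw [hu, hw] at this
    linear_combination this
  · have := tendsto_nhds_unique hzero (hval _ zero_notMem)
    rw [← hP0] at this
    linear_combination this

end PoleSystem

end

/-! ### The flow of the values at `0` and `±i` -/

section

namespace PoleSystem

variable {ι : Type*} [Fintype ι] [DecidableEq ι] {S : PoleSystem ι}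

omit [DecidableEq ι] in
theorem eventually_ne_zero_and_notMem {σ : ℂ} (h0 : σ ≠ 0) (hp : σ ∉ range S.pt) :
    ∀ᶠ z in 𝓝 σ, z ≠ 0 ∧ z ∉ range S.pt :=
  Filter.inter_mem (isOpen_ne.mem_nhds h0)
    ((finite_range S.pt).isClosed.isOpen_compl.mem_nhds hp)

/-- The evolution in `y` of the scalar solution, evaluated at `i` and `-i` to first order. -/
theorem y_evolution {γ ϖ' : ι → ℂ} (hγ : S.Symm γ) (hγi : S.InvSymm γ) (hreg : S.Regular γ)
    (h : ∀ a, ϖ' a = kFun (S.pt a) * γ a * S.sol γ (-S.pt a) + γ a * S.poleSum ϖ' (-S.pt a)) :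
    ∃ ε : ℂ, ∀ σ : ℂ, σ ^ 2 = -1 → σ ∉ range S.pt →
      S.poleSum ϖ' σ = (ε + kFun σ / 2 * (1 - (S.sol γ 0).re)) * S.sol γ σ ∧
      deriv (S.poleSum ϖ') σ = (ε + kFun σ / 2 * (1 + (S.sol γ 0).re)) * deriv (S.sol γ) σ
        - (S.sol γ 0).im / 2 * S.sol γ σ := by
  obtain ⟨ε, hε⟩ := exists_y_evolution hγ hγi hreg h
  refine ⟨ε, fun σ hσ hσp => ?_⟩
  have hσ0 := ne_zero_of_sq_eq_neg_one hσ
  have hσi := neg_one_div_of_sq_eq_neg_one hσ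
  have hl := lamFun_of_sq_eq_neg_one hσ
  constructor
  · have := hε σ hσ0 hσp
    rw [hσi, hl] at this
    linear_combination this
  -- Differentiate the Lax identity in `z` at `σ`, where `λ = 0`, `λ' = 1`, `k' = 0` and `-1/σ = σ`.
  · have d1 := (differentiableAt_poleSum (S := S) ϖ' hσp).hasDerivAt
    have d2 := (differentiableAt_sol (S := S) γ hσp).hasDerivAt
    have d3 := hasDerivAt_comp_neg_one_div hσ d2
    have k := hasDerivAt_kFun_zero hσ
    have l := hasDerivAt_lamFun_one hσ
    have e1 := (d1.sub ((k.div_const 2).mul d2)).add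
      ((((k.div_const 2).mul_const ((S.sol γ 0).re : ℂ)).add
        ((l.div_const 2).mul_const ((S.sol γ 0).im : ℂ))).mul d3)
    have e2 := d2.const_mul ε
    have heq : (fun z => ε * S.sol γ z) =ᶠ[𝓝 σ] _ :=
      (eventually_ne_zero_and_notMem hσ0 hσp).mono fun z hz => (hε z hz.1 hz.2).symm
    have := e1.unique (e2.congr_of_eventuallyEq heq.symm)
    simp only [Pi.add_apply, hl, hσi, zero_div, zero_mul, zero_add, add_zero] at this
    linear_combination this

/-- Differentiating the residue equations in the parameter gives the inhomogeneous equations that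
the evolution lemmas take as input. -/
theorem hasDerivAt_resid {g : ℝ → ι → ℂ} {g' : ι → ℂ} {s : ℝ} (hg : ∀ s, S.Symm (g s))
    (hsm : ∀ a, ContDiff ℝ 1 fun s => g s a) (hd : ∀ a, HasDerivAt (fun s => g s a) (g' a) s) :
    ∃ ϖ' : ι → ℂ, (∀ a, HasDerivAt (fun s => S.resid 1 (g s) a) (ϖ' a) s) ∧
      ∀ a, ϖ' a = g' a * S.sol (g s) (-S.pt a) + g s a * S.poleSum ϖ' (-S.pt a) := by
  have h1 : ∀ a, HasDerivAt (fun s => S.resid 1 (g s) a)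
      (deriv (fun s => S.resid 1 (g s) a) s) s := fun a =>
    ((contDiff_resid (S := S) hg hsm a).differentiable one_ne_zero s).hasDerivAt
  refine ⟨_, h1, fun a => ?_⟩
  have h2 : HasDerivAt (fun s => g s a * S.sol (g s) (-S.pt a))
      (g' a * S.sol (g s) (-S.pt a) + g s a *
        S.poleSum (fun a => deriv (fun s => S.resid 1 (g s) a) s) (-S.pt a)) s := by
    refine (hd a).mul ?_
    exact (HasDerivAt.fun_sum fun b _ => (h1 b).div_const _).const_add 1
  refine (h1 a).unique (h2.congr_of_eventuallyEq (Eventually.of_forall fun s => ?_))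
  exact resid_one_spec (hg s) a

omit [DecidableEq ι] in
theorem deriv_poleSum (ϖ : ι → ℂ) {z : ℂ} (hz : z ∉ range S.pt) :
    deriv (S.poleSum ϖ) z = ∑ a, ϖ a * (-1 / (z - S.pt a) ^ 2) := by
  refine HasDerivAt.deriv (HasDerivAt.fun_sum fun a _ => ?_)
  have : z - S.pt a ≠ 0 := sub_ne_zero.2 fun h => hz ⟨a, h.symm⟩
  simpa [div_eq_mul_inv] using
    (((hasDerivAt_id z).sub_const (S.pt a)).inv this).const_mul (ϖ a)

theorem deriv_sol (γ : ι → ℂ) (z : ℂ) :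
    deriv (S.sol γ) z = deriv (S.poleSum (S.resid 1 γ)) z := by
  change deriv (fun z => 1 + S.poleSum (S.resid 1 γ) z) z = _
  rw [deriv_const_add]

omit [DecidableEq ι] in
theorem hasDerivAt_poleSum_param {ϖ : ℝ → ι → ℂ} {ϖ' : ι → ℂ} {s : ℝ}
    (h : ∀ a, HasDerivAt (fun s => ϖ s a) (ϖ' a) s) (z : ℂ) :
    HasDerivAt (fun s => S.poleSum (ϖ s) z) (S.poleSum ϖ' z) s :=
  HasDerivAt.fun_sum fun a _ => (h a).div_const _

omit [DecidableEq ι] in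
theorem hasDerivAt_deriv_poleSum_param {ϖ : ℝ → ι → ℂ} {ϖ' : ι → ℂ} {s : ℝ}
    (h : ∀ a, HasDerivAt (fun s => ϖ s a) (ϖ' a) s) {z : ℂ} (hz : z ∉ range S.pt) :
    HasDerivAt (fun s => deriv (S.poleSum (ϖ s)) z) (deriv (S.poleSum ϖ') z) s := by
  simp only [deriv_poleSum _ hz]
  exact HasDerivAt.fun_sum fun a _ => (h a).mul_const _

/-- The logarithmic derivatives of the scalar solution at `± i` are real. -/
theorem conj_deriv_sol_div {γ : ι → ℂ} (hγ : S.Symm γ) (hγi : S.InvSymm γ)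
    {σ : ℂ} (hσ : σ ^ 2 = -1) (hσp : σ ∉ range S.pt) (hc : conj σ = -σ)
    (h0 : S.sol γ σ ≠ 0) :
    conj (deriv (S.sol γ) σ / S.sol γ σ) = deriv (S.sol γ) σ / S.sol γ σ := by
  have hσ0 := ne_zero_of_sq_eq_neg_one hσ
  have hσi := neg_one_div_of_sq_eq_neg_one hσ
  have d := (differentiableAt_sol (S := S) γ hσp).hasDerivAt
  have hev : ∀ᶠ z in 𝓝 σ, z ≠ 0 ∧ z ∉ range S.pt :=
    eventually_ne_zero_and_notMem hσ0 hσp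
  have heq : ∀ z, z ≠ 0 → z ∉ range S.pt →
      S.sol γ (-1 / z) = S.sol γ 0 * conj (S.sol γ (-conj z)) := fun z hz hzp => by
    rw [sol_inv hγ hγi hz hzp, conj_sol hγ]
  have d1 : HasDerivAt (fun z => conj (S.sol γ (-conj z))) (-conj (deriv (S.sol γ) σ)) σ := by
    have e : HasDerivAt (fun z => S.sol γ (-z)) (-deriv (S.sol γ) σ) (conj σ) := by
      have d' : HasDerivAt (S.sol γ) (deriv (S.sol γ) σ) (-conj σ) := by rwa [hc, neg_neg]
      simpa [Function.comp_def] using HasDerivAt.comp (conj σ) d' (hasDerivAt_neg (conj σ))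
    simpa [Function.comp_def] using e.conj_conj
  -- Comparing derivatives of `P(-1/z) = P(0) P(-z*)*` at `σ` gives `P' = P(0) (P')*`. The values
  -- satisfy the same relation, so the quotient is real.
  have d2 := (hasDerivAt_comp_neg_one_div hσ d).unique
    ((d1.const_mul (S.sol γ 0)).congr_of_eventuallyEq (hev.mono fun z hz => heq z hz.1 hz.2))
  have e2 := heq σ hσ0 hσp
  rw [hσi, hc, neg_neg] at e2
  have hP0 : S.sol γ 0 ≠ 0 := fun h => h0 (by rw [e2, h, zero_mul])
  have hcn : conj (S.sol γ σ) ≠ 0 := by simpa using h0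
  rw [map_div₀, div_eq_div_iff hcn h0]
  refine mul_left_cancel₀ hP0 ?_
  linear_combination deriv (S.sol γ) σ * e2 + S.sol γ σ * d2

end PoleSystem

theorem HasDerivAt.re' {f : ℝ → ℂ} {f' : ℂ} {s : ℝ} (h : HasDerivAt f f' s) :
    HasDerivAt (fun s => (f s).re) f'.re s :=
  Complex.reCLM.hasFDerivAt.comp_hasDerivAt s h

theorem HasDerivAt.im' {f : ℝ → ℂ} {f' : ℂ} {s : ℝ} (h : HasDerivAt f f' s) :
    HasDerivAt (fun s => (f s).im) f'.im s :=
  Complex.imCLM.hasFDerivAt.comp_hasDerivAt s h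

/-! ### Reconstruction data and their evolution -/

namespace PoleSystem

variable {ι : Type*} [Fintype ι] [DecidableEq ι] (S : PoleSystem ι)

/-- The real logarithmic derivative of the first column sum at `i`. -/
def logDerivA (γ : ι → ℂ) : ℝ := (deriv (S.sol γ) Complex.I / S.sol γ Complex.I).re

/-- The real logarithmic derivative of the second column sum at `i`. -/
def logDerivB (γ : ι → ℂ) : ℝ := (-(deriv (S.sol γ) (-Complex.I) / S.sol γ (-Complex.I))).re

/-- The shift `x - y`. -/
def shift (γ : ι → ℂ) : ℝ := Real.log (S.sol γ Complex.I / S.sol γ (-Complex.I)).re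

variable {S}

theorem Regular.deriv_I {γ : ι → ℂ} (h : S.Regular γ) (hγ : S.Symm γ) (hγi : S.InvSymm γ) :
    deriv (S.sol γ) Complex.I / S.sol γ Complex.I = S.logDerivA γ := by
  rw [logDerivA, eq_comm, ← Complex.conj_eq_iff_re]
  exact conj_deriv_sol_div hγ hγi Complex.I_sq I_notMem (by simp) h.ne_zero

theorem Regular.deriv_neg_I {γ : ι → ℂ} (h : S.Regular γ) (hγ : S.Symm γ) (hγi : S.InvSymm γ) :
    deriv (S.sol γ) (-Complex.I) / S.sol γ (-Complex.I) = -S.logDerivB γ := by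
  rw [logDerivB, eq_comm, neg_eq_iff_eq_neg, ← Complex.conj_eq_iff_re, map_neg]
  rw [conj_deriv_sol_div hγ hγi (by simp) neg_I_notMem (by simp) h.ne_zero']

theorem Regular.ratio_eq {γ : ι → ℂ} (h : S.Regular γ) :
    S.sol γ Complex.I / S.sol γ (-Complex.I) = (Real.exp (S.shift γ) : ℝ) := by
  obtain ⟨x, hx⟩ := h.ratio
  have : S.sol γ Complex.I / S.sol γ (-Complex.I) = (Real.exp x : ℝ) := by
    rw [hx, mul_div_assoc, div_self h.ne_zero', mul_one]
  rw [shift, this, Complex.ofReal_re, Real.log_exp]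

/-- All three quantities are built from quotients of solutions, so the unknown constant `ε` of
`y_evolution` drops out. -/
theorem Regular.hasDerivAt_y {g : ℝ → ι → ℂ} {s : ℝ} (hg : ∀ s, S.Symm (g s))
    (hgi : ∀ s, S.InvSymm (g s)) (hreg : ∀ s, S.Regular (g s))
    (hsm : ∀ a, ContDiff ℝ 1 fun s => g s a)
    (hd : ∀ a, HasDerivAt (fun s => g s a) (kFun (S.pt a) * g s a) s) :
    HasDerivAt (fun s => S.shift (g s)) ((S.sol (g s) 0).re - 1) s ∧
    HasDerivAt (fun s => S.logDerivA (g s))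
      (-((S.sol (g s) 0).re * S.logDerivA (g s)) - (S.sol (g s) 0).im / 2) s ∧
    HasDerivAt (fun s => S.logDerivB (g s))
      ((S.sol (g s) 0).re * S.logDerivB (g s) + (S.sol (g s) 0).im / 2) s := by
  obtain ⟨ϖ', h1, h2⟩ := hasDerivAt_resid hg hsm hd
  obtain ⟨ε, hε⟩ := y_evolution (hg s) (hgi s) (hreg s) h2
  obtain ⟨e1, e2⟩ := hε Complex.I Complex.I_sq I_notMem
  obtain ⟨e3, e4⟩ := hε (-Complex.I) (by simp) neg_I_notMem
  have kI : kFun Complex.I = -1 := by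
    rw [kFun_of_sq_eq_neg_one Complex.I_sq, Complex.I_mul_I]
  rw [kI] at e1 e2
  rw [kFun_neg, kI, neg_neg] at e3 e4
  have n1 := (hreg s).ne_zero
  have n2 := (hreg s).ne_zero'
  have d1 : ∀ z, HasDerivAt (fun s => S.sol (g s) z) (S.poleSum ϖ' z) s := fun z =>
    (hasDerivAt_poleSum_param h1 z).const_add 1
  have d2 : ∀ z ∉ range S.pt, HasDerivAt (fun s => deriv (S.sol (g s)) z)
      (deriv (S.poleSum ϖ') z) s := fun z hz => by
    simp only [deriv_sol]
    exact hasDerivAt_deriv_poleSum_param h1 hz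
  have f1 := (hreg s).deriv_I (hg s) (hgi s)
  have f2 := (hreg s).deriv_neg_I (hg s) (hgi s)
  rw [div_eq_iff n1] at f1
  rw [div_eq_iff n2] at f2
  refine ⟨?_, ?_, ?_⟩
  · have := HasDerivAt.re' ((d1 Complex.I).fun_div (d1 (-Complex.I)) n2)
    have hr := (hreg s).ratio_eq
    have h3 := this.log (by simp only [hr, Complex.ofReal_re]; exact (Real.exp_pos _).ne')
    refine h3.congr_deriv ?_
    have : (S.poleSum ϖ' Complex.I * S.sol (g s) (-Complex.I) -
        S.sol (g s) Complex.I * S.poleSum ϖ' (-Complex.I)) / S.sol (g s) (-Complex.I) ^ 2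
        = (((S.sol (g s) 0).re - 1 : ℝ) : ℂ) * (S.sol (g s) Complex.I / S.sol (g s) (-Complex.I)) := by
      rw [e1, e3]; push_cast; field_simp; ring
    rw [this, hr, Complex.re_ofReal_mul, Complex.ofReal_re, mul_div_assoc,
      div_self (Real.exp_pos _).ne', mul_one]
  · have := HasDerivAt.re' ((d2 Complex.I I_notMem).fun_div (d1 Complex.I) n1)
    refine this.congr_deriv ?_
    rw [e1, e2, f1, ← Complex.ofReal_re (-((S.sol (g s) 0).re * S.logDerivA (g s)) -
      (S.sol (g s) 0).im / 2)]
    congr 1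
    push_cast; field_simp; ring
  · have := HasDerivAt.re' ((d2 (-Complex.I) neg_I_notMem).fun_div (d1 (-Complex.I)) n2).fun_neg
    refine this.congr_deriv ?_
    rw [e3, e4, f2, ← Complex.ofReal_re ((S.sol (g s) 0).re * S.logDerivB (g s) +
      (S.sol (g s) 0).im / 2)]
    congr 1
    push_cast; field_simp; ring

/-- In the ratio of the values at `±i` the common terms `-i(a - b)` cancel and `4ab` remains. The
value at `0` is multiplied by `-2i(a - b)`, a rotation that exchanges its real and imaginary parts.
-/
theorem Regular.hasDerivAt_t {g : ℝ → ι → ℂ} {s : ℝ} (hg : ∀ s, S.Symm (g s))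
    (hgi : ∀ s, S.InvSymm (g s)) (hreg : ∀ s, S.Regular (g s))
    (hsm : ∀ a, ContDiff ℝ 1 fun s => g s a)
    (hd : ∀ a, HasDerivAt (fun s => g s a)
      (-2 * (kFun (S.pt a) * (lamFun (S.pt a) ^ 2)⁻¹) * g s a) s) :
    HasDerivAt (fun s => S.shift (g s)) (4 * S.logDerivA (g s) * S.logDerivB (g s)) s ∧
    HasDerivAt (fun s => (S.sol (g s) 0).re)
      (2 * (S.logDerivA (g s) - S.logDerivB (g s)) * (S.sol (g s) 0).im) s ∧
    HasDerivAt (fun s => (S.sol (g s) 0).im)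
      (-(2 * (S.logDerivA (g s) - S.logDerivB (g s)) * (S.sol (g s) 0).re)) s := by
  obtain ⟨ϖ', h1, h2⟩ := hasDerivAt_resid hg hsm hd
  have n1 := (hreg s).ne_zero
  have n2 := (hreg s).ne_zero'
  have d1 : ∀ z, HasDerivAt (fun s => S.sol (g s) z) (S.poleSum ϖ' z) s := fun z =>
    (hasDerivAt_poleSum_param h1 z).const_add 1
  have f1 := (hreg s).deriv_I (hg s) (hgi s)
  have f2 := (hreg s).deriv_neg_I (hg s) (hgi s)
  rw [div_eq_iff n1] at f1
  rw [div_eq_iff n2] at f2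
  obtain ⟨e1, e2, e3⟩ := t_evolution (hg s) (hgi s) (hreg s) h2 f1 f2
  refine ⟨?_, ?_, ?_⟩
  · have := HasDerivAt.re' ((d1 Complex.I).fun_div (d1 (-Complex.I)) n2)
    have hr := (hreg s).ratio_eq
    have h3 := this.log (by simp only [hr, Complex.ofReal_re]; exact (Real.exp_pos _).ne')
    refine h3.congr_deriv ?_
    have : (S.poleSum ϖ' Complex.I * S.sol (g s) (-Complex.I) -
        S.sol (g s) Complex.I * S.poleSum ϖ' (-Complex.I)) / S.sol (g s) (-Complex.I) ^ 2
        = ((4 * S.logDerivA (g s) * S.logDerivB (g s) : ℝ) : ℂ) *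
          (S.sol (g s) Complex.I / S.sol (g s) (-Complex.I)) := by
      rw [e1, e2]; push_cast; field_simp; ring
    rw [this, hr, Complex.re_ofReal_mul, Complex.ofReal_re, mul_div_assoc,
      div_self (Real.exp_pos _).ne', mul_one]
  · refine (HasDerivAt.re' (d1 0)).congr_deriv ?_
    rw [e3, show -2 * Complex.I * ((S.logDerivA (g s) : ℂ) - S.logDerivB (g s)) * S.sol (g s) 0
      = ((-2 * (S.logDerivA (g s) - S.logDerivB (g s)) : ℝ) : ℂ) * (Complex.I * S.sol (g s) 0) by
        push_cast; ring, Complex.re_ofReal_mul, Complex.I_mul_re]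
    ring
  · refine (HasDerivAt.im' (d1 0)).congr_deriv ?_
    rw [e3, show -2 * Complex.I * ((S.logDerivA (g s) : ℂ) - S.logDerivB (g s)) * S.sol (g s) 0
      = ((-2 * (S.logDerivA (g s) - S.logDerivB (g s)) : ℝ) : ℂ) * (Complex.I * S.sol (g s) 0) by
        push_cast; ring, Complex.im_ofReal_mul, Complex.I_mul_im]
    ring

/-! ### Smoothness -/

section Smooth

variable {E : Type*} [NormedAddCommGroup E] [NormedSpace ℝ E] {N : WithTop ℕ∞}
  {g : E → ι → ℂ} (hg : ∀ x, S.Symm (g x)) (hsm : ∀ a, ContDiff ℝ N fun x => g x a)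
include hg hsm

theorem contDiff_sol (z : ℂ) : ContDiff ℝ N fun x => S.sol (g x) z :=
  contDiff_const.add (ContDiff.sum fun a _ => (contDiff_resid hg hsm a).div_const _)

theorem contDiff_deriv_sol {z : ℂ} (hz : z ∉ range S.pt) :
    ContDiff ℝ N fun x => deriv (S.sol (g x)) z := by
  simp only [deriv_sol, deriv_poleSum _ hz]
  exact ContDiff.sum fun a _ => (contDiff_resid hg hsm a).mul contDiff_const

theorem contDiff_logDerivA (hreg : ∀ x, S.Regular (g x)) :
    ContDiff ℝ N fun x => S.logDerivA (g x) := by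
  simp only [logDerivA, div_eq_mul_inv]
  exact Complex.reCLM.contDiff.comp ((contDiff_deriv_sol hg hsm I_notMem).mul
    ((contDiff_sol hg hsm _).inv fun x => (hreg x).ne_zero))

theorem contDiff_logDerivB (hreg : ∀ x, S.Regular (g x)) :
    ContDiff ℝ N fun x => S.logDerivB (g x) := by
  simp only [logDerivB, div_eq_mul_inv]
  exact Complex.reCLM.contDiff.comp ((contDiff_deriv_sol hg hsm neg_I_notMem).mul
    ((contDiff_sol hg hsm _).inv fun x => (hreg x).ne_zero')).neg

theorem contDiff_shift (hreg : ∀ x, S.Regular (g x)) :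
    ContDiff ℝ N fun x => S.shift (g x) := by
  have h : ContDiff ℝ N fun x =>
      (S.sol (g x) Complex.I * (S.sol (g x) (-Complex.I))⁻¹).re :=
    Complex.reCLM.contDiff.comp ((contDiff_sol hg hsm _).mul
      ((contDiff_sol hg hsm _).inv fun x => (hreg x).ne_zero'))
  refine h.log fun x => ?_
  rw [← div_eq_mul_inv, (hreg x).ratio_eq, Complex.ofReal_re]
  exact (Real.exp_pos _).ne'

end Smooth

end PoleSystem

end

section

/-! ### From the flows in `y` and `t` to the mCH equation -/

/-- Real functions of `(y,t)` that satisfy the equations obeyed by the reconstruction data of a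
reflectionless solution. -/
structure FlowData (C s a b h : ℝ → ℝ → ℝ) : Prop where
  smooth_C : ContDiff ℝ ∞ fun p : ℝ × ℝ => C p.1 p.2
  smooth_s : ContDiff ℝ ∞ fun p : ℝ × ℝ => s p.1 p.2
  smooth_a : ContDiff ℝ ∞ fun p : ℝ × ℝ => a p.1 p.2
  smooth_b : ContDiff ℝ ∞ fun p : ℝ × ℝ => b p.1 p.2
  smooth_h : ContDiff ℝ ∞ fun p : ℝ × ℝ => h p.1 p.2
  C_pos : ∀ y t, 0 < C y t
  h_y : ∀ y t, HasDerivAt (fun y => h y t) (C y t - 1) y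
  h_t : ∀ y t, HasDerivAt (fun t => h y t) (4 * a y t * b y t) t
  a_y : ∀ y t, HasDerivAt (fun y => a y t) (-(C y t * a y t) - s y t / 2) y
  b_y : ∀ y t, HasDerivAt (fun y => b y t) (C y t * b y t + s y t / 2) y
  C_t : ∀ y t, HasDerivAt (fun t => C y t) (2 * (a y t - b y t) * s y t) t
  s_t : ∀ y t, HasDerivAt (fun t => s y t) (-(2 * (a y t - b y t) * C y t)) t
  a_top : ∀ t, Tendsto (fun y => a y t) atTop (𝓝 0)
  a_bot : ∀ t, Tendsto (fun y => a y t) atBot (𝓝 0)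
  b_top : ∀ t, Tendsto (fun y => b y t) atTop (𝓝 0)
  b_bot : ∀ t, Tendsto (fun y => b y t) atBot (𝓝 0)
  h_top : ∀ t, ∃ l, Tendsto (fun y => h y t) atTop (𝓝 l)
  h_bot : ∀ t, ∃ l, Tendsto (fun y => h y t) atBot (𝓝 l)

theorem hasDerivAt_comp_pair {F : ℝ × ℝ → ℝ} {y t : ℝ → ℝ} {τ p q y' t' : ℝ}
    (hF : DifferentiableAt ℝ F (y τ, t τ)) (hp : HasDerivAt (fun v => F (v, t τ)) p (y τ))
    (hq : HasDerivAt (fun v => F (y τ, v)) q (t τ)) (hy : HasDerivAt y y' τ)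
    (ht : HasDerivAt t t' τ) : HasDerivAt (fun τ => F (y τ, t τ)) (p * y' + q * t') τ := by
  have h0 := hF.hasFDerivAt
  have h1 := h0.comp_hasDerivAt τ (hy.prodMk ht)
  have e1 : fderiv ℝ F (y τ, t τ) (1, 0) = p :=
    (h0.comp_hasDerivAt (y τ) ((hasDerivAt_id (y τ)).prodMk (hasDerivAt_const _ (t τ)))).unique hp
  have e2 : fderiv ℝ F (y τ, t τ) (0, 1) = q :=
    (h0.comp_hasDerivAt (t τ) ((hasDerivAt_const _ (y τ)).prodMk (hasDerivAt_id (t τ)))).unique hq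
  refine h1.congr_deriv ?_
  rw [show ((y', t') : ℝ × ℝ) = y' • (1, 0) + t' • (0, 1) by simp, map_add, map_smul, map_smul,
    e1, e2]
  simp [mul_comm]

/-- The inverse of the map `(y,t) ↦ (X y t, t)` is smooth if `X` is smooth, bijective in `y`, and
has nonzero derivative in `y`. -/
theorem contDiff_inverse_fst {X Y : ℝ → ℝ → ℝ} {D : ℝ → ℝ → ℝ}
    (hX : ContDiff ℝ ∞ fun p : ℝ × ℝ => X p.1 p.2)
    (hD : ∀ y t, HasDerivAt (fun y => X y t) (D y t) y) (hD0 : ∀ y t, D y t ≠ 0)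
    (hXY : ∀ x t, X (Y x t) t = x) (hYX : ∀ y t, Y (X y t) t = y) :
    ContDiff ℝ ∞ fun p : ℝ × ℝ => Y p.1 p.2 := by
  set Φ : ℝ × ℝ → ℝ × ℝ := fun p => (X p.1 p.2, p.2) with hΦ
  have hΦs : ContDiff ℝ ∞ Φ := hX.prodMk contDiff_snd
  rw [contDiff_iff_contDiffAt]
  rintro ⟨x, t⟩
  set y := Y x t with hy
  set L : ℝ × ℝ →L[ℝ] ℝ := fderiv ℝ (fun p : ℝ × ℝ => X p.1 p.2) (y, t) with hL
  have hXd : HasFDerivAt (fun p : ℝ × ℝ => X p.1 p.2) L (y, t) :=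
    (hX.differentiable (by simp) (y, t)).hasFDerivAt
  have hL1 : L (1, 0) = D y t := by
    have h : HasDerivAt (fun y => X y t) (L (1, 0)) y :=
      hXd.comp_hasDerivAt y (f := fun y => ((y, t) : ℝ × ℝ))
        ((hasDerivAt_id y).prodMk (hasDerivAt_const _ t))
    exact h.unique (hD y t)
  have hLv : ∀ v w, L (v, w) = D y t * v + L (0, 1) * w := by
    intro v w
    rw [show ((v, w) : ℝ × ℝ) = v • (1, 0) + w • (0, 1) by simp, map_add, map_smul, map_smul, hL1]
    simp [mul_comm]
  have h0 := hD0 y t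
  -- The Jacobian of `(y,t) ↦ (X y t, t)` is triangular with diagonal `D y t` and `1`; its inverse
  -- is written out so that the inverse function theorem applies.
  let e : (ℝ × ℝ) ≃L[ℝ] (ℝ × ℝ) := ContinuousLinearEquiv.equivOfInverse
    (L.prod (ContinuousLinearMap.snd ℝ ℝ ℝ))
    (((D y t)⁻¹ • (ContinuousLinearMap.fst ℝ ℝ ℝ - L (0, 1) • ContinuousLinearMap.snd ℝ ℝ ℝ)).prod
      (ContinuousLinearMap.snd ℝ ℝ ℝ))
    (by
      rintro ⟨v, w⟩
      simp only [ContinuousLinearMap.prod_apply, smul_apply,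
        sub_apply, ContinuousLinearMap.coe_fst', ContinuousLinearMap.coe_snd',
        smul_eq_mul, hLv v w, Prod.mk.injEq, and_true]
      field_simp
      ring)
    (by
      rintro ⟨v, w⟩
      simp only [ContinuousLinearMap.prod_apply, smul_apply,
        sub_apply, ContinuousLinearMap.coe_fst', ContinuousLinearMap.coe_snd',
        smul_eq_mul, hLv _ w, Prod.mk.injEq, and_true]
      field_simp
      ring)
  have hΦd : HasFDerivAt Φ (e : ℝ × ℝ →L[ℝ] ℝ × ℝ) (y, t) :=
    hXd.prodMk hasFDerivAt_snd
  have hn : (∞ : WithTop ℕ∞) ≠ 0 := by simp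
  have hloc := (hΦs.contDiffAt (x := (y, t))).to_localInverse hΦd hn
  have hst := (hΦs.contDiffAt (x := (y, t))).hasStrictFDerivAt' hΦd hn
  have hΦy : Φ (y, t) = (x, t) := by simp [hΦ, hy, hXY]
  have hev := hst.eventually_right_inverse
  rw [hΦy] at hev
  have hloc' := contDiff_fst.contDiffAt.comp (Φ (y, t)) hloc
  rw [hΦy] at hloc'
  refine hloc'.congr_of_eventuallyEq ?_
  filter_upwards [hev] with p hp
  change Y p.1 p.2 = (hst.localInverse Φ e (y, t) p).1
  -- Any local right inverse of `Φ` agrees with the global inverse, by `hYX`.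
  generalize hst.localInverse Φ e (y, t) p = q at hp
  rw [← hp]
  exact hYX q.1 q.2

namespace FlowData

variable {C s a b h : ℝ → ℝ → ℝ} (H : FlowData C s a b h)
include H

theorem hasDerivAt_X (y t : ℝ) : HasDerivAt (fun y => y + h y t) (C y t) y :=
  ((hasDerivAt_id y).add (H.h_y y t)).congr_deriv (by ring)

theorem strictMono_X (t : ℝ) : StrictMono fun y => y + h y t :=
  strictMono_of_deriv_pos fun y => by rw [(H.hasDerivAt_X y t).deriv]; exact H.C_pos y t

theorem surjective_X (t : ℝ) : Function.Surjective fun y => y + h y t := by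
  refine Continuous.surjective ?_ ?_ ?_
  · exact continuous_iff_continuousAt.2 fun y => (H.hasDerivAt_X y t).continuousAt
  · obtain ⟨l, hl⟩ := H.h_top t
    exact tendsto_id.atTop_add hl
  · obtain ⟨l, hl⟩ := H.h_bot t
    exact tendsto_id.atBot_add hl

/-- The change of variables is bijective. -/
theorem bijective_X (t : ℝ) : Function.Bijective fun y => y + h y t :=
  ⟨(H.strictMono_X t).injective, H.surjective_X t⟩

/-- The function recovered from the data solves the mCH equation. -/
theorem isMCHSolution {u : ℝ → ℝ → ℝ} (hu : ∀ y t, u (y + h y t) t = -(a y t + b y t)) :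
    IsMCHSolution u := by
  let e : ∀ t, ℝ ≃o ℝ := fun t => (H.strictMono_X t).orderIsoOfSurjective _ (H.surjective_X t)
  set Y : ℝ → ℝ → ℝ := fun x t => (e t).symm x with hY
  have hXY : ∀ x t, Y x t + h (Y x t) t = x := fun x t => (e t).apply_symm_apply x
  have hYX : ∀ y t, Y (y + h y t) t = y := fun y t => (e t).symm_apply_apply y
  have hYs : ContDiff ℝ ∞ fun p : ℝ × ℝ => Y p.1 p.2 :=
    contDiff_inverse_fst (X := fun y t => y + h y t) (contDiff_fst.add H.smooth_h)
      H.hasDerivAt_X (fun y t => (H.C_pos y t).ne') hXY hYX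
  have hYs2 : ContDiff ℝ ∞ fun p : ℝ × ℝ => (Y p.1 p.2, p.2) := hYs.prodMk contDiff_snd
  have hue : ∀ x t, u x t = -(a (Y x t) t + b (Y x t) t) := fun x t => by
    have := hu (Y x t) t
    rwa [hXY] at this
  have dif : ∀ {f : ℝ → ℝ → ℝ}, (ContDiff ℝ ∞ fun p : ℝ × ℝ => f p.1 p.2) → ∀ q,
      DifferentiableAt ℝ (fun p : ℝ × ℝ => f p.1 p.2) q := fun hf q =>
    hf.differentiable (by simp) q
  have hYx : ∀ x t, HasDerivAt (fun x => Y x t) (1 / C (Y x t) t) x := by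
    intro x t
    have h1 : HasDerivAt (fun x => Y x t) (deriv (fun x => Y x t) x) x := by
      have : DifferentiableAt ℝ (fun x => Y x t) x :=
        (dif hYs (x, t)).comp x (f := fun x => ((x, t) : ℝ × ℝ))
          (differentiableAt_id.prodMk (differentiableAt_const t))
      exact this.hasDerivAt
    have h2 := HasDerivAt.comp x (H.hasDerivAt_X (Y x t) t) h1
    have h3 : HasDerivAt (fun x : ℝ => x) (C (Y x t) t * deriv (fun x => Y x t) x) x :=
      h2.congr_of_eventuallyEq (Eventually.of_forall fun x => (hXY x t).symm)
    have h4 := h3.unique (hasDerivAt_id x)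
    refine h1.congr_deriv ?_
    rw [eq_div_iff (H.C_pos _ _).ne', mul_comm]
    exact h4
  have hYt : ∀ x t, HasDerivAt (fun t => Y x t)
      (-(4 * a (Y x t) t * b (Y x t) t) / C (Y x t) t) t := by
    intro x t
    have h1 : HasDerivAt (fun t => Y x t) (deriv (fun t => Y x t) t) t := by
      have : DifferentiableAt ℝ (fun t => Y x t) t :=
        (dif hYs (x, t)).comp t (f := fun t => ((x, t) : ℝ × ℝ))
          ((differentiableAt_const x).prodMk differentiableAt_id)
      exact this.hasDerivAt
    have h2 := hasDerivAt_comp_pair (F := fun p : ℝ × ℝ => p.1 + h p.1 p.2)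
      (y := fun t => Y x t) (t := fun t => t)
      (differentiableAt_fst.add (dif H.smooth_h _)) (H.hasDerivAt_X (Y x t) t)
      ((H.h_t (Y x t) t).const_add (Y x t)) h1 (hasDerivAt_id t)
    have h3 : HasDerivAt (fun _ : ℝ => x) _ t :=
      h2.congr_of_eventuallyEq (Eventually.of_forall fun t => (hXY x t).symm)
    have h4 := h3.unique (hasDerivAt_const t x)
    refine h1.congr_deriv ?_
    rw [eq_div_iff (H.C_pos _ _).ne']
    linarith
  have comp_x : ∀ {f : ℝ → ℝ → ℝ} {p x t : ℝ}, HasDerivAt (fun y => f y t) p (Y x t) →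
      HasDerivAt (fun x => f (Y x t) t) (p / C (Y x t) t) x := fun {f p x t} hf =>
    (HasDerivAt.comp x (h₂ := fun y => f y t) hf (hYx x t)).congr_deriv (by rw [mul_one_div])
  -- In `a + b` the terms `∓ s/2` cancel, and in `a - b` they add up; hence `u_x = a - b` and `u -
  -- u_xx = s/C`.
  have hux : ∀ x t, HasDerivAt (fun x => u x t) (a (Y x t) t - b (Y x t) t) x := by
    intro x t
    simp only [hue]
    have hC := (H.C_pos (Y x t) t).ne'
    refine (comp_x (f := fun y t => -(a y t + b y t))
      ((H.a_y (Y x t) t).add (H.b_y (Y x t) t)).neg).congr_deriv ?_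
    field_simp
    ring
  have huxd : ∀ t x, deriv (fun η => u η t) x = a (Y x t) t - b (Y x t) t := fun t x =>
    (hux x t).deriv
  have huxx : ∀ x t, HasDerivAt (fun x => a (Y x t) t - b (Y x t) t)
      (u x t - s (Y x t) t / C (Y x t) t) x := by
    intro x t
    have hC := (H.C_pos (Y x t) t).ne'
    refine (comp_x (f := fun y t => a y t - b y t)
      ((H.a_y (Y x t) t).sub (H.b_y (Y x t) t))).congr_deriv ?_
    rw [hue]
    field_simp
    ring
  have hmom : ∀ x t, momentum u x t = s (Y x t) t / C (Y x t) t := by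
    intro x t
    simp only [momentum, huxd, (huxx x t).deriv]
    ring
  have hms : ContDiff ℝ ∞ fun p : ℝ × ℝ => s p.1 p.2 / C p.1 p.2 :=
    H.smooth_s.div H.smooth_C fun p => (H.C_pos _ _).ne'
  refine ⟨?_, ?_, ?_, ?_⟩
  · simp only [hue]
    exact ((H.smooth_a.comp hYs2).add (H.smooth_b.comp hYs2)).neg
  · intro x t
    have hC := (H.C_pos (Y x t) t).ne'
    have hmy : HasDerivAt (fun y => s y t / C y t) (deriv (fun y => s y t / C y t) (Y x t))
        (Y x t) := by
      have : DifferentiableAt ℝ (fun y => s y t / C y t) (Y x t) :=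
        (dif (f := fun y t => s y t / C y t) hms (Y x t, t)).comp (Y x t)
          (f := fun y => ((y, t) : ℝ × ℝ)) (differentiableAt_id.prodMk (differentiableAt_const t))
      exact this.hasDerivAt
    have hmt := (H.s_t (Y x t) t).div (H.C_t (Y x t) t) hC
    have d1 := hasDerivAt_comp_pair (F := fun p : ℝ × ℝ => s p.1 p.2 / C p.1 p.2)
      (y := fun t => Y x t) (t := fun t => t) (dif (f := fun y t => s y t / C y t) hms _) hmy hmt
      (hYt x t) (hasDerivAt_id t)
    have d2 := (comp_x (f := fun y t => s y t / C y t) hmy).fun_mul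
      (((hux x t).fun_pow 2).fun_sub ((huxx x t).fun_pow 2))
    have e1 : (fun τ => momentum u x τ) = fun τ => s (Y x τ) τ / C (Y x τ) τ := funext (hmom x)
    have e2 : (fun ξ => momentum u ξ t * (u ξ t ^ 2 - deriv (fun η => u η t) ξ ^ 2)) = fun ξ =>
        s (Y ξ t) t / C (Y ξ t) t * (u ξ t ^ 2 - (a (Y ξ t) t - b (Y ξ t) t) ^ 2) := by
      funext ξ
      rw [hmom, huxd]
    -- The unknown `y`-derivative `m'` of `s/C` cancels because the shift moves with speed `4ab = u²
    -- - u_x²`: `y` is a Lagrangian coordinate. What remains is algebra in `a`, `b`, `s`, `C`.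
    rw [e1, e2, d1.deriv, d2.deriv, huxd, hue]
    generalize deriv (fun y => s y t / C y t) (Y x t) = m'
    field_simp
    ring
  · intro t
    simp only [hue]
    have hYt' : Tendsto (fun x => Y x t) atTop atTop := (e t).symm.tendsto_atTop
    simpa using (((H.a_top t).add (H.b_top t)).comp hYt').neg
  · intro t
    simp only [hue]
    have hYt' : Tendsto (fun x => Y x t) atBot atBot := (e t).symm.tendsto_atBot
    simpa using (((H.a_bot t).add (H.b_bot t)).comp hYt').neg

end FlowData

end

section

/-! ### Spatial asymptotics -/

namespace PoleSystem

variable {ι : Type*} [Fintype ι] [DecidableEq ι] {S : PoleSystem ι}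

/-- If the solutions for `γ` and `-γ` have the same limit, then the reconstruction data approach
those of the zero background. -/
theorem tendsto_data {α : Type*} {l : Filter α} [l.NeBot] {g : α → ι → ℂ} {ϖ : ι → ℂ}
    (hg : ∀ s, S.Symm (g s)) (hgi : ∀ s, S.InvSymm (g s)) (hreg : ∀ s, S.Regular (g s))
    (h1 : ∀ a, Tendsto (fun s => S.resid 1 (g s) a) l (𝓝 (ϖ a)))
    (h2 : ∀ a, Tendsto (fun s => S.resid 1 (-g s) a) l (𝓝 (ϖ a))) :
    Tendsto (fun s => S.logDerivA (g s)) l (𝓝 0) ∧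
    Tendsto (fun s => S.logDerivB (g s)) l (𝓝 0) ∧
    ∃ L, Tendsto (fun s => S.shift (g s)) l (𝓝 L) := by
  set P : ℂ → ℂ := fun z => 1 + S.poleSum ϖ z with hP
  have p1 : ∀ z, Tendsto (fun s => S.sol (g s) z) l (𝓝 (P z)) := fun z =>
    (tendsto_finsetSum _ fun a _ => (h1 a).div_const _).const_add 1
  have p2 : ∀ z, Tendsto (fun s => S.sol (-g s) z) l (𝓝 (P z)) := fun z =>
    (tendsto_finsetSum _ fun a _ => (h2 a).div_const _).const_add 1
  -- The common limit for `γ` and `-γ` makes `P 0` real by `conj_sol`; it has modulus one, and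
  -- `Regular.re_pos` excludes `-1`.
  have hP0 : P 0 = 1 := by
    have hc : conj (P 0) = P 0 := by
      refine tendsto_nhds_unique ?_ (p2 0)
      refine ((Complex.continuous_conj.tendsto _).comp (p1 0)).congr fun s => ?_
      have := conj_sol (hg s) 0
      simpa using this
    have hn : ‖P 0‖ = 1 := tendsto_nhds_unique (p1 0).norm
      (tendsto_const_nhds.congr fun s => ((hreg s).norm_sol_zero (hg s) (hgi s)).symm)
    have hre : 0 ≤ (P 0).re := ge_of_tendsto ((Complex.continuous_re.tendsto _).comp (p1 0))
      (Eventually.of_forall fun s => (hreg s).re_pos.le)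
    rw [Complex.conj_eq_iff_re] at hc
    rw [← hc, Complex.norm_real, Real.norm_eq_abs, abs_of_nonneg hre] at hn
    rw [← hc, hn, Complex.ofReal_one]
  have hprod : P Complex.I * P (-Complex.I) = 1 := by
    rw [← hP0]
    exact tendsto_nhds_unique ((p1 Complex.I).mul (p1 (-Complex.I)))
      ((p1 0).congr fun s => ((hreg s).prod).symm)
  have n1 : P Complex.I ≠ 0 := left_ne_zero_of_mul_eq_one hprod
  have n2 : P (-Complex.I) ≠ 0 := right_ne_zero_of_mul_eq_one hprod
  have hinv : ∀ z, z ≠ 0 → z ∉ range S.pt → P (-1 / z) = P z := fun z hz hzp => by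
    have : P (-1 / z) = P 0 * P z := tendsto_nhds_unique (p1 (-1 / z))
      (((p1 0).mul (p2 z)).congr fun s => (sol_inv (hg s) (hgi s) hz hzp).symm)
    rw [this, hP0, one_mul]
  -- The limit is invariant under `z ↦ -1/z`, whose derivative at `σ` is `-1`; so `P'(σ) = -P'(σ)`.
  have hder : ∀ σ : ℂ, σ ^ 2 = -1 → σ ∉ range S.pt → deriv (S.poleSum ϖ) σ = 0 := by
    intro σ hσ hσp
    have d : HasDerivAt P (deriv (S.poleSum ϖ) σ) σ :=
      (differentiableAt_poleSum ϖ hσp).hasDerivAt.const_add 1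
    have e := (hasDerivAt_comp_neg_one_div hσ d).unique (d.congr_of_eventuallyEq
      ((eventually_ne_zero_and_notMem (ne_zero_of_sq_eq_neg_one hσ) hσp).mono
        fun z hz => hinv z hz.1 hz.2))
    linear_combination -e / 2
  have q1 : ∀ σ : ℂ, σ ^ 2 = -1 → σ ∉ range S.pt →
      Tendsto (fun s => deriv (S.sol (g s)) σ) l (𝓝 0) := by
    intro σ hσ hσp
    rw [← hder σ hσ hσp]
    simp only [deriv_sol, deriv_poleSum _ hσp]
    exact tendsto_finsetSum _ fun a _ => (h1 a).mul_const _
  refine ⟨?_, ?_, (P Complex.I / P (-Complex.I)).re.log, ?_⟩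
  · have := (Complex.continuous_re.tendsto _).comp
      ((q1 Complex.I Complex.I_sq I_notMem).div (p1 Complex.I) n1)
    simpa using! this
  · have := (Complex.continuous_re.tendsto _).comp
      ((q1 (-Complex.I) (by simp) neg_I_notMem).div (p1 (-Complex.I)) n2).neg
    simpa using! this
  · have hq := (p1 Complex.I).div (p1 (-Complex.I)) n2
    have him : (P Complex.I / P (-Complex.I)).im = 0 := by
      refine tendsto_nhds_unique ((Complex.continuous_im.tendsto _).comp hq)
        (tendsto_const_nhds.congr fun s => ?_)
      simp [(hreg s).ratio_eq, -Complex.ofReal_exp]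
    refine ((Complex.continuous_re.tendsto _).comp hq).log fun h0 => ?_
    exact div_ne_zero n1 n2 (Complex.ext h0 him)

/-- The limit coupling is `0`, which equals its own negative. -/
theorem tendsto_resid_of_tendsto_zero {α : Type*} {l : Filter α} {g : α → ι → ℂ}
    (h : ∀ a, Tendsto (fun s => g s a) l (𝓝 0)) :
    ∃ ϖ : ι → ℂ, (∀ a, Tendsto (fun s => S.resid 1 (g s) a) l (𝓝 (ϖ a))) ∧
      ∀ a, Tendsto (fun s => S.resid 1 (-g s) a) l (𝓝 (ϖ a)) := by
  have k := fun (g : α → ι → ℂ) => tendsto_resid (S := S) (l := l) (δ := fun _ => 1) (γ := g)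
    (δ₀ := 1) (γ₀ := 0) (fun a => by simp) (fun a => by simp) (fun a => by simp)
    (fun a => tendsto_const_nhds)
  exact ⟨S.resid 1 0, k g h, k (fun s => -g s) fun a => by simpa using (h a).neg⟩

-- Scaling by the inverse couplings sends `(1, γ)` to `(0, 1)` in the limit, so the residue
-- condition becomes a zero of the solution at `-p`. Points of `Z` carry no coupling and keep `(1,
-- 0)`. In each case one of the two coefficients is `0`, so the sign of `γ` no longer matters.
open Classical in
theorem tendsto_resid_of_tendsto_infinity {α : Type*} {l : Filter α} {g : α → ι → ℂ} {Z : Set ι}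
    (hg : ∀ s, S.Symm (g s)) (hrefl : ∀ a, S.refl a ∈ Z ↔ a ∈ Z) (hz : ∀ s, ∀ a ∈ Z, g s a = 0)
    (hnz : ∀ s, ∀ a ∉ Z, g s a ≠ 0)
    (h : ∀ a ∉ Z, Tendsto (fun s => (g s a)⁻¹) l (𝓝 0)) :
    ∃ ϖ : ι → ℂ, (∀ a, Tendsto (fun s => S.resid 1 (g s) a) l (𝓝 (ϖ a))) ∧
      ∀ a, Tendsto (fun s => S.resid 1 (-g s) a) l (𝓝 (ϖ a)) := by
  let ε : α → ι → ℂ := fun s a => if a ∈ Z then 1 else (g s a)⁻¹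
  let δ₀ : ι → ℂ := fun a => if a ∈ Z then 1 else 0
  let γ₀ : ι → ℂ := fun a => if a ∈ Z then 0 else 1
  have hε : ∀ s, S.Symm (ε s) := fun s a => by
    simp only [ε, hrefl, hg s a]
    split_ifs <;> simp
  have hε0 : ∀ s a, ε s a ≠ 0 := fun s a => by
    by_cases ha : a ∈ Z
    · simp [ε, ha]
    · simpa [ε, ha] using hnz s a ha
  have hεδ : ∀ a, Tendsto (fun s => (ε s * 1) a) l (𝓝 (δ₀ a)) := fun a => by
    by_cases ha : a ∈ Z
    · simpa [ε, δ₀, ha] using tendsto_const_nhds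
    · simpa [ε, δ₀, ha] using h a ha
  have hεγ : ∀ s, ε s * g s = γ₀ := fun s => by
    funext a
    by_cases ha : a ∈ Z
    · simp [ε, γ₀, ha, hz s a ha]
    · simp [ε, γ₀, ha, hnz s a ha]
  have hδ₀ : S.Symm δ₀ := fun a => by
    simp only [δ₀, hrefl]
    split_ifs <;> simp
  have hγ₀ : S.Symm γ₀ := fun a => by
    simp only [γ₀, hrefl]
    split_ifs <;> simp
  have hne : ∀ a, δ₀ a ≠ 0 ∨ γ₀ a ≠ 0 := fun a => by
    by_cases ha : a ∈ Z <;> simp [δ₀, γ₀, ha]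
  refine ⟨S.resid δ₀ γ₀, fun a => ?_, fun a => ?_⟩
  · have := tendsto_resid (S := S) (γ := fun _ => γ₀) hne hδ₀ hγ₀ hεδ
      (fun a => tendsto_const_nhds) a
    refine this.congr fun s => ?_
    rw [← hεγ s, resid_smul (by simp) (fun a => by simp) (hg s) (hε s) (hε0 s)]
  · have h0 : S.resid δ₀ (-γ₀) = S.resid δ₀ γ₀ := resid_neg_of_mul_eq_zero hne hδ₀ hγ₀ fun a => by
      by_cases ha : a ∈ Z <;> simp [δ₀, γ₀, ha]
    have hg' : ∀ s, S.Symm (-g s) := fun s a => by simp [hg s a]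
    have := tendsto_resid (S := S) (γ := fun _ => -γ₀) (γ₀ := -γ₀) (by simpa using hne) hδ₀
      (fun a => by simp [hγ₀ a]) hεδ (fun a => tendsto_const_nhds) a
    rw [h0] at this
    refine this.congr fun s => ?_
    rw [← hεγ s, ← mul_neg, resid_smul (by simp) (fun a => by simp) (hg' s) (hε s) (hε0 s)]

/-- The reconstruction data of a family of scalar problems that evolves in `y` and `t`. -/
theorem flowData {g : ℝ → ℝ → ι → ℂ} (sy : ∀ y t, S.Symm (g y t)) (iv : ∀ y t, S.InvSymm (g y t))
    (hreg : ∀ y t, S.Regular (g y t)) (sm : ∀ a, ContDiff ℝ ∞ fun p : ℝ × ℝ => g p.1 p.2 a)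
    (hy : ∀ y t a, HasDerivAt (fun y => g y t a) (kFun (S.pt a) * g y t a) y)
    (ht : ∀ y t a, HasDerivAt (fun t => g y t a)
      (-2 * (kFun (S.pt a) * (lamFun (S.pt a) ^ 2)⁻¹) * g y t a) t)
    (htop : ∀ t, ∃ ϖ : ι → ℂ,
      (∀ a, Tendsto (fun y => S.resid 1 (g y t) a) atTop (𝓝 (ϖ a))) ∧
      ∀ a, Tendsto (fun y => S.resid 1 (-g y t) a) atTop (𝓝 (ϖ a)))
    (hbot : ∀ t, ∃ ϖ : ι → ℂ,
      (∀ a, Tendsto (fun y => S.resid 1 (g y t) a) atBot (𝓝 (ϖ a))) ∧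
      ∀ a, Tendsto (fun y => S.resid 1 (-g y t) a) atBot (𝓝 (ϖ a))) :
    FlowData (fun y t => (S.sol (g y t) 0).re) (fun y t => (S.sol (g y t) 0).im)
      (fun y t => S.logDerivA (g y t)) (fun y t => S.logDerivB (g y t))
      (fun y t => S.shift (g y t)) := by
  have smy : ∀ t a, ContDiff ℝ 1 fun y : ℝ => g y t a := fun t a =>
    ((sm a).of_le (by simp)).comp (contDiff_id.prodMk (contDiff_const (c := t)))
  have smt : ∀ y a, ContDiff ℝ 1 fun t : ℝ => g y t a := fun y a =>
    ((sm a).of_le (by simp)).comp ((contDiff_const (c := y)).prodMk contDiff_id)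
  have dy := fun y t => Regular.hasDerivAt_y (s := y) (fun y => sy y t)
    (fun y => iv y t) (fun y => hreg y t) (smy t) (hy y t)
  have dt := fun y t => Regular.hasDerivAt_t (s := t) (sy y) (iv y) (hreg y) (smt y) (ht y t)
  have top : ∀ t, Tendsto (fun y => S.logDerivA (g y t)) atTop (𝓝 0) ∧
      Tendsto (fun y => S.logDerivB (g y t)) atTop (𝓝 0) ∧
      ∃ L, Tendsto (fun y => S.shift (g y t)) atTop (𝓝 L) := fun t =>
    tendsto_data (fun y => sy y t) (fun y => iv y t) (fun y => hreg y t)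
    (htop t).choose_spec.1 (htop t).choose_spec.2
  have bot : ∀ t, Tendsto (fun y => S.logDerivA (g y t)) atBot (𝓝 0) ∧
      Tendsto (fun y => S.logDerivB (g y t)) atBot (𝓝 0) ∧
      ∃ L, Tendsto (fun y => S.shift (g y t)) atBot (𝓝 L) := fun t =>
    tendsto_data (fun y => sy y t) (fun y => iv y t) (fun y => hreg y t)
    (hbot t).choose_spec.1 (hbot t).choose_spec.2
  have sol0 : ContDiff ℝ ∞ fun p : ℝ × ℝ => S.sol (g p.1 p.2) 0 :=
    contDiff_sol (g := fun p : ℝ × ℝ => g p.1 p.2) (fun p => sy p.1 p.2) sm 0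
  exact {
    smooth_C := Complex.reCLM.contDiff.comp sol0
    smooth_s := Complex.imCLM.contDiff.comp sol0
    smooth_a := contDiff_logDerivA (g := fun p : ℝ × ℝ => g p.1 p.2) (fun p => sy p.1 p.2) sm
      fun p => hreg p.1 p.2
    smooth_b := contDiff_logDerivB (g := fun p : ℝ × ℝ => g p.1 p.2) (fun p => sy p.1 p.2) sm
      fun p => hreg p.1 p.2
    smooth_h := contDiff_shift (g := fun p : ℝ × ℝ => g p.1 p.2) (fun p => sy p.1 p.2) sm
      fun p => hreg p.1 p.2
    C_pos := fun y t => (hreg y t).re_pos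
    h_y := fun y t => (dy y t).1
    h_t := fun y t => (dt y t).1
    a_y := fun y t => (dy y t).2.1
    b_y := fun y t => (dy y t).2.2
    C_t := fun y t => (dt y t).2.1
    s_t := fun y t => (dt y t).2.2
    a_top := fun t => (top t).1
    a_bot := fun t => (bot t).1
    b_top := fun t => (top t).2.1
    b_bot := fun t => (bot t).2.1
    h_top := fun t => (top t).2.2
    h_bot := fun t => (bot t).2.2 }

end PoleSystem

/-! ### The reconstruction data of the soliton problem -/

/-- This sign makes the couplings decay as `y → +∞` and grow as `y → -∞`. -/
theorem re_kFun_neg {z : ℂ} (hz : 0 < z.im) : (kFun z).re < 0 := by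
  have h0 : z ≠ 0 := fun h => by simp [h] at hz
  have h1 : (kFun z).re = -(z.im + z.im / Complex.normSq z) / 2 := by
    simp [kFun, Complex.mul_re, Complex.inv_im, Complex.inv_re]
    ring
  have h2 : 0 < z.im / Complex.normSq z := div_pos hz (Complex.normSq_pos.2 h0)
  rw [h1]
  linarith

variable {n : ℕ} {ζ : Fin n → ℂ} {hinj : Function.Injective ζ} {hζ : ∀ j, ζ j ∈ regionD}

theorem coupling_eq (ζ c : Fin n → ℂ) (y t : ℝ) (a : Fin n × Fin 4) :
    coupling ζ c y t a = upperConst (c a.1) (ζ a.1) a.2 *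
      Complex.exp (kFun (upperPole (ζ a.1) a.2) *
        (y - 2 * (lamFun (upperPole (ζ a.1) a.2) ^ 2)⁻¹ * t)) := by
  rw [coupling, theta]
  congr 2
  linear_combination (-kFun (upperPole (ζ a.1) a.2) *
        (y - 2 * (lamFun (upperPole (ζ a.1) a.2) ^ 2)⁻¹ * t)) * Complex.I_sq

theorem contDiff_coupling (ζ c : Fin n → ℂ) (a : Fin n × Fin 4) {N : WithTop ℕ∞} :
    ContDiff ℝ N fun p : ℝ × ℝ => coupling ζ c p.1 p.2 a := by
  simp only [coupling_eq]
  have h1 : ContDiff ℝ N fun p : ℝ × ℝ => (p.1 : ℂ) := Complex.ofRealCLM.contDiff.comp contDiff_fst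
  have h2 : ContDiff ℝ N fun p : ℝ × ℝ => (p.2 : ℂ) := Complex.ofRealCLM.contDiff.comp contDiff_snd
  exact contDiff_const.mul (contDiff_const.mul (h1.sub (contDiff_const.mul h2))).cexp

theorem hasDerivAt_coupling_y (c : Fin n → ℂ) (y t : ℝ) (a : Fin n × Fin 4) :
    HasDerivAt (fun y => coupling ζ c y t a)
      (kFun ((poleSystem ζ hinj hζ).pt a) * coupling ζ c y t a) y := by
  simp only [coupling_eq]
  have := ((((hasDerivAt_id (y : ℂ)).sub_const
    (2 * (lamFun (upperPole (ζ a.1) a.2) ^ 2)⁻¹ * t)).const_mul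
      (kFun (upperPole (ζ a.1) a.2))).cexp.const_mul (upperConst (c a.1) (ζ a.1) a.2)).comp_ofReal
  refine this.congr_deriv ?_
  simp only [poleSystem, id]
  ring

theorem hasDerivAt_coupling_t (c : Fin n → ℂ) (y t : ℝ) (a : Fin n × Fin 4) :
    HasDerivAt (fun t => coupling ζ c y t a)
      (-2 * (kFun ((poleSystem ζ hinj hζ).pt a) * (lamFun ((poleSystem ζ hinj hζ).pt a) ^ 2)⁻¹)
        * coupling ζ c y t a) t := by
  simp only [coupling_eq]
  have := (((((hasDerivAt_id (t : ℂ)).const_mul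
    (2 * (lamFun (upperPole (ζ a.1) a.2) ^ 2)⁻¹)).const_sub (y : ℂ)).const_mul
      (kFun (upperPole (ζ a.1) a.2))).cexp.const_mul (upperConst (c a.1) (ζ a.1) a.2)).comp_ofReal
  refine this.congr_deriv ?_
  simp only [poleSystem, id]
  ring

theorem norm_coupling (ζ c : Fin n → ℂ) (t : ℝ) (a : Fin n × Fin 4) :
    ∃ K : ℝ, ∀ y : ℝ, ‖coupling ζ c y t a‖ = ‖upperConst (c a.1) (ζ a.1) a.2‖ *
      Real.exp ((kFun (upperPole (ζ a.1) a.2)).re * y + K) := by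
  refine ⟨(kFun (upperPole (ζ a.1) a.2) *
    (-(2 * (lamFun (upperPole (ζ a.1) a.2) ^ 2)⁻¹ * t))).re, fun y => ?_⟩
  rw [coupling_eq, norm_mul, Complex.norm_exp, sub_eq_add_neg, mul_add, Complex.add_re,
    Complex.re_mul_ofReal]

theorem tendsto_coupling_atTop (hζ : ∀ j, ζ j ∈ regionD) (c : Fin n → ℂ) (t : ℝ)
    (a : Fin n × Fin 4) : Tendsto (fun y => coupling ζ c y t a) atTop (𝓝 0) := by
  obtain ⟨K, hK⟩ := norm_coupling ζ c t a
  rw [tendsto_zero_iff_norm_tendsto_zero]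
  simp only [hK]
  have h1 := re_kFun_neg (upperPole_im_pos (hζ a.1) a.2)
  have h2 : Tendsto (fun y : ℝ => (kFun (upperPole (ζ a.1) a.2)).re * y + K) atTop atBot :=
    tendsto_atBot_add_const_right _ _ (tendsto_id.const_mul_atTop_of_neg h1)
  simpa using (Real.tendsto_exp_atBot.comp h2).const_mul ‖upperConst (c a.1) (ζ a.1) a.2‖

theorem tendsto_inv_coupling_atBot (hζ : ∀ j, ζ j ∈ regionD) (c : Fin n → ℂ) (t : ℝ)
    {a : Fin n × Fin 4} (ha : upperConst (c a.1) (ζ a.1) a.2 ≠ 0) :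
    Tendsto (fun y => (coupling ζ c y t a)⁻¹) atBot (𝓝 0) := by
  obtain ⟨K, hK⟩ := norm_coupling ζ c t a
  rw [tendsto_zero_iff_norm_tendsto_zero]
  simp only [norm_inv, hK]
  have h1 := re_kFun_neg (upperPole_im_pos (hζ a.1) a.2)
  have h2 : Tendsto (fun y : ℝ => (kFun (upperPole (ζ a.1) a.2)).re * y + K) atBot atTop :=
    tendsto_atTop_add_const_right _ _ (tendsto_id.const_mul_atBot_of_neg h1)
  exact tendsto_inv_atTop_zero.comp
    ((Real.tendsto_exp_atTop.comp h2).const_mul_atTop (norm_pos_iff.2 ha))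

variable (hinj hζ) in
/-- The reconstruction data of the soliton problem. -/
theorem flowData_coupling {c : Fin n → ℂ}
    (hreg : ∀ y t, (poleSystem ζ hinj hζ).Regular (coupling ζ c y t)) :
    FlowData (fun y t => ((poleSystem ζ hinj hζ).sol (coupling ζ c y t) 0).re)
      (fun y t => ((poleSystem ζ hinj hζ).sol (coupling ζ c y t) 0).im)
      (fun y t => (poleSystem ζ hinj hζ).logDerivA (coupling ζ c y t))
      (fun y t => (poleSystem ζ hinj hζ).logDerivB (coupling ζ c y t))
      (fun y t => (poleSystem ζ hinj hζ).shift (coupling ζ c y t)) := by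
  -- A norming constant may vanish. The set of uncoupled points is the same for all `(y,t)`, so it
  -- can be read off at `(0,0)`.
  have hzero : ∀ y t a, coupling ζ c y t a = 0 ↔ upperConst (c a.1) (ζ a.1) a.2 = 0 :=
    fun y t a => by rw [coupling, mul_eq_zero_iff_right (Complex.exp_ne_zero _)]
  have hrefl : ∀ a, (poleSystem ζ hinj hζ).refl a ∈ {a | coupling ζ c 0 0 a = 0} ↔
      a ∈ {a | coupling ζ c 0 0 a = 0} := fun a => by
    simp only [mem_ofPred_eq]
    rw [symm_coupling c 0 0 a, map_eq_zero]
  have hz : ∀ y t a, coupling ζ c y t a = 0 ↔ coupling ζ c 0 0 a = 0 := fun y t a => by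
    rw [hzero, hzero]
  exact PoleSystem.flowData (symm_coupling c) (invSymm_coupling c) hreg (contDiff_coupling ζ c ·)
    (hasDerivAt_coupling_y c) (hasDerivAt_coupling_t c)
    (fun t => PoleSystem.tendsto_resid_of_tendsto_zero (tendsto_coupling_atTop hζ c t))
    (fun t => PoleSystem.tendsto_resid_of_tendsto_infinity (fun y => symm_coupling c y t) hrefl
      (fun y a ha => (hz y t a).2 ha) (fun y a ha h => ha ((hz y t a).1 h))
      (fun a ha => tendsto_inv_coupling_atBot hζ c t fun h => ha ((hzero 0 0 a).2 h)))

-- Near `i` the column sums are `P(z)` and `P(-z)`. Their ratio at `i` is `e^{-h}`, so the logarithm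
-- recovers the shift, and the limit formula is minus the logarithmic derivative of `P(z) P(-z)`.
-- This turns recovery into a pointwise formula, from which existence and uniqueness of `u` are
-- immediate.
variable (hinj hζ) in
theorem recovers_iff {c : Fin n → ℂ} {M : ℝ → ℝ → ℂ → Mat} {u : ℝ → ℝ → ℝ}
    (hreg : ∀ y t, (poleSystem ζ hinj hζ).Regular (coupling ζ c y t))
    (hM : ∀ y t, ∀ᶠ z in 𝓝 Complex.I,
      colSum1 (M y t) z = (poleSystem ζ hinj hζ).sol (coupling ζ c y t) z ∧
      colSum2 (M y t) z = (poleSystem ζ hinj hζ).sol (coupling ζ c y t) (-z)) :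
    Recovers M u ↔ ∀ y t, u (y + (poleSystem ζ hinj hζ).shift (coupling ζ c y t)) t =
      -((poleSystem ζ hinj hζ).logDerivA (coupling ζ c y t)
        + (poleSystem ζ hinj hζ).logDerivB (coupling ζ c y t)) := by
  set S := poleSystem ζ hinj hζ with hS
  have hlog : ∀ y t : ℝ, (y : ℂ) - Complex.log (colSum2 (M y t) Complex.I / colSum1 (M y t) Complex.I)
      = ((y + S.shift (coupling ζ c y t) : ℝ) : ℂ) := by
    intro y t
    obtain ⟨h1, h2⟩ := (hM y t).self_of_nhds
    have := (hreg y t).ratio_eq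
    rw [h1, h2, ← inv_div, this, ← Complex.ofReal_inv, ← Real.exp_neg,
      ← Complex.ofReal_log (Real.exp_pos _).le, Real.log_exp]
    push_cast
    ring
  have hlim : ∀ y t, Tendsto
        (fun z => 1 / (z - Complex.I) *
          (1 - colSum1 (M y t) z * colSum2 (M y t) z
            / (colSum1 (M y t) Complex.I * colSum2 (M y t) Complex.I)))
        (𝓝[≠] Complex.I) (𝓝 ((-(S.logDerivA (coupling ζ c y t)
          + S.logDerivB (coupling ζ c y t)) : ℝ) : ℂ)) := by
    intro y t
    set P := S.sol (coupling ζ c y t) with hP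
    have n1 : P Complex.I ≠ 0 := (hreg y t).ne_zero
    have n2 : P (-Complex.I) ≠ 0 := (hreg y t).ne_zero'
    obtain ⟨h1, h2⟩ := (hM y t).self_of_nhds
    have f1 := (hreg y t).deriv_I (symm_coupling c y t) (invSymm_coupling c y t)
    have f2 := (hreg y t).deriv_neg_I (symm_coupling c y t) (invSymm_coupling c y t)
    rw [div_eq_iff n1] at f1
    rw [div_eq_iff n2] at f2
    have d1 : HasDerivAt P (deriv P Complex.I) Complex.I :=
      (PoleSystem.differentiableAt_sol _ PoleSystem.I_notMem).hasDerivAt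
    have d2 : HasDerivAt P (deriv P (-Complex.I)) (-Complex.I) :=
      (PoleSystem.differentiableAt_sol _ PoleSystem.neg_I_notMem).hasDerivAt
    have d3 : HasDerivAt (fun z => P (-z)) (-deriv P (-Complex.I)) Complex.I := by
      simpa [Function.comp_def] using HasDerivAt.comp Complex.I d2 (hasDerivAt_neg Complex.I)
    have d4 := ((d1.fun_mul d3).div_const (P Complex.I * P (-Complex.I)))
    have d5 := (hasDerivAt_iff_tendsto_slope.1 d4).neg
    have hval : -((deriv P Complex.I * P (-Complex.I) + P Complex.I * -deriv P (-Complex.I)) /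
        (P Complex.I * P (-Complex.I))) = ((-(S.logDerivA (coupling ζ c y t)
          + S.logDerivB (coupling ζ c y t)) : ℝ) : ℂ) := by
      rw [f1, f2]
      push_cast
      field_simp
    rw [hval] at d5
    refine d5.congr' ?_
    filter_upwards [(hM y t).filter_mono nhdsWithin_le_nhds] with z hz
    rw [hz.1, hz.2, h1, h2, slope_def_field, div_self (mul_ne_zero n1 n2)]
    ring
  constructor
  · rintro ⟨x, -, hx⟩ y t
    obtain ⟨e1, e2⟩ := hx y t
    rw [hlog] at e1
    rw [Complex.ofReal_inj.1 e1] at e2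
    exact_mod_cast tendsto_nhds_unique e2 (hlim y t)
  · intro h
    refine ⟨fun y t => y + S.shift (coupling ζ c y t), (flowData_coupling hinj hζ hreg).bijective_X,
      fun y t => ⟨(hlog y t).symm, ?_⟩⟩
    rw [h]
    exact hlim y t

theorem IsSolitonRH.eventually_colSum {c : Fin n → ℂ} {y t : ℝ} {M : ℂ → Mat}
    (hM : IsSolitonRH ζ c y t M) : ∀ᶠ z in 𝓝 Complex.I,
      colSum1 M z = (poleSystem ζ hinj hζ).sol (coupling ζ c y t) z ∧
      colSum2 M z = (poleSystem ζ hinj hζ).sol (coupling ζ c y t) (-z) := by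
  have h1 := (finite_spectrumSet ζ).isClosed.isOpen_compl.mem_nhds (I_notMem_spectrumSet hinj hζ)
  have h2 := (continuous_neg.tendsto Complex.I).eventually
    ((finite_spectrumSet ζ).isClosed.isOpen_compl.mem_nhds (neg_I_notMem_spectrumSet hinj hζ))
  filter_upwards [h1, h2] with z hz hz'
  refine ⟨hM.colSum1_eq hz, ?_⟩
  have := hM.colSum2_neg_eq (hinj := hinj) (hζ := hζ) hz'
  rwa [neg_neg] at this

/-- If `M` agrees near `i` with solutions of the soliton problem, then exactly one function is
recovered from `M`, and it is the `n`-soliton solution. -/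
theorem existsUnique_recovers (hinj : Function.Injective ζ) (hζ : ∀ j, ζ j ∈ regionD)
    {c : Fin n → ℂ} {M M0 : ℝ → ℝ → ℂ → Mat} (hM0 : ∀ y t, IsSolitonRH ζ c y t (M0 y t))
    (hM : ∀ y t, ∀ᶠ z in 𝓝 Complex.I, M y t z = M0 y t z) :
    (∃! u : ℝ → ℝ → ℝ, Recovers M u) ∧
      ∀ u : ℝ → ℝ → ℝ, Recovers M u → IsNSolitonSolution ζ c u := by
  have hreg : ∀ y t, (poleSystem ζ hinj hζ).Regular (coupling ζ c y t) := fun y t =>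
    (hM0 y t).regular
  have h0 := fun u => recovers_iff hinj hζ (u := u) hreg fun y t => (hM0 y t).eventually_colSum
  have h1 := fun u => recovers_iff hinj hζ (u := u) (M := M) hreg fun y t => by
    filter_upwards [hM y t, (hM0 y t).eventually_colSum (hinj := hinj) (hζ := hζ)] with z e1 e2
    simpa only [colSum1, colSum2, e1] using e2
  have F := flowData_coupling hinj hζ hreg
  refine ⟨?_, fun u hu => ⟨F.isMCHSolution ((h1 u).1 hu), M0, hM0, (h0 u).2 ((h1 u).1 hu)⟩⟩
  let e := fun t => Equiv.ofBijective _ (F.bijective_X t)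
  refine ⟨fun x t => -((poleSystem ζ hinj hζ).logDerivA (coupling ζ c ((e t).symm x) t)
        + (poleSystem ζ hinj hζ).logDerivB (coupling ζ c ((e t).symm x) t)), ?_, ?_⟩
  · refine (h1 _).2 fun y t => ?_
    have : (e t).symm (y + (poleSystem ζ hinj hζ).shift (coupling ζ c y t)) = y :=
      (e t).symm_apply_apply y
    simp only [this]
  · intro u hu
    funext x t
    obtain ⟨y, rfl⟩ := (e t).surjective x
    rw [Equiv.symm_apply_apply]
    exact (h1 u).1 hu y t

end

section

open MeasureTheory

/-! ### Rectifiable curves are removable for continuous functions -/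

/-- The integral of `f` over the boundary of the rectangle with the opposite corners `a + ci` and
`b + di`. -/
def rectInt (f : ℂ → ℂ) (a b c d : ℝ) : ℂ :=
  (∫ x : ℝ in a..b, f (x + c * Complex.I)) - (∫ x : ℝ in a..b, f (x + d * Complex.I)) +
    Complex.I * (∫ y : ℝ in c..d, f (b + y * Complex.I)) -
    Complex.I * (∫ y : ℝ in c..d, f (a + y * Complex.I))

theorem intervalIntegrable_horizontal {f : ℂ → ℂ} (hf : Continuous f) (a b c : ℝ) :
    IntervalIntegrable (fun x : ℝ => f (x + c * Complex.I)) volume a b :=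
  Continuous.intervalIntegrable (by fun_prop) _ _

theorem intervalIntegrable_vertical {f : ℂ → ℂ} (hf : Continuous f) (a c d : ℝ) :
    IntervalIntegrable (fun y : ℝ => f (a + y * Complex.I)) volume c d :=
  Continuous.intervalIntegrable (by fun_prop) _ _

/-- Integrals over interior edges of the grid occur twice with opposite signs and telescope. -/
theorem sum_rectInt {f : ℂ → ℂ} (hf : Continuous f) (a c : ℕ → ℝ) (N : ℕ) :
    ∑ i ∈ Finset.range N, ∑ j ∈ Finset.range N, rectInt f (a i) (a (i + 1)) (c j) (c (j + 1))
      = rectInt f (a 0) (a N) (c 0) (c N) := by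
  have h1 : ∀ i, ∑ j ∈ Finset.range N, rectInt f (a i) (a (i + 1)) (c j) (c (j + 1)) =
      rectInt f (a i) (a (i + 1)) (c 0) (c N) := by
    intro i
    simp only [rectInt, Finset.sum_add_distrib, Finset.sum_sub_distrib, ← Finset.mul_sum]
    rw [intervalIntegral.sum_integral_adjacent_intervals fun k _ =>
        intervalIntegrable_vertical hf _ _ _,
      intervalIntegral.sum_integral_adjacent_intervals fun k _ =>
        intervalIntegrable_vertical hf _ _ _, ← Finset.sum_sub_distrib,
      Finset.sum_range_sub' (fun j => ∫ x : ℝ in a i..a (i + 1), f (x + c j * Complex.I))]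
  rw [Finset.sum_congr rfl fun i _ => h1 i]
  simp only [rectInt, Finset.sum_add_distrib, Finset.sum_sub_distrib]
  rw [intervalIntegral.sum_integral_adjacent_intervals fun k _ =>
      intervalIntegrable_horizontal hf _ _ _,
    intervalIntegral.sum_integral_adjacent_intervals fun k _ =>
      intervalIntegrable_horizontal hf _ _ _, add_sub_assoc, ← Finset.sum_sub_distrib,
    Finset.sum_range_sub (fun i =>
      Complex.I * ∫ y : ℝ in c 0..c N, f (a i + y * Complex.I)), add_sub_assoc]

/-- A constant integrates to zero over a closed contour, so only the oscillation of `f` counts. -/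
theorem norm_rectInt_le {f : ℂ → ℂ} (hf : Continuous f) {a b c d ε : ℝ} {w : ℂ}
    (h : ∀ z : ℂ, z.re ∈ uIcc a b → z.im ∈ uIcc c d → ‖f z - w‖ ≤ ε) :
    ‖rectInt f a b c d‖ ≤ 2 * ε * (|b - a| + |d - c|) := by
  have h0 : rectInt f a b c d = rectInt (fun z => f z - w) a b c d := by
    simp only [rectInt]
    rw [intervalIntegral.integral_sub (intervalIntegrable_horizontal hf _ _ _)
        intervalIntegrable_const,
      intervalIntegral.integral_sub (intervalIntegrable_horizontal hf _ _ _)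
        intervalIntegrable_const,
      intervalIntegral.integral_sub (intervalIntegrable_vertical hf _ _ _)
        intervalIntegrable_const,
      intervalIntegral.integral_sub (intervalIntegrable_vertical hf _ _ _)
        intervalIntegrable_const]
    ring
  have e1 : ∀ y ∈ uIcc c d, ‖∫ x : ℝ in a..b, (f (x + y * Complex.I) - w)‖ ≤ ε * |b - a| :=
    fun y hy => intervalIntegral.norm_integral_le_of_norm_le_const fun x hx =>
      h _ (by simpa using uIoc_subset_uIcc hx) (by simpa using hy)
  have e2 : ∀ x ∈ uIcc a b, ‖Complex.I * ∫ y : ℝ in c..d, (f (x + y * Complex.I) - w)‖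
      ≤ ε * |d - c| := fun x hx => by
    rw [norm_mul, Complex.norm_I, one_mul]
    exact intervalIntegral.norm_integral_le_of_norm_le_const fun y hy =>
      h _ (by simpa using hx) (by simpa using uIoc_subset_uIcc hy)
  rw [h0, rectInt]
  refine (norm_sub_le _ _).trans ?_
  refine (add_le_add_left ((norm_add_le _ _).trans (add_le_add_left (norm_sub_le _ _) _)) _).trans ?_
  have := e1 c left_mem_uIcc
  have := e1 d right_mem_uIcc
  have := e2 a left_mem_uIcc
  have := e2 b right_mem_uIcc
  linarith

theorem rectInt_eq_zero {f : ℂ → ℂ} {a b c d : ℝ}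
    (h : ∀ z : ℂ, z.re ∈ uIcc a b → z.im ∈ uIcc c d → DifferentiableAt ℂ f z) :
    rectInt f a b c d = 0 := by
  have := Complex.integral_boundary_rect_eq_zero_of_differentiableOn f (a + c * Complex.I)
    (b + d * Complex.I) fun z hz => by
      rw [Complex.mem_reProdIm] at hz
      exact (h z (by simpa using hz.1) (by simpa using hz.2)).differentiableWithinAt
  simpa [rectInt] using this

theorem card_filter_abs_sub_le (N : ℕ) (u L : ℝ) (hL : 0 ≤ L) :
    (((Finset.range N).filter fun i : ℕ => |(i : ℝ) - u| ≤ L).card : ℝ) ≤ 2 * L + 1 := by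
  have h1 : ((Finset.range N).filter fun i : ℕ => |(i : ℝ) - u| ≤ L).card ≤
      (Finset.Icc ⌈u - L⌉ ⌊u + L⌋).card := by
    refine Finset.card_le_card_of_injOn (fun i : ℕ => (i : ℤ)) (fun i hi => ?_)
      (fun i _ j _ h => by simpa using h)
    have hi' := abs_le.1 (Finset.mem_filter.1 hi).2
    simp only [Finset.coe_Icc, mem_Icc, Int.ceil_le, Int.le_floor, Int.cast_natCast]
    constructor <;> linarith
  rw [Int.card_Icc] at h1
  have h2 : (((⌊u + L⌋ + 1 - ⌈u - L⌉).toNat : ℕ) : ℝ) ≤ 2 * L + 1 := by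
    rcases le_total 0 (⌊u + L⌋ + 1 - ⌈u - L⌉) with h | h
    · have h3 : (((⌊u + L⌋ + 1 - ⌈u - L⌉).toNat : ℤ) : ℝ)
          = ((⌊u + L⌋ + 1 - ⌈u - L⌉ : ℤ) : ℝ) := by rw [Int.toNat_of_nonneg h]
      rw [Int.cast_natCast] at h3
      rw [h3]
      push_cast
      have := Int.floor_le (u + L)
      have := Int.le_ceil (u - L)
      linarith
    · rw [Int.toNat_of_nonpos h]
      simp only [Nat.cast_zero]
      linarith
  exact (Nat.cast_le.2 h1).trans h2

/-- One coordinate of the position of a grid cell that meets a curve. -/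
theorem abs_sub_le_of_mem_cell {N i : ℕ} (hN : 0 < N) {a b x x' K : ℝ} (hab : a ≠ b)
    (hx : x ∈ uIcc (a + i * ((b - a) / N)) (a + (i + 1 : ℕ) * ((b - a) / N)))
    (hxx : |x - x'| ≤ K / N) :
    |(i : ℝ) - N * (x' - a) / (b - a)| ≤ (K + |b - a|) / |b - a| := by
  have hN' : (0 : ℝ) < N := by exact_mod_cast hN
  have hba : b - a ≠ 0 := sub_ne_zero.2 hab.symm
  have hba' : 0 < |b - a| := abs_pos.2 hba
  have h1 : |x - (a + i * ((b - a) / N))| ≤ |b - a| / N := by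
    have := abs_sub_left_of_mem_uIcc hx
    rw [show a + (i + 1 : ℕ) * ((b - a) / N) - (a + i * ((b - a) / N)) = (b - a) / N by
      push_cast; ring, abs_div, abs_of_pos hN'] at this
    rwa [abs_sub_comm] at this ⊢
  have h2 : |(a + i * ((b - a) / N)) - x'| ≤ (K + |b - a|) / N := by
    rw [show (a + i * ((b - a) / N)) - x' = (x - x') - (x - (a + i * ((b - a) / N))) by ring,
      add_div]
    exact (abs_sub _ _).trans (add_le_add hxx h1)
  have h3 : (i : ℝ) - N * (x' - a) / (b - a) =
      ((a + i * ((b - a) / N)) - x') * (N / (b - a)) := by field_simp; ring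
  rw [h3, abs_mul, abs_div, abs_of_pos hN', le_div_iff₀ hba']
  calc _ = |a + ↑i * ((b - a) / ↑N) - x'| * N := by field_simp
    _ ≤ (K + |b - a|) / N * N := by gcongr
    _ = _ := by field_simp

/-- Cut the rectangle into `N²` cells. A Lipschitz curve meets only `O(N)` of them, and by uniform
continuity each of these contributes at most `ε · O(1/N)`; the other cells contribute nothing by
Cauchy's theorem. The total is `O(ε)`, uniformly in `N`. -/
theorem rectInt_eq_zero_of_lipschitz {f : ℂ → ℂ} (hf : Continuous f) {γ : ℝ → ℂ} {K : NNReal}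
    (hγ : LipschitzWith K γ) {a b c d : ℝ}
    (h : ∀ z : ℂ, z.re ∈ uIcc a b → z.im ∈ uIcc c d → z ∉ γ '' Icc 0 1 → DifferentiableAt ℂ f z) :
    rectInt f a b c d = 0 := by
  rcases eq_or_ne a b with rfl | hab
  · simp [rectInt]
  rcases eq_or_ne c d with rfl | hcd
  · simp [rectInt]
  set A := |b - a| + |d - c| with hA
  have hA0 : 0 < A := add_pos (abs_pos.2 (sub_ne_zero.2 hab.symm)) (abs_pos.2 (sub_ne_zero.2 hcd.symm))
  set L₁ := ((K : ℝ) + |b - a|) / |b - a| with hL₁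
  set L₂ := ((K : ℝ) + |d - c|) / |d - c| with hL₂
  have hL₁0 : 0 ≤ L₁ := by positivity
  have hL₂0 : 0 ≤ L₂ := by positivity
  set C := (2 * L₁ + 1) * (2 * L₂ + 1) * (4 * A) with hC
  have hC0 : 0 < C := by positivity
  have key : ∀ ε > 0, ‖rectInt f a b c d‖ ≤ C * ε := by
    intro ε hε
    have hcomp : IsCompact (uIcc a b ×ℂ uIcc c d) := isCompact_uIcc.reProdIm isCompact_uIcc
    obtain ⟨δ, hδ, hδf⟩ := Metric.uniformContinuousOn_iff.1
      (hcomp.uniformContinuousOn_of_continuous hf.continuousOn) ε hε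
    obtain ⟨N, hN⟩ := exists_nat_gt (A / δ)
    have hN' : (0 : ℝ) < N := (div_pos hA0 hδ).trans hN
    have hN0 : 0 < N := by exact_mod_cast hN'
    have hAN : A / N < δ := by
      rw [div_lt_iff₀ hδ] at hN
      rw [div_lt_iff₀ hN']
      linarith
    let x : ℕ → ℝ := fun i => a + i * ((b - a) / N)
    let y : ℕ → ℝ := fun j => c + j * ((d - c) / N)
    have hx0 : x 0 = a := by simp [x]
    have hy0 : y 0 = c := by simp [y]
    have hxN : x N = b := by simp only [x]; field_simp; ring
    have hyN : y N = d := by simp only [y]; field_simp; ring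
    have hmem : ∀ {p q : ℝ} {i : ℕ}, i ≤ N → p + i * ((q - p) / N) ∈ uIcc p q := by
      intro p q i hi
      have : p + i * ((q - p) / N) = p + ((i : ℝ) / N) • (q - p) := by
        rw [smul_eq_mul]; ring
      rw [this]
      have hi' : (i : ℝ) / N ≤ 1 := (div_le_one hN').2 (by exact_mod_cast hi)
      rw [← segment_eq_uIcc]
      rw [segment_eq_image']
      exact ⟨_, ⟨by positivity, hi'⟩, rfl⟩
    have hcell : ∀ {i j : ℕ}, i < N → j < N → ∀ z : ℂ, z.re ∈ uIcc (x i) (x (i + 1)) →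
        z.im ∈ uIcc (y j) (y (j + 1)) → z.re ∈ uIcc a b ∧ z.im ∈ uIcc c d := by
      intro i j hi hj z hz1 hz2
      exact ⟨uIcc_subset_uIcc (hmem hi.le) (hmem hi) hz1, uIcc_subset_uIcc (hmem hj.le) (hmem hj) hz2⟩
    have hdx : ∀ i, |x (i + 1) - x i| = |b - a| / N := fun i => by
      simp only [x]
      rw [← abs_of_pos hN', ← abs_div, abs_of_pos hN']
      congr 1; push_cast; ring
    have hdy : ∀ j, |y (j + 1) - y j| = |d - c| / N := fun i => by
      simp only [y]
      rw [← abs_of_pos hN', ← abs_div, abs_of_pos hN']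
      congr 1; push_cast; ring
    have hbound : ∀ i < N, ∀ j < N,
        ‖rectInt f (x i) (x (i + 1)) (y j) (y (j + 1))‖ ≤ 2 * ε * (A / N) := by
      intro i hi j hj
      rw [hA, add_div, ← hdx i, ← hdy j]
      refine norm_rectInt_le hf (w := f (x i + y j * Complex.I)) fun z hz1 hz2 => ?_
      rw [← dist_eq_norm]
      obtain ⟨m1, m2⟩ := hcell hi hj z hz1 hz2
      obtain ⟨m3, m4⟩ := hcell hi hj (x i + y j * Complex.I) (by simp) (by simp)
      refine (hδf z ⟨m1, m2⟩ _ ⟨m3, m4⟩ ?_).le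
      refine lt_of_le_of_lt ?_ hAN
      rw [dist_eq_norm, hA, add_div, ← hdx i, ← hdy j]
      refine (Complex.norm_le_abs_re_add_abs_im _).trans (add_le_add ?_ ?_)
      · simpa [abs_sub_comm] using abs_sub_left_of_mem_uIcc hz1
      · simpa [abs_sub_comm] using abs_sub_left_of_mem_uIcc hz2
    classical
    -- A cell met by the curve lies within a bounded number of cells of one of the `N + 1` sample
    -- points `γ (m / N)`; `Ai` and `Bj` list the admissible column and row indices.
    let Ai : ℕ → Finset ℕ := fun m => (Finset.range N).filter fun i : ℕ =>
      |(i : ℝ) - N * ((γ (m / N)).re - a) / (b - a)| ≤ L₁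
    let Bj : ℕ → Finset ℕ := fun m => (Finset.range N).filter fun i : ℕ =>
      |(i : ℝ) - N * ((γ (m / N)).im - c) / (d - c)| ≤ L₂
    let Bad : Finset (ℕ × ℕ) := (Finset.range (N + 1)).biUnion fun m => Ai m ×ˢ Bj m
    have hBad : (Bad.card : ℝ) ≤ (N + 1) * ((2 * L₁ + 1) * (2 * L₂ + 1)) := by
      have h1 : Bad.card ≤ ∑ m ∈ Finset.range (N + 1), (Ai m ×ˢ Bj m).card :=
        Finset.card_biUnion_le
      refine (Nat.cast_le.2 h1).trans ?_
      push_cast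
      refine (Finset.sum_le_card_nsmul _ _ ((2 * L₁ + 1) * (2 * L₂ + 1)) fun m _ => ?_).trans ?_
      · rw [Finset.card_product]
        push_cast
        exact mul_le_mul (card_filter_abs_sub_le _ _ _ hL₁0) (card_filter_abs_sub_le _ _ _ hL₂0)
          (Nat.cast_nonneg _) (by positivity)
      · simp
    have hgood : ∀ i < N, ∀ j < N, (i, j) ∉ Bad →
        rectInt f (x i) (x (i + 1)) (y j) (y (j + 1)) = 0 := by
      intro i hi j hj hij
      refine rectInt_eq_zero fun z hz1 hz2 => ?_
      obtain ⟨m1, m2⟩ := hcell hi hj z hz1 hz2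
      refine h z m1 m2 fun hz => hij ?_
      obtain ⟨τ, ⟨hτ0, hτ1⟩, rfl⟩ := hz
      have hτ : |τ - (⌊τ * N⌋₊ : ℝ) / N| ≤ 1 / N := by
        have e1 := Nat.floor_le (mul_nonneg hτ0 hN'.le)
        have e2 := Nat.lt_floor_add_one (τ * N)
        have e3 : τ - (⌊τ * N⌋₊ : ℝ) / N = (τ * N - ⌊τ * N⌋₊) / N := by field_simp
        rw [e3, abs_div, abs_of_pos hN']
        gcongr
        rw [abs_le]
        constructor <;> linarith
      have hd : ‖γ τ - γ ((⌊τ * N⌋₊ : ℝ) / N)‖ ≤ K / N := by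
        have := hγ.dist_le_mul τ ((⌊τ * N⌋₊ : ℝ) / N)
        rw [dist_eq_norm, Real.dist_eq] at this
        refine this.trans ?_
        calc (K : ℝ) * _ ≤ K * (1 / N) := by gcongr
          _ = K / N := by ring
      -- The sample just before the parameter `τ` is within `1/N` of it, so by the Lipschitz bound
      -- the curve moves at most `K/N`.
      refine Finset.mem_biUnion.2 ⟨⌊τ * N⌋₊, ?_, Finset.mem_product.2
        ⟨Finset.mem_filter.2 ⟨Finset.mem_range.2 hi, ?_⟩,
          Finset.mem_filter.2 ⟨Finset.mem_range.2 hj, ?_⟩⟩⟩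
      · rw [Finset.mem_range, Nat.lt_succ_iff]
        refine Nat.floor_le_of_le ?_
        nlinarith
      · refine abs_sub_le_of_mem_cell hN0 hab hz1 ?_
        rw [← Complex.sub_re]
        exact (Complex.abs_re_le_norm _).trans hd
      · refine abs_sub_le_of_mem_cell hN0 hcd hz2 ?_
        rw [← Complex.sub_im]
        exact (Complex.abs_im_le_norm _).trans hd
    have hsum := sum_rectInt hf x y N
    rw [hx0, hy0, hxN, hyN, ← Finset.sum_product'] at hsum
    have hBadsub : Bad ⊆ Finset.range N ×ˢ Finset.range N := by
      refine Finset.biUnion_subset.2 fun m _ => ?_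
      exact Finset.product_subset_product (Finset.filter_subset _ _) (Finset.filter_subset _ _)
    rw [← Finset.sum_subset hBadsub fun p hp hpB => by
      rw [Finset.mem_product, Finset.mem_range, Finset.mem_range] at hp
      exact hgood _ hp.1 _ hp.2 hpB] at hsum
    rw [← hsum]
    refine (norm_sum_le_of_le (f := fun p : ℕ × ℕ =>
      rectInt f (x p.1) (x (p.1 + 1)) (y p.2) (y (p.2 + 1))) Bad
      (n := fun _ => 2 * ε * (A / N)) fun p hp => ?_).trans ?_
    · have := hBadsub hp
      rw [Finset.mem_product, Finset.mem_range, Finset.mem_range] at this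
      exact hbound _ this.1 _ this.2
    · rw [Finset.sum_const, nsmul_eq_mul]
      have hN1 : (1 : ℝ) ≤ N := by exact_mod_cast hN0
      calc (Bad.card : ℝ) * (2 * ε * (A / N))
          ≤ ((N + 1) * ((2 * L₁ + 1) * (2 * L₂ + 1))) * (2 * ε * (A / N)) := by gcongr
        _ ≤ ((2 * N) * ((2 * L₁ + 1) * (2 * L₂ + 1))) * (2 * ε * (A / N)) := by
            gcongr; linarith
        _ = C * ε := by rw [hC]; field_simp; ring
  rw [← norm_le_zero_iff]
  refine le_of_forall_pos_le_add fun ε hε => ?_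
  have := key (ε / C) (by positivity)
  rwa [mul_div_cancel₀ _ hC0.ne', ← zero_add ε] at this

/-- A function that is continuous near `z₀` and holomorphic there off a Lipschitz curve is
holomorphic at `z₀`. -/
theorem differentiableAt_of_lipschitz_curve {f : ℂ → ℂ} {γ : ℝ → ℂ} {K : NNReal}
    (hγ : LipschitzWith K γ) {z₀ : ℂ} {r : ℝ} (hr : 0 < r)
    (hf : ContinuousOn f (Metric.closedBall z₀ r))
    (hd : ∀ z ∈ Metric.ball z₀ r, z ∉ γ '' Icc 0 1 → DifferentiableAt ℂ f z) :
    DifferentiableAt ℂ f z₀ := by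
  -- Tietze extension: the rectangle lemma is stated for globally continuous functions.
  obtain ⟨F, hF⟩ := ContinuousMap.exists_restrict_eq (Metric.isClosed_closedBall)
    ⟨(Metric.closedBall z₀ r).domRestrict f, hf.domRestrict⟩
  have hFf : ∀ z ∈ Metric.closedBall z₀ r, F z = f z := fun z hz =>
    congrArg (fun g : C(Metric.closedBall z₀ r, ℂ) => g ⟨z, hz⟩) hF
  have hFd : ∀ z ∈ Metric.ball z₀ r, z ∉ γ '' Icc 0 1 → DifferentiableAt ℂ F z := by
    intro z hz hzγ
    refine (hd z hz hzγ).congr_of_eventuallyEq ?_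
    filter_upwards [Metric.isOpen_ball.mem_nhds hz] with w hw
    exact hFf w (Metric.ball_subset_closedBall hw)
  -- Morera: vanishing rectangle integrals make `F` holomorphic on the disc.
  have hcons : Complex.IsConservativeOn F (Metric.ball z₀ r) := by
    intro z w hzw
    rw [← add_eq_zero_iff_eq_neg, Complex.wedgeIntegral_add_wedgeIntegral_eq]
    exact rectInt_eq_zero_of_lipschitz F.continuous hγ fun p hp1 hp2 hpγ =>
      hFd p (hzw ⟨hp1, hp2⟩) hpγ
  have h1 : DifferentiableAt ℂ F z₀ :=
    ((hcons.isExactOn_ball F.continuous.continuousOn).differentiableOn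
      Metric.isOpen_ball).differentiableAt (Metric.ball_mem_nhds z₀ hr)
  refine h1.congr_of_eventuallyEq ?_
  filter_upwards [Metric.ball_mem_nhds z₀ hr] with w hw
  exact (hFf w (Metric.ball_subset_closedBall hw)).symm

end

section

/-! ### Interpolation of poles by jumps -/

/-- Contours that surround poles, together with triangular residue matrices
`Matrix.single (row k) (col k) (coef k j)` at the poles `pt k j`. -/
structure PoleContours (κ ι : Type*) where
  dom : κ → Set ℂ
  pt : κ → ι → ℂ
  coef : κ → ι → ℂ
  row : κ → Fin 2
  col : κ → Fin 2
  row_ne_col : ∀ k, row k ≠ col k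
  jordan : ∀ k, IsJordanDomain (dom k)
  mem : ∀ k j, pt k j ∈ dom k
  injective : ∀ k, Function.Injective (pt k)
  disjoint : ∀ k l, k ≠ l → Disjoint (closure (dom k)) (closure (dom l))

theorem mul_one_add_single {r s : Fin 2} (A : Mat) (x : ℂ) (a b : Fin 2) :
    (A * (1 + Matrix.single r s x)) a b = A a b + if b = s then A a r * x else 0 := by
  rw [mul_add, mul_one, Matrix.add_apply]
  congr 1
  split_ifs with h
  · rw [h, Matrix.mul_single_apply_same]
  · rw [Matrix.mul_single_apply_of_ne _ _ _ _ _ h]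

theorem mul_single_apply' {r s : Fin 2} (A : Mat) (x : ℂ) (a b : Fin 2) :
    (A * Matrix.single r s x) a b = if b = s then A a r * x else 0 := by
  split_ifs with h
  · rw [h, Matrix.mul_single_apply_same]
  · rw [Matrix.mul_single_apply_of_ne _ _ _ _ _ h]

theorem tendsto_mat {α : Type*} {l : Filter α} {f : α → Mat} {A : Mat} :
    Tendsto f l (𝓝 A) ↔ ∀ a b, Tendsto (fun x => f x a b) l (𝓝 (A a b)) := by
  exact ⟨fun h a b => tendsto_pi_nhds.1 (tendsto_pi_nhds.1 h a) b,
    fun h => tendsto_pi_nhds.2 fun a => tendsto_pi_nhds.2 (h a)⟩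

namespace PoleContours

variable {κ ι : Type*} [Finite κ] [Fintype ι] (D : PoleContours κ ι)

/-- The sum of the poles inside a contour. -/
def poles (k : κ) (z : ℂ) : ℂ := ∑ j, D.coef k j / (z - D.pt k j)

/-- The triangular matrix with the sum of the poles inside a contour as its entry. -/
def tri (k : κ) (ε z : ℂ) : Mat := 1 + Matrix.single (D.row k) (D.col k) (ε * D.poles k z)

/-- The set of all poles. -/
def poleSet : Set ℂ := {z | ∃ k j, z = D.pt k j}

variable {D}

-- The single off-diagonal entry is nilpotent because the row and column indices differ.
omit [Finite κ] in
theorem tri_mul_tri (k : κ) (ε z : ℂ) : D.tri k ε z * D.tri k (-ε) z = 1 := by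
  rw [tri, tri, add_mul, one_mul, mul_add, mul_one,
    Matrix.single_mul_single_of_ne _ _ _ _ (D.row_ne_col k).symm, add_zero, add_assoc,
    ← Matrix.single_add, neg_mul, neg_add_cancel, Matrix.single_zero, add_zero]

theorem finite_poleSet : D.poleSet.Finite := by
  have : D.poleSet = ⋃ k, range (D.pt k) := by
    ext z
    simp [poleSet, eq_comm]
  rw [this]
  exact finite_iUnion fun k => finite_range _

omit [Finite κ] [Fintype ι] in
theorem eq_of_mem_closure {k l : κ} {z : ℂ} (hk : z ∈ closure (D.dom k))
    (hl : z ∈ closure (D.dom l)) : k = l := by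
  by_contra h
  exact (D.disjoint k l h).notMem_of_mem_left hk hl

omit [Finite κ] [Fintype ι] in
theorem notMem_frontier {k : κ} {z : ℂ} (h : z ∈ D.dom k) (l : κ) : z ∉ frontier (D.dom l) := by
  intro hl
  obtain rfl := eq_of_mem_closure (subset_closure h) hl.1
  rw [(D.jordan k).1.frontier_eq] at hl
  exact hl.2 h

omit [Finite κ] [Fintype ι] in
theorem notMem_frontier_of_notMem_closure {z : ℂ} (h : ∀ k, z ∉ closure (D.dom k)) (l : κ) :
    z ∉ frontier (D.dom l) := fun hl => h l hl.1

omit [Fintype ι] in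
theorem isOpen_outside : IsOpen {z | ∀ k, z ∉ closure (D.dom k)} := by
  have : {z | ∀ k, z ∉ closure (D.dom k)} = (⋃ k, closure (D.dom k))ᶜ := by ext; simp
  rw [this]
  exact (isClosed_iUnion_of_finite fun k => isClosed_closure).isOpen_compl

omit [Fintype ι] in
theorem isOpen_compl_frontier : IsOpen (⋃ k, frontier (D.dom k))ᶜ :=
  (isClosed_iUnion_of_finite fun _ => isClosed_frontier).isOpen_compl

omit [Finite κ] in
theorem differentiableAt_poles (k : κ) {z : ℂ} (hz : z ∉ D.poleSet) :
    DifferentiableAt ℂ (D.poles k) z := by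
  unfold poles
  refine DifferentiableAt.fun_sum fun j _ => ?_
  have : z - D.pt k j ≠ 0 := sub_ne_zero.2 fun h => hz ⟨k, j, h⟩
  fun_prop (disch := assumption)

omit [Finite κ] in
theorem tendsto_mul_poles (k : κ) (j : ι) :
    Tendsto (fun z => (z - D.pt k j) * D.poles k z) (𝓝[≠] (D.pt k j)) (𝓝 (D.coef k j)) := by
  classical
  have h1 : ContinuousAt (fun z => D.coef k j + (z - D.pt k j) *
      ∑ b ∈ Finset.univ.erase j, D.coef k b / (z - D.pt k b)) (D.pt k j) := by
    refine continuousAt_const.add (ContinuousAt.mul (by fun_prop) ?_)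
    refine tendsto_finsetSum _ fun b hb => ?_
    have : D.pt k j - D.pt k b ≠ 0 := sub_ne_zero.2 fun h =>
      (Finset.ne_of_mem_erase hb) (D.injective k h).symm
    exact ContinuousAt.div continuousAt_const (by fun_prop) this
  have h2 := h1.tendsto.mono_left (nhdsWithin_le_nhds (s := {D.pt k j}ᶜ))
  simp only [sub_self, zero_mul, add_zero] at h2
  refine h2.congr' ?_
  filter_upwards [self_mem_nhdsWithin] with z hz
  have hz' : z - D.pt k j ≠ 0 := sub_ne_zero.2 hz
  rw [poles, ← Finset.add_sum_erase _ _ (Finset.mem_univ j), mul_add, mul_div_cancel₀ _ hz']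

/-- Near a point of a contour there are no other contours and no poles. -/
theorem eventually_near_frontier {k : κ} {z : ℂ} (hz : z ∈ frontier (D.dom k)) :
    ∀ᶠ w in 𝓝 z, (∀ l, w ∈ closure (D.dom l) → l = k) ∧ w ∉ D.poleSet := by
  have h1 : z ∉ ⋃ l : {l // l ≠ k}, closure (D.dom l) := by
    rw [mem_iUnion]
    rintro ⟨l, hl⟩
    exact l.2 (eq_of_mem_closure hl hz.1)
  have h2 : z ∉ D.poleSet := by
    rintro ⟨l, j, rfl⟩
    exact notMem_frontier (D.mem l j) k hz
  filter_upwards [(isClosed_iUnion_of_finite fun l : {l // l ≠ k} =>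
    isClosed_closure (s := D.dom l)).isOpen_compl.mem_nhds h1,
    finite_poleSet.isClosed.isOpen_compl.mem_nhds h2] with w hw1 hw2
  refine ⟨fun l hl => ?_, hw2⟩
  by_contra hlk
  exact hw1 (mem_iUnion.2 ⟨⟨l, hlk⟩, hl⟩)

omit [Finite κ] in
theorem differentiableAt_mul_tri {M : ℂ → Mat} {z : ℂ}
    (hM : ∀ a b, DifferentiableAt ℂ (fun z => M z a b) z) (hz : z ∉ D.poleSet) (k : κ) (ε : ℂ)
    (a b : Fin 2) : DifferentiableAt ℂ (fun z => (M z * D.tri k ε z) a b) z := by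
  simp only [tri, mul_one_add_single]
  split_ifs
  · exact (hM a b).add ((hM a _).mul ((differentiableAt_poles k hz).const_mul ε))
  · simpa using hM a b

omit [Finite κ] [Fintype ι] in
/-- Removability of the contours. -/
theorem differentiableAt_of_frontier {k : κ} {f : ℂ → ℂ} {z : ℂ}
    (hc : ∀ᶠ w in 𝓝 z, ContinuousAt f w)
    (hd : ∀ᶠ w in 𝓝 z, w ∉ frontier (D.dom k) → DifferentiableAt ℂ f w) :
    DifferentiableAt ℂ f z := by
  obtain ⟨γ, ⟨K, hK⟩, hper, -, hγ⟩ := (D.jordan k).2.2.2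
  obtain ⟨r, hr, hball⟩ := Metric.nhds_basis_closedBall.eventually_iff.1 (hc.and hd)
  refine differentiableAt_of_lipschitz_curve hK hr
    (fun w hw => (hball hw).1.continuousWithinAt) fun w hw hwγ => ?_
  refine (hball (Metric.ball_subset_closedBall hw)).2 fun h => hwγ ?_
  rw [hγ] at h
  have := hper.image_Icc one_pos 0
  rw [zero_add] at this
  rwa [this]

/-- A solution with jumps gives rise to a solution with poles. -/
theorem exists_poles_of_jumps {M : ℂ → Mat} {U : κ → ℂ → Mat}
    (hM : ∀ a b, DifferentiableOn ℂ (fun z => M z a b) (⋃ k, frontier (D.dom k))ᶜ)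
    (hU : ∀ k, ∀ z ∈ frontier (D.dom k), U k z = D.tri k (-1) z)
    (hJ : ∀ k, HasJump M (D.dom k) (U k)) :
    ∃ M0 : ℂ → Mat, (∀ a b, DifferentiableOn ℂ (fun z => M0 z a b) D.poleSetᶜ) ∧
      (∀ k j, HasResidueCondition M0 (D.pt k j)
        (Matrix.single (D.row k) (D.col k) (D.coef k j))) ∧
      (∀ z, (∀ k, z ∉ closure (D.dom k)) → M z = M0 z) ∧
      ∀ k, ∀ z ∈ D.dom k, M z = M0 z * D.tri k (-1) z := by
  classical
  choose Mp Mm hMp hMm hlim using hJ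
  -- The poles are put back inside; on a contour the value is the outer boundary value, which the
  -- jump relation makes equal to the limit from inside.
  let M0 : ℂ → Mat := fun z =>
    if h : ∃ k, z ∈ D.dom k then M z * D.tri h.choose 1 z
    else if h : ∃ k, z ∈ frontier (D.dom k) then Mm h.choose z else M z
  have e1 : ∀ k, ∀ z ∈ D.dom k, M0 z = M z * D.tri k 1 z := by
    intro k z hz
    have h : ∃ k, z ∈ D.dom k := ⟨k, hz⟩
    have hk : h.choose = k :=
      eq_of_mem_closure (subset_closure h.choose_spec) (subset_closure hz)
    simp only [M0, dif_pos h, hk]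
  have e2 : ∀ k, ∀ z ∈ frontier (D.dom k), M0 z = Mm k z := by
    intro k z hz
    have h0 : ¬∃ k, z ∈ D.dom k := fun ⟨l, hl⟩ => notMem_frontier hl k hz
    have h : ∃ k, z ∈ frontier (D.dom k) := ⟨k, hz⟩
    have hk : h.choose = k := eq_of_mem_closure h.choose_spec.1 hz.1
    simp only [M0, dif_neg h0, dif_pos h, hk]
  have e3 : ∀ z, (∀ k, z ∉ closure (D.dom k)) → M0 z = M z := by
    intro z hz
    have h0 : ¬∃ k, z ∈ D.dom k := fun ⟨l, hl⟩ => hz l (subset_closure hl)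
    have h : ¬∃ k, z ∈ frontier (D.dom k) := fun ⟨l, hl⟩ => hz l hl.1
    simp only [M0, dif_neg h0, dif_neg h]
  have hMd : ∀ z, (∀ k, z ∉ frontier (D.dom k)) → ∀ a b,
      DifferentiableAt ℂ (fun z => M z a b) z := fun z hz a b =>
    (hM a b).differentiableAt (isOpen_compl_frontier.mem_nhds (by simpa using hz))
  have d1 : ∀ k, ∀ z ∈ D.dom k, z ∉ D.poleSet → ∀ a b,
      DifferentiableAt ℂ (fun z => M0 z a b) z := fun k z hz hzp a b =>
    (differentiableAt_mul_tri (hMd z (notMem_frontier hz)) hzp k 1 a b).congr_of_eventuallyEq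
      (((D.jordan k).1.mem_nhds hz |> fun h => mem_of_superset h fun w hw => by
        simp only [mem_ofPred_eq, e1 k w hw]))
  have d3 : ∀ z, (∀ k, z ∉ closure (D.dom k)) → ∀ a b,
      DifferentiableAt ℂ (fun z => M0 z a b) z := fun z hz a b =>
    (hMd z (notMem_frontier_of_notMem_closure hz) a b).congr_of_eventuallyEq
      (mem_of_superset (isOpen_outside.mem_nhds hz) fun w hw => by
        simp only [mem_ofPred_eq, e3 w hw])
  have c2 : ∀ k, ∀ z ∈ frontier (D.dom k), ContinuousAt M0 z := by
    intro k z hz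
    obtain ⟨l1, l2, l3⟩ := hlim k z hz
    have hev := eventually_near_frontier hz
    have hzp := hev.self_of_nhds.2
    -- Continuity at a contour point has to be checked along the inside, the contour itself and the
    -- outside; there is no other set to approach from.
    have hcov : 𝓝 z = 𝓝[D.dom k] z ⊔ 𝓝[frontier (D.dom k)] z ⊔ 𝓝[(closure (D.dom k))ᶜ] z := by
      rw [← nhdsWithin_union, ← nhdsWithin_union, ← nhdsWithin_univ]
      congr 1
      rw [(D.jordan k).1.frontier_eq, union_sdiff_cancel subset_closure, union_compl_self]
    rw [ContinuousAt, hcov, tendsto_sup, tendsto_sup, e2 k z hz]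
    refine ⟨⟨?_, ?_⟩, ?_⟩
    · have ht : Tendsto (fun w => D.tri k 1 w) (𝓝[D.dom k] z) (𝓝 (D.tri k 1 z)) := by
        refine tendsto_mat.2 fun a b => ?_
        have := (differentiableAt_mul_tri (M := fun _ => 1) (fun a b => differentiableAt_const _)
          hzp k 1 a b).continuousAt
        simp only [one_mul] at this
        exact this.tendsto.mono_left nhdsWithin_le_nhds
      have hval : Mp k z * D.tri k 1 z = Mm k z := by
        have := tri_mul_tri (D := D) k (-1) z
        rw [neg_neg] at this
        rw [l3, hU k z hz, mul_assoc, this, mul_one]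
      rw [← hval]
      refine (l1.mul ht).congr' ?_
      filter_upwards [self_mem_nhdsWithin] with w hw
      exact (e1 k w hw).symm
    · refine (hMm k z hz).tendsto.congr' ?_
      filter_upwards [self_mem_nhdsWithin] with w hw
      exact (e2 k w hw).symm
    · refine l2.congr' ?_
      filter_upwards [self_mem_nhdsWithin, hev.filter_mono nhdsWithin_le_nhds] with w hw hw2
      refine (e3 w fun l hl => ?_).symm
      obtain rfl := hw2.1 l hl
      exact hw hl
  have c2' : ∀ k, ∀ z ∈ frontier (D.dom k), ∀ a b, ContinuousAt (fun z => M0 z a b) z :=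
    fun k z hz a b => tendsto_mat.1 (c2 k z hz) a b
  have cases_near : ∀ k w, (∀ l, w ∈ closure (D.dom l) → l = k) → w ∈ D.dom k ∨
      w ∈ frontier (D.dom k) ∨ ∀ l, w ∉ closure (D.dom l) := by
    intro k w hw
    by_cases h1 : w ∈ closure (D.dom k)
    · by_cases h2 : w ∈ D.dom k
      · exact Or.inl h2
      · refine Or.inr (Or.inl ?_)
        rw [(D.jordan k).1.frontier_eq]
        exact ⟨h1, h2⟩
    · refine Or.inr (Or.inr fun l hl => ?_)
      obtain rfl := hw l hl
      exact h1 hl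
  refine ⟨M0, fun a b z hz => DifferentiableAt.differentiableWithinAt ?_, fun k j => ?_,
    fun z hz => (e3 z hz).symm, fun k z hz => ?_⟩
  · by_cases h1 : ∃ k, z ∈ closure (D.dom k)
    · obtain ⟨k, hk⟩ := h1
      by_cases h2 : z ∈ D.dom k
      · exact d1 k z h2 hz a b
      · have hf : z ∈ frontier (D.dom k) := by
          rw [(D.jordan k).1.frontier_eq]
          exact ⟨hk, h2⟩
        have hev := eventually_near_frontier hf
        refine differentiableAt_of_frontier (D := D) (k := k) ?_ ?_
        · filter_upwards [hev] with w hw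
          rcases cases_near k w hw.1 with h | h | h
          · exact (d1 k w h hw.2 a b).continuousAt
          · exact c2' k w h a b
          · exact (d3 w h a b).continuousAt
        · filter_upwards [hev] with w hw hwf
          rcases cases_near k w hw.1 with h | h | h
          · exact d1 k w h hw.2 a b
          · exact absurd h hwf
          · exact d3 w h a b
    · push Not at h1
      exact d3 z h1 a b
  · have hp := D.mem k j
    have hMc : ∀ a b, Tendsto (fun z => M z a b) (𝓝[≠] (D.pt k j)) (𝓝 (M (D.pt k j) a b)) :=
      fun a b => (hMd _ (notMem_frontier hp) a b).continuousAt.tendsto.mono_left nhdsWithin_le_nhds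
    have hev : ∀ᶠ z in 𝓝[≠] (D.pt k j), z ∈ D.dom k :=
      Filter.Eventually.filter_mono nhdsWithin_le_nhds ((D.jordan k).1.mem_nhds hp)
    have h0 : Tendsto (fun z => z - D.pt k j) (𝓝[≠] (D.pt k j)) (𝓝 0) := by
      have : ContinuousAt (fun z => z - D.pt k j) (D.pt k j) := by fun_prop
      simpa using this.tendsto.mono_left nhdsWithin_le_nhds
    -- The triangular factor leaves column `row k` unchanged and adds to column `col k` the pole sum
    -- times that unchanged column. Since `M` is continuous at the pole, both limits are read off
    -- from its value there.
    refine ⟨M (D.pt k j) * Matrix.single (D.row k) (D.col k) (D.coef k j), ?_, ?_⟩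
    · refine tendsto_mat.2 fun a b => ?_
      simp only [mul_single_apply']
      split_ifs with hb
      · refine ((hMc a (D.row k)).mul_const _).congr' ?_
        filter_upwards [hev] with z hz
        rw [e1 k z hz, tri, mul_one_add_single, if_neg (D.row_ne_col k), add_zero]
      · exact tendsto_const_nhds
    · refine tendsto_mat.2 fun a b => ?_
      have ht : Tendsto (fun z => (z - D.pt k j) * M z a b + if b = D.col k then
          M z a (D.row k) * ((z - D.pt k j) * D.poles k z) else 0) (𝓝[≠] (D.pt k j))
          (𝓝 (0 * M (D.pt k j) a b + if b = D.col k then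
            M (D.pt k j) a (D.row k) * D.coef k j else 0)) := by
        refine (h0.mul (hMc a b)).add ?_
        split_ifs
        · exact (hMc a (D.row k)).mul (tendsto_mul_poles k j)
        · exact tendsto_const_nhds
      rw [zero_mul, zero_add, ← mul_single_apply'] at ht
      refine ht.congr' ?_
      filter_upwards [hev] with z hz
      rw [Matrix.smul_apply, e1 k z hz, tri, mul_one_add_single, smul_eq_mul]
      split_ifs <;> ring
  · have := tri_mul_tri (D := D) k 1 z
    rw [e1 k z hz, mul_assoc, this, mul_one]

/-- A solution with poles gives rise to a solution with jumps. -/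
theorem exists_jumps_of_poles {M0 : ℂ → Mat} {U : κ → ℂ → Mat}
    (hM : ∀ a b, DifferentiableOn ℂ (fun z => M0 z a b) D.poleSetᶜ)
    (hU : ∀ k, ∀ z ∈ frontier (D.dom k), U k z = D.tri k (-1) z)
    (hR : ∀ k j, HasResidueCondition M0 (D.pt k j)
        (Matrix.single (D.row k) (D.col k) (D.coef k j))) :
    ∃ M : ℂ → Mat,
      (∀ a b, DifferentiableOn ℂ (fun z => M z a b) (⋃ k, frontier (D.dom k))ᶜ) ∧
      (∀ k, HasJump M (D.dom k) (U k)) ∧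
      (∀ z, (∀ k, z ∉ closure (D.dom k)) → M z = M0 z) ∧
      ∀ k, ∀ z ∈ D.dom k, z ∉ D.poleSet → M z = M0 z * D.tri k (-1) z := by
  classical
  -- The product is singular only at the poles, and removably so; `fillIn` supplies its values
  -- there.
  let M : ℂ → Mat := fun z => if h : ∃ k, z ∈ D.dom k then
    Matrix.of fun a b => fillIn (fun w => (M0 w * D.tri h.choose (-1) w) a b) z else M0 z
  have e1 : ∀ k, ∀ z ∈ D.dom k, ∀ a b,
      M z a b = fillIn (fun w => (M0 w * D.tri k (-1) w) a b) z := by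
    intro k z hz a b
    have h : ∃ k, z ∈ D.dom k := ⟨k, hz⟩
    have hk : h.choose = k :=
      eq_of_mem_closure (subset_closure h.choose_spec) (subset_closure hz)
    simp only [M, dif_pos h, hk, Matrix.of_apply]
  have e3 : ∀ z, (∀ k, z ∉ D.dom k) → M z = M0 z := by
    intro z hz
    have h : ¬∃ k, z ∈ D.dom k := fun ⟨l, hl⟩ => hz l hl
    simp only [M, dif_neg h]
  have hMd : ∀ z, z ∉ D.poleSet → ∀ a b, DifferentiableAt ℂ (fun z => M0 z a b) z :=
    fun z hz a b => (hM a b).differentiableAt (finite_poleSet.isClosed.isOpen_compl.mem_nhds hz)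
  have dT : ∀ k z, z ∉ D.poleSet → ∀ a b,
      DifferentiableAt ℂ (fun w => (M0 w * D.tri k (-1) w) a b) z := fun k z hz a b =>
    differentiableAt_mul_tri (hMd z hz) hz k (-1) a b
  have e1' : ∀ k, ∀ z ∈ D.dom k, z ∉ D.poleSet → M z = M0 z * D.tri k (-1) z := by
    intro k z hz hzp
    ext a b
    rw [e1 k z hz, fillIn_eq_of_continuousAt (dT k z hzp a b).continuousAt]
  have hfr : ∀ k, ∀ z ∈ frontier (D.dom k), z ∉ D.poleSet := fun k z hz =>
    (eventually_near_frontier hz).self_of_nhds.2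
  refine ⟨M, fun a b z hz => DifferentiableAt.differentiableWithinAt ?_, fun k => ?_,
    fun z hz => e3 z fun k hk => hz k (subset_closure hk), e1'⟩
  · by_cases h : ∃ k, z ∈ D.dom k
    · obtain ⟨k, hk⟩ := h
      have hpt : ∀ᶠ w in 𝓝[≠] z, w ∉ D.poleSet := eventually_notMem_of_finite finite_poleSet z
      refine DifferentiableAt.congr_of_eventuallyEq (differentiableAt_fillIn
        (f := fun w => (M0 w * D.tri k (-1) w) a b) (hpt.mono fun w hw => dT k w hw a b) ?_)
        (mem_of_superset ((D.jordan k).1.mem_nhds hk) fun w hw => e1 k w hw a b)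
      by_cases hzp : z ∈ D.poleSet
      · obtain ⟨l, j, rfl⟩ := hzp
        obtain rfl : l = k := eq_of_mem_closure (subset_closure (D.mem l j)) (subset_closure hk)
        obtain ⟨A, h1, h2⟩ := hR l j
        rw [tendsto_mat] at h1 h2
        simp only [mul_single_apply'] at h1
        simp only [Matrix.smul_apply, smul_eq_mul] at h2
        -- Column `row l` of the residue vanishes, so that column of `M0` extends across the pole.
        -- Its limit times the coefficient is the residue of the other column, which the pole sum
        -- therefore cancels.
        have hA : A a (D.row l) = 0 := by
          have := h1 a (D.row l)
          simp only [if_neg (D.row_ne_col l)] at this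
          exact tendsto_nhds_unique this tendsto_const_nhds
        have h3 := h2 a (D.row l)
        rw [hA] at h3
        simp only [tri, mul_one_add_single]
        split_ifs with hb
        · have h4 := tendsto_fillIn (f := fun z => M0 z a (D.row l))
            (hpt.mono fun w hw => hMd w hw a _) h3
          have h5 := h1 a (D.col l)
          simp only [if_true] at h5
          have h6 := tendsto_nhds_unique h5 (h4.mul_const (D.coef l j))
          have h7 := (h2 a (D.col l)).sub (h4.mul (tendsto_mul_poles l j))
          rw [h6, sub_self] at h7
          refine h7.congr fun w => ?_
          rw [hb]
          ring
        · have hbr : b = D.row l := by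
            have := D.row_ne_col l
            omega
          rw [hbr]
          simpa using h3
      · exact tendsto_mul_of_differentiableAt (dT k z hzp a b).continuousAt
    · push Not at h
      have hz' : ∀ k, z ∉ closure (D.dom k) := fun k hk => hz (mem_iUnion.2 ⟨k, by
        rw [(D.jordan k).1.frontier_eq]
        exact ⟨hk, h k⟩⟩)
      have hzp : z ∉ D.poleSet := by
        rintro ⟨l, j, rfl⟩
        exact h l (D.mem l j)
      refine (hMd z hzp a b).congr_of_eventuallyEq
        (mem_of_superset (isOpen_outside.mem_nhds hz') fun w hw => ?_)
      have := e3 w fun k hk => hw k (subset_closure hk)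
      simp only [mem_ofPred_eq, this]
  · refine ⟨fun z => M0 z * D.tri k (-1) z, M0, fun z hz => ?_, fun z hz => ?_, fun z hz =>
      ⟨?_, ?_, by rw [hU k z hz]⟩⟩
    · exact (tendsto_mat.2 fun a b => (dT k z (hfr k z hz) a b).continuousAt.tendsto).mono_left
        nhdsWithin_le_nhds
    · exact (tendsto_mat.2 fun a b => (hMd z (hfr k z hz) a b).continuousAt.tendsto).mono_left
        nhdsWithin_le_nhds
    · refine ((tendsto_mat.2 fun a b =>
        (dT k z (hfr k z hz) a b).continuousAt.tendsto).mono_left nhdsWithin_le_nhds).congr' ?_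
      filter_upwards [self_mem_nhdsWithin,
        (eventually_near_frontier hz).filter_mono nhdsWithin_le_nhds] with w hw hw2
      exact (e1' k w hw hw2.2).symm
    · refine ((tendsto_mat.2 fun a b =>
        (hMd z (hfr k z hz) a b).continuousAt.tendsto).mono_left nhdsWithin_le_nhds).congr' ?_
      filter_upwards [self_mem_nhdsWithin,
        (eventually_near_frontier hz).filter_mono nhdsWithin_le_nhds] with w hw hw2
      refine (e3 w fun l hl => ?_).symm
      obtain rfl := hw2.1 l (subset_closure hl)
      exact hw (subset_closure hl)

end PoleContours

end

section

/-! ### The soliton problem and the problem with jumps -/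

theorem upperPole_injOn {z w : ℂ} {k : Fin 4} (h : upperPole z k = upperPole w k) : z = w := by
  fin_cases k <;> first
    | simpa [upperPole, neg_div] using h
    | exact (starRingEnd ℂ).injective (by simpa [upperPole, neg_div] using h)

theorem lowerPole_injOn {z w : ℂ} {k : Fin 4} (h : lowerPole z k = lowerPole w k) : z = w := by
  fin_cases k <;> first
    | simpa [lowerPole, neg_div] using h
    | exact (starRingEnd ℂ).injective (by simpa [lowerPole, neg_div] using h)

variable {n : ℕ} {s₁ s₂ : ℂ} {s₃ : ℝ} {Gp Gm : Fin 4 → Set ℂ} {ζ : Fin n → ℂ}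

/-- The eight contours, with the poles of the soliton problem. -/
def poleContours (hG : IsContourSystem n s₁ s₂ s₃ Gp Gm) (hinj : Function.Injective ζ)
    (hmem : ∀ j, ζ j ∈ quadDomain n s₁ s₂ s₃) (c : Fin n → ℂ) (y t : ℝ) :
    PoleContours (Fin 4 ⊕ Fin 4) (Fin n) where
  dom := Sum.elim Gp Gm
  pt := Sum.elim (fun k j => upperPole (ζ j) k) (fun k j => lowerPole (ζ j) k)
  coef := Sum.elim
    (fun k j => upperConst (c j) (ζ j) k *
      Complex.exp (-2 * Complex.I * theta y t (upperPole (ζ j) k)))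
    (fun k j => lowerConst (c j) (ζ j) k *
      Complex.exp (2 * Complex.I * theta y t (lowerPole (ζ j) k)))
  row := Sum.elim (fun _ => 1) (fun _ => 0)
  col := Sum.elim (fun _ => 0) (fun _ => 1)
  row_ne_col := by rintro (k | k) <;> simp
  jordan := by
    rintro (k | k)
    · exact hG.jordan_upper k
    · exact hG.jordan_lower k
  mem := by
    rintro (k | k) j
    · exact hG.subset_upper k ⟨_, subset_closure (hmem j), rfl⟩
    · exact hG.subset_lower k ⟨_, subset_closure (hmem j), rfl⟩
  injective := by
    rintro (k | k) i j h
    · exact hinj (upperPole_injOn h)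
    · exact hinj (lowerPole_injOn h)
  disjoint := by
    rintro (k | k) (l | l) h
    · exact hG.disjoint_upper k l fun e => h (by rw [e])
    · exact hG.disjoint_cross k l
    · exact (hG.disjoint_cross l k).symm
    · exact hG.disjoint_lower k l fun e => h (by rw [e])

variable (hG : IsContourSystem n s₁ s₂ s₃ Gp Gm) (hinj : Function.Injective ζ)
    (hmem : ∀ j, ζ j ∈ quadDomain n s₁ s₂ s₃) (c : Fin n → ℂ) (y t : ℝ)

theorem poleSet_poleContours : (poleContours hG hinj hmem c y t).poleSet = spectrumSet ζ := by
  ext z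
  constructor
  · rintro ⟨k | k, j, rfl⟩
    · exact ⟨j, k, Or.inl rfl⟩
    · exact ⟨j, k, Or.inr rfl⟩
  · rintro ⟨j, k, rfl | rfl⟩
    · exact ⟨Sum.inl k, j, rfl⟩
    · exact ⟨Sum.inr k, j, rfl⟩

theorem tri_inl (k : Fin 4) (z : ℂ) : (poleContours hG hinj hmem c y t).tri (Sum.inl k) (-1) z =
    !![1, 0; -upperPoleSum ζ c y t k z, 1] := by
  have h : (poleContours hG hinj hmem c y t).poles (Sum.inl k) z = upperPoleSum ζ c y t k z := rfl
  ext a b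
  fin_cases a <;> fin_cases b <;> simp [PoleContours.tri, h] <;> simp [poleContours]

theorem tri_inr (k : Fin 4) (z : ℂ) : (poleContours hG hinj hmem c y t).tri (Sum.inr k) (-1) z =
    !![1, -lowerPoleSum ζ c y t k z; 0, 1] := by
  have h : (poleContours hG hinj hmem c y t).poles (Sum.inr k) z = lowerPoleSum ζ c y t k z := rfl
  ext a b
  fin_cases a <;> fin_cases b <;> simp [PoleContours.tri, h] <;> simp [poleContours]

theorem single_inl (k : Fin 4) (j : Fin n) :
    Matrix.single ((poleContours hG hinj hmem c y t).row (Sum.inl k))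
      ((poleContours hG hinj hmem c y t).col (Sum.inl k))
      ((poleContours hG hinj hmem c y t).coef (Sum.inl k) j) =
    !![0, 0; upperConst (c j) (ζ j) k *
      Complex.exp (-2 * Complex.I * theta y t (upperPole (ζ j) k)), 0] := by
  ext a b
  fin_cases a <;> fin_cases b <;> simp [poleContours]

theorem single_inr (k : Fin 4) (j : Fin n) :
    Matrix.single ((poleContours hG hinj hmem c y t).row (Sum.inr k))
      ((poleContours hG hinj hmem c y t).col (Sum.inr k))
      ((poleContours hG hinj hmem c y t).coef (Sum.inr k) j) =
    !![0, lowerConst (c j) (ζ j) k *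
      Complex.exp (2 * Complex.I * theta y t (lowerPole (ζ j) k)); 0, 0] := by
  ext a b
  fin_cases a <;> fin_cases b <;> simp [poleContours]

theorem iUnion_frontier_poleContours :
    (⋃ k, frontier ((poleContours hG hinj hmem c y t).dom k)) =
      (⋃ k, frontier (Gp k)) ∪ ⋃ k, frontier (Gm k) := by
  rw [iUnion_sum]
  rfl

theorem NormalizedAtInfinity.congr {M M' : ℂ → Mat} (h : NormalizedAtInfinity M)
    (he : ∀ᶠ z in Bornology.cobounded ℂ, M z = M' z) : NormalizedAtInfinity M' := fun a b =>
  (h a b).congr' (he.mono fun z hz => by simp only [hz]) EventuallyEq.rfl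

theorem NormalizedAtI.congr {M M' : ℂ → Mat} (h : NormalizedAtI M)
    (he : ∀ᶠ z in 𝓝 Complex.I, M z = M' z) : NormalizedAtI M' := by
  obtain ⟨m, x, μ, hO⟩ := h
  exact ⟨m, x, μ, fun a b => (hO a b).congr' (he.mono fun z hz => by simp only [hz]) EventuallyEq.rfl⟩

include hG in
theorem eventually_outside_infinity : ∀ᶠ z in Bornology.cobounded ℂ,
    (∀ k, z ∉ closure (Gp k)) ∧ ∀ k, z ∉ closure (Gm k) := by
  refine Eventually.and ?_ ?_ <;> refine eventually_all.2 fun k => ?_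
  · exact Bornology.isBounded_def.1 (hG.jordan_upper k).2.2.1.closure
  · exact Bornology.isBounded_def.1 (hG.jordan_lower k).2.2.1.closure

include hG in
theorem eventually_outside_I : ∀ᶠ z in 𝓝 Complex.I,
    (∀ k, z ∉ closure (Gp k)) ∧ ∀ k, z ∉ closure (Gm k) := by
  refine Eventually.and ?_ ?_ <;> refine eventually_all.2 fun k => ?_
  · exact isClosed_closure.isOpen_compl.mem_nhds (hG.I_notMem_upper k)
  · exact isClosed_closure.isOpen_compl.mem_nhds (hG.I_notMem_lower k)

/-- On the contours the jump functions are sums of poles. -/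
def JumpsArePoleSums (r₁ : ℂ → ℂ) (s₁ s₂ : ℂ) (s₃ : ℝ) (Gp Gm : Fin 4 → Set ℂ) (ζ c : Fin n → ℂ)
    (y t : ℝ) : Prop :=
  ∀ k, (∀ z ∈ frontier (Gp k), upperJump n s₁ s₂ s₃ r₁ y t z k = -upperPoleSum ζ c y t k z) ∧
    ∀ z ∈ frontier (Gm k), lowerJump n s₁ s₂ s₃ r₁ y t z k = -lowerPoleSum ζ c y t k z

/-- The jump matrices on the eight contours. -/
def jumpMatrix (n : ℕ) (s₁ s₂ : ℂ) (s₃ : ℝ) (r₁ : ℂ → ℂ) (y t : ℝ) (k : Fin 4 ⊕ Fin 4) (z : ℂ) :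
    Mat :=
  Sum.elim (fun k => !![1, 0; upperJump n s₁ s₂ s₃ r₁ y t z k, 1])
    (fun k => !![1, lowerJump n s₁ s₂ s₃ r₁ y t z k; 0, 1]) k

variable {c y t} {r₁ : ℂ → ℂ}

theorem jumpMatrix_eq_tri (hJ : JumpsArePoleSums r₁ s₁ s₂ s₃ Gp Gm ζ c y t) (k : Fin 4 ⊕ Fin 4) :
    ∀ z ∈ frontier ((poleContours hG hinj hmem c y t).dom k), jumpMatrix n s₁ s₂ s₃ r₁ y t k z =
      (poleContours hG hinj hmem c y t).tri k (-1) z := by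
  intro z hz
  rcases k with k | k
  · rw [tri_inl, jumpMatrix, Sum.elim_inl, (hJ k).1 z hz]
  · rw [tri_inr, jumpMatrix, Sum.elim_inr, (hJ k).2 z hz]

include hG hinj hmem in
theorem IsLimitRH.exists_isSolitonRH (hJ : JumpsArePoleSums r₁ s₁ s₂ s₃ Gp Gm ζ c y t)
    {M : ℂ → Mat} (hM : IsLimitRH n s₁ s₂ s₃ r₁ Gp Gm y t M) :
    ∃ M0 : ℂ → Mat, IsSolitonRH ζ c y t M0 ∧ IsInterpolation ζ c Gp Gm y t M0 M := by
  obtain ⟨M0, h1, h2, h3, h4⟩ := (poleContours hG hinj hmem c y t).exists_poles_of_jumps (M := M)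
    (U := jumpMatrix n s₁ s₂ s₃ r₁ y t)
    (fun a b => by rw [iUnion_frontier_poleContours]; exact hM.analytic a b)
    (jumpMatrix_eq_tri hG hinj hmem hJ)
    (by
      rintro (k | k)
      · exact hM.jump_upper k
      · exact hM.jump_lower k)
  rw [poleSet_poleContours] at h1
  have hout : ∀ z, (∀ k, z ∉ closure (Gp k)) → (∀ k, z ∉ closure (Gm k)) → M z = M0 z :=
    fun z hp hm => h3 z (by
      rintro (k | k)
      · exact hp k
      · exact hm k)
  refine ⟨M0, ⟨h1, fun j k => ?_, fun j k => ?_, ?_, ?_⟩, ⟨hout, fun k z hz _ => ?_,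
    fun k z hz _ => ?_⟩⟩
  · rw [← single_inl hG hinj hmem]
    exact h2 (Sum.inl k) j
  · rw [← single_inr hG hinj hmem]
    exact h2 (Sum.inr k) j
  · exact hM.norm_infinity.congr ((eventually_outside_infinity hG).mono fun z hz =>
      hout z hz.1 hz.2)
  · exact hM.norm_I.congr ((eventually_outside_I hG).mono fun z hz => hout z hz.1 hz.2)
  · rw [← tri_inl hG hinj hmem]
    exact h4 (Sum.inl k) z hz
  · rw [← tri_inr hG hinj hmem]
    exact h4 (Sum.inr k) z hz

include hG hinj hmem in
theorem IsSolitonRH.exists_isLimitRH (hJ : JumpsArePoleSums r₁ s₁ s₂ s₃ Gp Gm ζ c y t)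
    {M0 : ℂ → Mat} (hM : IsSolitonRH ζ c y t M0) :
    ∃ M : ℂ → Mat, IsLimitRH n s₁ s₂ s₃ r₁ Gp Gm y t M ∧ IsInterpolation ζ c Gp Gm y t M0 M := by
  obtain ⟨M, h1, h2, h3, h4⟩ := (poleContours hG hinj hmem c y t).exists_jumps_of_poles (M0 := M0)
    (U := jumpMatrix n s₁ s₂ s₃ r₁ y t)
    (fun a b => by rw [poleSet_poleContours]; exact hM.analytic a b)
    (jumpMatrix_eq_tri hG hinj hmem hJ)
    (by
      rintro (k | k) j
      · rw [single_inl]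
        exact hM.residue_upper j k
      · rw [single_inr]
        exact hM.residue_lower j k)
  rw [iUnion_frontier_poleContours] at h1
  rw [poleSet_poleContours] at h4
  have hout : ∀ z, (∀ k, z ∉ closure (Gp k)) → (∀ k, z ∉ closure (Gm k)) → M z = M0 z :=
    fun z hp hm => h3 z (by
      rintro (k | k)
      · exact hp k
      · exact hm k)
  refine ⟨M, ⟨h1, fun k => h2 (Sum.inl k), fun k => h2 (Sum.inr k), ?_, ?_⟩,
    ⟨hout, fun k z hz hzp => ?_, fun k z hz hzp => ?_⟩⟩
  · exact hM.norm_infinity.congr ((eventually_outside_infinity hG).mono fun z hz =>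
      (hout z hz.1 hz.2).symm)
  · exact hM.norm_I.congr ((eventually_outside_I hG).mono fun z hz => (hout z hz.1 hz.2).symm)
  · rw [← tri_inl hG hinj hmem]
    exact h4 (Sum.inl k) z hz hzp
  · rw [← tri_inr hG hinj hmem]
    exact h4 (Sum.inr k) z hz hzp

end

section

open MeasureTheory

/-! ### Sums over roots -/

section Roots

variable {n : ℕ} {η : ℂ}

theorem exists_eq_pow_mul (hn : 0 < n) (hη : IsPrimitiveRoot η n) {x y : ℂ} (h : y ^ n = x ^ n) :
    ∃ m : Fin n, y = η ^ (m : ℕ) * x := by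
  have hy : y ∈ Polynomial.nthRoots n (x ^ n) := (Polynomial.mem_nthRoots hn).2 h
  rw [hη.nthRoots_eq rfl, Multiset.mem_map] at hy
  obtain ⟨m, hm, rfl⟩ := hy
  exact ⟨⟨m, Multiset.mem_range.1 hm⟩, rfl⟩

/-- A sum over `n` distinct `n`-th roots. -/
theorem sum_eq_sum_pow_mul (hn : 0 < n) (hη : IsPrimitiveRoot η n) {x : ℂ} {y : Fin n → ℂ}
    (hy : Function.Injective y) (h : ∀ j, y j ^ n = x ^ n) (f : ℂ → ℂ) :
    ∑ j, f (y j) = ∑ j : Fin n, f (η ^ (j : ℕ) * x) := by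
  choose m hm using fun j => exists_eq_pow_mul hn hη (h j)
  have hinj : Function.Injective m := fun i j hij => hy (by rw [hm i, hm j, hij])
  rw [← (Equiv.ofBijective m (Finite.injective_iff_bijective.1 hinj)).sum_comp
    fun j : Fin n => f (η ^ (j : ℕ) * x)]
  exact Finset.sum_congr rfl fun j _ => by rw [hm j]; rfl

theorem pow_mul_injective (hη : IsPrimitiveRoot η n) {y : ℂ} (hy : y ≠ 0) :
    Function.Injective fun j : Fin n => η ^ (j : ℕ) * y := fun i j hij =>
  Fin.ext (hη.pow_inj i.2 j.2 (mul_right_cancel₀ hy hij))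

theorem pow_mul_pow (hη : IsPrimitiveRoot η n) (j : ℕ) (y : ℂ) : (η ^ j * y) ^ n = y ^ n := by
  rw [mul_pow, ← pow_mul, mul_comm j, pow_mul, hη.pow_eq_one, one_pow, one_mul]

/-- The symmetric sum does not depend on the chosen root. At `0` all roots coincide, so injectivity
fails and the case is separate. -/
theorem sum_pow_mul_eq (hn : 0 < n) (hη : IsPrimitiveRoot η n) {x y : ℂ} (h : y ^ n = x ^ n)
    (f : ℂ → ℂ) : ∑ j : Fin n, f (η ^ (j : ℕ) * y) = ∑ j : Fin n, f (η ^ (j : ℕ) * x) := by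
  rcases eq_or_ne y 0 with rfl | hy
  · rw [zero_pow hn.ne', eq_comm, pow_eq_zero_iff hn.ne'] at h
    rw [h]
  · exact sum_eq_sum_pow_mul hn hη (pow_mul_injective hη hy)
      (fun j => (pow_mul_pow hη j y).trans h) f

/-- The nodal polynomial of the `ζ_j` is `(X - s₁)ⁿ - s₂`: both are monic of degree `n` and agree at
`n` points. The product is its derivative at `ζ_j`. -/
theorem prod_erase_sub {s₁ s₂ : ℂ} {ζ : Fin n → ℂ} (hinj : Function.Injective ζ)
    (hζ : ∀ j, (ζ j - s₁) ^ n = s₂) (j : Fin n) :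
    ∏ k ∈ Finset.univ.erase j, (ζ j - ζ k) = n * (ζ j - s₁) ^ (n - 1) := by
  have hn : 0 < n := j.pos
  open Polynomial in
  have h : Lagrange.nodal Finset.univ ζ = (X - C s₁) ^ n - C s₂ := by
    have hm : ((X - C s₁) ^ n : ℂ[X]).Monic := (monic_X_sub_C s₁).pow n
    have hd : ((X - C s₁) ^ n : ℂ[X]).degree = n := by
      rw [degree_pow, degree_X_sub_C, nsmul_eq_mul, mul_one]
    have hlt : (C s₂ : ℂ[X]).degree < ((X - C s₁) ^ n : ℂ[X]).degree := by
      rw [hd]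
      exact degree_C_le.trans_lt (by exact_mod_cast hn)
    have hm2 : ((X - C s₁) ^ n - C s₂ : ℂ[X]).Monic := hm.sub_of_left hlt
    have hd2 : ((X - C s₁) ^ n - C s₂ : ℂ[X]).degree = n := by
      rw [degree_sub_eq_left_of_degree_lt hlt, hd]
    have hN : (Lagrange.nodal Finset.univ ζ : ℂ[X]).degree = n := by
      simp [Lagrange.degree_nodal]
    refine eq_of_degree_sub_lt_of_eval_index_eq (s := Finset.univ) (v := ζ) hinj.injOn ?_ fun i hi => ?_
    · have := degree_sub_lt_left (hN.trans hd2.symm) Lagrange.nodal_ne_zero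
        (Lagrange.nodal_monic.leadingCoeff.trans hm2.leadingCoeff.symm)
      rw [hN] at this
      simpa using this
    · rw [Lagrange.eval_nodal_at_node hi]
      simp [hζ i]
  have h1 := Lagrange.eval_nodal_derivative_eval_node_eq (s := Finset.univ) (v := ζ)
    (Finset.mem_univ j)
  rw [Lagrange.eval_nodal] at h1
  rw [← h1, h]
  simp [Polynomial.derivative_pow]

end Roots

/-! ### An integrable weight -/

theorem intervalIntegrable_abs_rpow {a : ℝ} (ha : a < 1) (b : ℝ) (hb : 0 ≤ b) :
    IntervalIntegrable (fun x : ℝ => |x| ^ (-a)) volume (-b) b := by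
  have h1 : IntervalIntegrable (fun x : ℝ => |x| ^ (-a)) volume 0 b := by
    refine (intervalIntegral.intervalIntegrable_rpow' (r := -a) (by linarith)).congr fun x hx => ?_
    rw [uIoc_of_le hb] at hx
    simp only [abs_of_pos hx.1]
  have h2 : IntervalIntegrable (fun x : ℝ => |x| ^ (-a)) volume (-b) 0 := by
    have := (IntervalIntegrable.iff_comp_neg (f := fun x : ℝ => |x| ^ (-a)) (a := 0) (b := b)).1 h1
    simpa using this.symm
  exact h2.trans h1

/-- Jordan's inequality `|sin x| ≥ (2/π)|x|` handles one period of `|sin|`, and periodicity the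
rest. -/
theorem intervalIntegrable_abs_sin_rpow {a : ℝ} (ha0 : 0 ≤ a) (ha : a < 1) (α b c : ℝ) :
    IntervalIntegrable (fun x : ℝ => |Real.sin (x - α)| ^ (-a)) volume b c := by
  have hper : Function.Periodic (fun x : ℝ => |Real.sin x| ^ (-a)) Real.pi := fun x => by
    simp [Real.sin_add_pi]
  have hπ := Real.pi_pos
  have h1 : IntervalIntegrable (fun x : ℝ => |Real.sin x| ^ (-a)) volume (-(Real.pi / 2))
      (-(Real.pi / 2) + Real.pi) := by
    rw [show -(Real.pi / 2) + Real.pi = Real.pi / 2 by ring]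
    refine ((intervalIntegrable_abs_rpow ha (Real.pi / 2) (by positivity)).const_mul
      ((2 / Real.pi) ^ (-a))).mono_fun ?_ ?_
    · exact (Measurable.aestronglyMeasurable (by fun_prop))
    · refine (ae_restrict_iff' measurableSet_uIoc).2 (Eventually.of_forall fun x hx => ?_)
      rw [uIoc_of_le (by linarith)] at hx
      have hx' : |x| ≤ Real.pi / 2 := abs_le.2 ⟨hx.1.le, hx.2⟩
      beta_reduce
      rw [Real.norm_of_nonneg (by positivity), Real.norm_of_nonneg (by positivity),
        ← Real.mul_rpow (by positivity) (abs_nonneg x)]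
      rcases eq_or_ne x 0 with rfl | hx0
      · simp
      · exact Real.rpow_le_rpow_of_nonpos (by positivity) (Real.mul_abs_le_abs_sin hx') (by linarith)
  have h2 := hper.intervalIntegrable hπ.ne' h1 (b - α) (c - α)
  exact (h2.comp_sub_right α).mono_set (by simp)

/-- Along the circles around `s₂` the function `‖w‖ ^ (-a)` has an integrable majorant. -/
theorem exists_weight {a : ℝ} (ha0 : 0 ≤ a) (ha : a < 1) {s₂ : ℂ} (hs : s₂ ≠ 0 ∨ a = 0) (b c : ℝ) :
    ∃ κ : ℝ → ℝ, IntervalIntegrable κ volume b c ∧ ∀ᵐ φ : ℝ, ∀ ρ : ℝ, 0 < ρ →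
      s₂ + ρ * Complex.exp (Complex.I * φ) ≠ 0 ∧
      ‖s₂ + ρ * Complex.exp (Complex.I * φ)‖ ^ (-a) ≤ κ φ := by
  rcases eq_or_ne s₂ 0 with rfl | hs0
  · refine ⟨fun _ => 1, intervalIntegrable_const, Eventually.of_forall fun φ ρ hρ => ⟨?_, ?_⟩⟩
    · rw [zero_add]
      exact mul_ne_zero (by exact_mod_cast hρ.ne') (Complex.exp_ne_zero _)
    · simp [hs.resolve_left (by simp)]
  · set α := s₂.arg with hα
    refine ⟨fun φ => ‖s₂‖ ^ (-a) * |Real.sin (φ - α)| ^ (-a),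
      (intervalIntegrable_abs_sin_rpow ha0 ha α b c).const_mul _, ?_⟩
    have hnull : ∀ᵐ φ : ℝ, Real.sin (φ - α) ≠ 0 := by
      have hc : {φ : ℝ | Real.sin (φ - α) = 0} ⊆ range fun k : ℤ => (k : ℝ) * Real.pi + α := by
        intro φ hφ
        obtain ⟨k, hk⟩ := Real.sin_eq_zero_iff.1 hφ
        exact ⟨k, by simp only; linarith⟩
      have := ((countable_range fun k : ℤ => (k : ℝ) * Real.pi + α).mono hc).measure_zero volume
      rw [ae_iff]
      simpa using this
    filter_upwards [hnull] with φ hφ ρ hρ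
    -- For fixed `φ` the points lie on a ray from `s₂`, and the bound is the distance of its line
    -- from `0`. It does not involve `ρ`, which makes the majorant uniform in the radius.
    have hle : ‖s₂‖ * |Real.sin (φ - α)| ≤ ‖s₂ + ρ * Complex.exp (Complex.I * φ)‖ := by
      have e1 : s₂ + ρ * Complex.exp (Complex.I * φ) = Complex.exp (Complex.I * φ) *
          (‖s₂‖ * Complex.exp ((α - φ : ℝ) * Complex.I) + ρ) := by
        have e2 : Complex.exp (Complex.I * φ) * Complex.exp ((α - φ : ℝ) * Complex.I) =
            Complex.exp (α * Complex.I) := by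
          rw [← Complex.exp_add]
          congr 1
          push_cast
          ring
        conv_lhs => rw [← Complex.norm_mul_exp_arg_mul_I s₂]
        rw [← hα, ← e2]
        ring
      rw [e1, norm_mul, mul_comm Complex.I, Complex.norm_exp_ofReal_mul_I, one_mul]
      refine le_trans ?_ (Complex.abs_im_le_norm _)
      rw [Complex.add_im, Complex.ofReal_im, add_zero, Complex.im_ofReal_mul,
        Complex.exp_ofReal_mul_I_im, abs_mul, abs_norm, ← neg_sub φ α, Real.sin_neg, abs_neg]
    have hpos : 0 < ‖s₂‖ * |Real.sin (φ - α)| := mul_pos (norm_pos_iff.2 hs0) (abs_pos.2 hφ)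
    refine ⟨norm_pos_iff.1 (hpos.trans_le hle), ?_⟩
    rw [← Real.mul_rpow (norm_nonneg _) (abs_nonneg _)]
    exact Real.rpow_le_rpow_of_nonpos hpos hle (by linarith)

/-! ### The quadrature domain and its boundary arcs -/

section Quad

variable {n : ℕ} {s₁ s₂ : ℂ} {s₃ : ℝ}

theorem isOpen_quadDomain : IsOpen (quadDomain n s₁ s₂ s₃) := by
  have : Continuous fun z : ℂ => ‖(z - s₁) ^ n - s₂‖ := by fun_prop
  exact isOpen_lt this continuous_const

/-- The nontrivial direction uses that `z ↦ (z - s₁)ⁿ` is open: preimages of closures then lie in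
closures of preimages. -/
theorem mem_closure_quadDomain (hn : 0 < n) (hs₃ : 0 < s₃) {z : ℂ} :
    z ∈ closure (quadDomain n s₁ s₂ s₃) ↔ ‖(z - s₁) ^ n - s₂‖ ≤ s₃ := by
  have hcont : Continuous fun z : ℂ => (z - s₁) ^ n := by fun_prop
  have hpre : quadDomain n s₁ s₂ s₃ = (fun z : ℂ => (z - s₁) ^ n) ⁻¹' Metric.ball s₂ s₃ := by
    ext w
    simp [quadDomain, dist_eq_norm]
  constructor
  · intro h
    have hc : Continuous fun z : ℂ => ‖(z - s₁) ^ n - s₂‖ := by fun_prop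
    have hsub : quadDomain n s₁ s₂ s₃ ⊆ {z | ‖(z - s₁) ^ n - s₂‖ ≤ s₃} := fun w hw => by
      simp only [quadDomain, mem_ofPred_eq] at hw ⊢
      exact hw.le
    exact closure_minimal hsub (isClosed_le hc continuous_const) h
  · intro h
    have hopen : IsOpenMap fun z : ℂ => (z - s₁) ^ n := by
      have han : AnalyticOnNhd ℂ (fun z : ℂ => (z - s₁) ^ n) univ := fun z _ => by fun_prop
      refine han.is_constant_or_isOpenMap.resolve_left ?_
      rintro ⟨c, hc⟩
      have h1 := hc s₁
      have h2 := hc (s₁ + 1)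
      rw [sub_self, zero_pow hn.ne'] at h1
      rw [add_sub_cancel_left, one_pow, ← h1] at h2
      exact one_ne_zero h2
    rw [hpre]
    refine hopen.preimage_closure_subset_closure_preimage ?_
    rw [closure_ball s₂ hs₃.ne']
    simpa [dist_eq_norm] using h

theorem isCompact_closure_quadDomain (hn : 0 < n) (hs₃ : 0 < s₃) :
    IsCompact (closure (quadDomain n s₁ s₂ s₃)) := by
  refine Metric.isCompact_of_isClosed_isBounded isClosed_closure ?_
  refine (Metric.isBounded_closedBall (x := s₁) (r := 1 + (‖s₂‖ + s₃))).subset fun z hz => ?_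
  rw [mem_closure_quadDomain hn hs₃] at hz
  rw [Metric.mem_closedBall, dist_eq_norm]
  have h1 : ‖z - s₁‖ ^ n ≤ ‖s₂‖ + s₃ := by
    rw [← norm_pow]
    have := norm_le_norm_add_norm_sub' ((z - s₁) ^ n) s₂
    linarith
  rcases le_total ‖z - s₁‖ 1 with h | h
  · have := norm_nonneg s₂
    linarith
  · have := le_self_pow₀ h hn.ne'
    linarith

/-- The closed unit disc around `1` meets the branch cut only at `0`. So the principal root in a
boundary arc fails to be smooth only where the arc passes through `s₁`. -/
theorem one_add_mem_slitPlane {u : ℂ} (hu : ‖u‖ ≤ 1) (h0 : 1 + u ≠ 0) : 1 + u ∈ Complex.slitPlane := by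
  rw [Complex.mem_slitPlane_iff]
  by_contra! h
  have h1 : (1 + u).re = 1 + u.re := by simp
  have h2 : (1 + u).im = u.im := by simp
  rw [h1, h2] at h
  have h3 := (abs_le.1 ((Complex.abs_re_le_norm u).trans hu)).1
  have h4 : u.re = -1 := by linarith [h.1]
  exact h0 (Complex.ext (by simp [h4]) (by simp [h.2]))

/-- The boundary arcs are differentiable off the branch point. -/
theorem differentiableAt_boundaryArc (hs₃ : 0 < s₃) (j : Fin n) {φ : ℝ}
    (h : s₂ + s₃ * Complex.exp (Complex.I * φ) ≠ 0) :
    DifferentiableAt ℝ (boundaryArc n s₁ s₂ s₃ j) φ := by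
  have h3 : (s₃ : ℂ) ≠ 0 := by exact_mod_cast hs₃.ne'
  have hexp : Complex.exp (Complex.I * φ) ≠ 0 := Complex.exp_ne_zero _
  have hco : DifferentiableAt ℝ (fun φ : ℝ => (φ : ℂ)) φ := Complex.ofRealCLM.differentiableAt
  have hnorm : ‖Complex.exp (Complex.I * φ)‖ = 1 := by
    rw [mul_comm, Complex.norm_exp_ofReal_mul_I]
  have hE : ∀ k : ℂ, DifferentiableAt ℝ (fun φ : ℝ => Complex.exp (k * φ)) φ := fun k =>
    (hco.const_mul k).cexp
  have pw : ∀ {f : ℝ → ℂ}, DifferentiableAt ℝ f φ → f φ ∈ Complex.slitPlane →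
      DifferentiableAt ℝ (fun φ => f φ ^ ((n : ℂ)⁻¹)) φ := fun {f} hf hm => by
    have := ((hasDerivAt_id (f φ)).cpow_const (c := (n : ℂ)⁻¹) hm).differentiableAt
    exact (this.restrictScalars ℝ).comp φ hf
  unfold boundaryArc
  split_ifs with hle
  · have e1 : 1 + s₂ / s₃ * Complex.exp (-(Complex.I * φ)) ∈ Complex.slitPlane := by
      refine one_add_mem_slitPlane ?_ fun h0 => h ?_
      · rw [norm_mul, Complex.exp_neg, norm_inv, hnorm, inv_one, mul_one, norm_div,
          Complex.norm_real, Real.norm_of_nonneg hs₃.le]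
        exact (div_le_one hs₃).2 hle
      · rw [Complex.exp_neg] at h0
        field_simp at h0
        linear_combination h0
    have d1 : DifferentiableAt ℝ (fun φ : ℝ => Complex.exp (-(Complex.I * φ))) φ := by
      simpa using hE (-Complex.I)
    have d2 : DifferentiableAt ℝ (fun φ : ℝ => Complex.exp (Complex.I * φ / n)) φ :=
      ((hco.const_mul _).div_const _).cexp
    exact (((d2.const_mul _).mul (pw ((d1.const_mul _).const_add 1) e1)).const_mul _).const_add _
  · have h2 : s₂ ≠ 0 := by
      rintro rfl
      exact hle (by simpa using hs₃.le)
    have e1 : 1 + s₃ / s₂ * Complex.exp (Complex.I * φ) ∈ Complex.slitPlane := by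
      refine one_add_mem_slitPlane ?_ fun h0 => h ?_
      · rw [norm_mul, hnorm, mul_one, norm_div, Complex.norm_real, Real.norm_of_nonneg hs₃.le]
        exact (div_le_one (norm_pos_iff.2 h2)).2 (not_le.1 hle).le
      · field_simp at h0
        linear_combination h0
    exact (((pw (((hE Complex.I).const_mul _).const_add 1) e1).const_mul _).const_mul _).const_add _

/-- Implicit differentiation of `boundaryArc_spec`; the case distinction in the definition plays no
role any more. -/
theorem deriv_boundaryArc (hn : 0 < n) (hs₃ : 0 < s₃) (j : Fin n) {φ : ℝ}
    (h : s₂ + s₃ * Complex.exp (Complex.I * φ) ≠ 0) :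
    deriv (boundaryArc n s₁ s₂ s₃ j) φ = Complex.I * s₃ * Complex.exp (Complex.I * φ) /
      (n * (boundaryArc n s₁ s₂ s₃ j φ - s₁) ^ (n - 1)) := by
  have hspec := boundaryArc_spec n hn s₁ s₂ s₃ hs₃ j
  have hne : boundaryArc n s₁ s₂ s₃ j φ - s₁ ≠ 0 := by
    intro h0
    have := hspec φ
    rw [h0, zero_pow hn.ne'] at this
    exact h this.symm
  have d1 := (((differentiableAt_boundaryArc (s₁ := s₁) hs₃ j h).hasDerivAt.sub_const s₁).fun_pow n)
  have hco : HasDerivAt (fun φ : ℝ => (φ : ℂ)) 1 φ := Complex.ofRealCLM.hasDerivAt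
  have d2 := (((hco.const_mul Complex.I).cexp.const_mul (s₃ : ℂ)).const_add s₂)
  have d3 := d1.unique (d2.congr_of_eventuallyEq (Eventually.of_forall hspec))
  have hnC : (n : ℂ) ≠ 0 := by exact_mod_cast hn.ne'
  rw [eq_div_iff (mul_ne_zero hnC (pow_ne_zero _ hne))]
  linear_combination d3

theorem measurable_boundaryArc (j : Fin n) : Measurable (boundaryArc n s₁ s₂ s₃ j) := by
  unfold boundaryArc
  split_ifs <;> fun_prop

theorem boundaryArc_mem (hn : 0 < n) (hs₃ : 0 < s₃) (j : Fin n) (φ : ℝ) :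
    boundaryArc n s₁ s₂ s₃ j φ ∈ closure (quadDomain n s₁ s₂ s₃) := by
  rw [mem_closure_quadDomain hn hs₃, boundaryArc_spec n hn s₁ s₂ s₃ hs₃, add_sub_cancel_left,
    norm_mul, mul_comm Complex.I, Complex.norm_exp_ofReal_mul_I, mul_one, Complex.norm_real,
    Real.norm_of_nonneg hs₃.le]

theorem boundaryArc_eq (hn : 0 < n) (j : Fin n) (φ : ℝ) :
    boundaryArc n s₁ s₂ s₃ j φ - s₁ = Complex.exp (2 * Real.pi * Complex.I / n) ^ (j : ℕ) *
      (boundaryArc n s₁ s₂ s₃ ⟨0, hn⟩ φ - s₁) := by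
  simp only [boundaryArc, add_sub_cancel_left, Nat.cast_zero, mul_zero, zero_div, Complex.exp_zero,
    one_mul]
  congr 1
  rw [← Complex.exp_nat_mul]
  congr 1
  ring

end Quad

end

section

open MeasureTheory

/-! ### Integrals over the boundary of the quadrature domain -/

section Pushforward

variable {n : ℕ} {s₁ s₂ : ℂ} {s₃ : ℝ} {F : ℂ → ℂ}

/-- The push-forward of the differential `F(ζ) dζ` under `w = (ζ - s₁)ⁿ`. -/
def pushforward (n : ℕ) (s₁ : ℂ) (F : ℂ → ℂ) (w : ℂ) : ℂ :=
  ∑ j : Fin n, F (s₁ + Complex.exp (2 * Real.pi * Complex.I / n) ^ (j : ℕ) * w ^ ((n : ℂ)⁻¹)) /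
    (n * (Complex.exp (2 * Real.pi * Complex.I / n) ^ (j : ℕ) * w ^ ((n : ℂ)⁻¹)) ^ (n - 1))

theorem pushforward_eq (hn : 0 < n) {x w : ℂ} (h : x ^ n = w) :
    pushforward n s₁ F w =
      ∑ j : Fin n, F (s₁ + Complex.exp (2 * Real.pi * Complex.I / n) ^ (j : ℕ) * x) /
        (n * (Complex.exp (2 * Real.pi * Complex.I / n) ^ (j : ℕ) * x) ^ (n - 1)) :=
  sum_pow_mul_eq hn (Complex.isPrimitiveRoot_exp n hn.ne')
    (by rw [h, Complex.cpow_nat_inv_pow _ hn.ne']) fun x => F (s₁ + x) / (n * x ^ (n - 1))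

theorem pushforward_eq_sum (hn : 0 < n) {w : ℂ} {y : Fin n → ℂ} (hy : Function.Injective y)
    (h : ∀ j, (y j - s₁) ^ n = w) :
    pushforward n s₁ F w = ∑ j, F (y j) / (n * (y j - s₁) ^ (n - 1)) := by
  rw [pushforward_eq hn (h ⟨0, hn⟩)]
  have := sum_eq_sum_pow_mul hn (Complex.isPrimitiveRoot_exp n hn.ne') (x := y ⟨0, hn⟩ - s₁)
    (y := fun j => y j - s₁) (fun i j hij => hy (sub_left_injective hij))
    (fun j => (h j).trans (h _).symm) fun x => F (s₁ + x) / (n * x ^ (n - 1))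
  rw [← this]
  simp only [add_sub_cancel]

/-- Dividing by `w` first moves the cut of the principal root away from `w`. For `n = 1` there is no
branching, and the identity also serves at `0`. -/
theorem exists_root_branch (hn : 0 < n) {w : ℂ} (hw : w ≠ 0 ∨ n = 1) :
    ∃ b : ℂ → ℂ, (∀ z, b z ^ n = z) ∧ DifferentiableAt ℂ b w := by
  by_cases h0 : w = 0
  · obtain rfl := hw.resolve_left (not_not.2 h0)
    exact ⟨id, fun z => pow_one z, differentiableAt_id⟩
  · refine ⟨fun z => w ^ ((n : ℂ)⁻¹) * (z / w) ^ ((n : ℂ)⁻¹), fun z => ?_, ?_⟩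
    · rw [mul_pow, Complex.cpow_nat_inv_pow _ hn.ne', Complex.cpow_nat_inv_pow _ hn.ne',
        mul_div_cancel₀ _ h0]
    · refine DifferentiableAt.const_mul ?_ _
      refine ((differentiableAt_id.div_const w).hasDerivAt.cpow_const ?_).differentiableAt
      simp [h0]

theorem pow_sub_one_ne_zero (hn : 0 < n) {x w : ℂ} (h : x ^ n = w) (hw : w ≠ 0 ∨ n = 1) :
    x ^ (n - 1) ≠ 0 := by
  rcases hw with hw | rfl
  · refine pow_ne_zero _ fun h0 => hw ?_
    rw [← h, h0]
    exact zero_pow hn.ne'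
  · simp

theorem add_root_mem_closure (hn : 0 < n) (hs₃ : 0 < s₃) {x w : ℂ} (h : x ^ n = w)
    (hw : w ∈ Metric.closedBall s₂ s₃) : s₁ + x ∈ closure (quadDomain n s₁ s₂ s₃) := by
  rw [mem_closure_quadDomain hn hs₃, add_sub_cancel_left, h]
  rwa [Metric.mem_closedBall, dist_eq_norm] at hw

variable (hn : 0 < n) (hF : DiffContOnCl ℂ F (quadDomain n s₁ s₂ s₃))
include hn hF

theorem continuousWithinAt_pushforward (hs₃ : 0 < s₃) {w : ℂ} (hw0 : w ≠ 0 ∨ n = 1)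
    (hw : w ∈ Metric.closedBall s₂ s₃) :
    ContinuousWithinAt (pushforward n s₁ F) (Metric.closedBall s₂ s₃) w := by
  obtain ⟨b, hb, hbd⟩ := exists_root_branch hn hw0
  have hη := Complex.isPrimitiveRoot_exp n hn.ne'
  have e : pushforward n s₁ F = fun w => ∑ j : Fin n,
      F (s₁ + Complex.exp (2 * Real.pi * Complex.I / n) ^ (j : ℕ) * b w) /
        (n * (Complex.exp (2 * Real.pi * Complex.I / n) ^ (j : ℕ) * b w) ^ (n - 1)) :=
    funext fun w => pushforward_eq hn (hb w)
  rw [e]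
  have hbc := hbd.continuousAt.continuousWithinAt (s := Metric.closedBall s₂ s₃)
  refine tendsto_finsetSum _ fun j _ => ?_
  have hroot : ∀ z, (Complex.exp (2 * Real.pi * Complex.I / n) ^ (j : ℕ) * b z) ^ n = z := fun z =>
    (pow_mul_pow hη j (b z)).trans (hb z)
  refine Tendsto.div ?_ (tendsto_const_nhds.mul ((tendsto_const_nhds.mul hbc).pow _)) ?_
  · exact (hF.continuousOn _ (add_root_mem_closure hn hs₃ (hroot w) hw)).tendsto.comp
      (tendsto_nhdsWithin_iff.2 ⟨tendsto_const_nhds.add (tendsto_const_nhds.mul hbc), by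
        filter_upwards [self_mem_nhdsWithin] with z hz
        exact add_root_mem_closure hn hs₃ (hroot z) hz⟩)
  · exact mul_ne_zero (by exact_mod_cast hn.ne') (pow_sub_one_ne_zero hn (hroot w) hw0)

theorem differentiableAt_pushforward {w : ℂ} (hw0 : w ≠ 0 ∨ n = 1)
    (hw : w ∈ Metric.ball s₂ s₃) : DifferentiableAt ℂ (pushforward n s₁ F) w := by
  obtain ⟨b, hb, hbd⟩ := exists_root_branch hn hw0
  have hη := Complex.isPrimitiveRoot_exp n hn.ne'
  have e : pushforward n s₁ F = fun w => ∑ j : Fin n,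
      F (s₁ + Complex.exp (2 * Real.pi * Complex.I / n) ^ (j : ℕ) * b w) /
        (n * (Complex.exp (2 * Real.pi * Complex.I / n) ^ (j : ℕ) * b w) ^ (n - 1)) :=
    funext fun w => pushforward_eq hn (hb w)
  rw [e]
  refine DifferentiableAt.fun_sum fun j _ => ?_
  have hroot : (Complex.exp (2 * Real.pi * Complex.I / n) ^ (j : ℕ) * b w) ^ n = w :=
    (pow_mul_pow hη j (b w)).trans (hb w)
  have hmem : s₁ + Complex.exp (2 * Real.pi * Complex.I / n) ^ (j : ℕ) * b w ∈
      quadDomain n s₁ s₂ s₃ := by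
    simp only [quadDomain, mem_ofPred_eq, add_sub_cancel_left, hroot]
    rwa [Metric.mem_ball, dist_eq_norm] at hw
  refine DifferentiableAt.fun_div ?_ (((hbd.const_mul _).fun_pow _).const_mul _) ?_
  · exact DifferentiableAt.comp w (hF.differentiableAt isOpen_quadDomain hmem)
      ((hbd.const_mul _).const_add _)
  · exact mul_ne_zero (by exact_mod_cast hn.ne') (pow_sub_one_ne_zero hn hroot hw0)

omit hF in
theorem norm_pow_sub_one {x w : ℂ} (h : x ^ n = w) :
    ‖x‖ ^ (n - 1) = ‖w‖ ^ (((n : ℝ) - 1) / n) := by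
  rw [← h, norm_pow, ← Real.rpow_natCast, ← Real.rpow_natCast, ← Real.rpow_mul (norm_nonneg _)]
  congr 1
  have : (n : ℝ) ≠ 0 := by exact_mod_cast hn.ne'
  rw [Nat.cast_sub hn]
  field_simp
  simp

-- Each of the `n` summands is at most `B / (n ‖w‖^{(n-1)/n})`. The exponent is below `1`, which
-- makes the singularity at `0` both removable and integrable along circles.
omit hF in
theorem norm_pushforward_le (hs₃ : 0 < s₃) {B : ℝ}
    (hB : ∀ z ∈ closure (quadDomain n s₁ s₂ s₃), ‖F z‖ ≤ B) {w : ℂ}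
    (hw : w ∈ Metric.closedBall s₂ s₃) :
    ‖pushforward n s₁ F w‖ ≤ B * ‖w‖ ^ (-(((n : ℝ) - 1) / n)) := by
  have hη := Complex.isPrimitiveRoot_exp n hn.ne'
  have hn' : (0 : ℝ) < n := by exact_mod_cast hn
  rw [pushforward]
  refine (norm_sum_le_of_le _ (n := fun _ => B * ‖w‖ ^ (-(((n : ℝ) - 1) / n)) / n)
    fun j _ => ?_).trans ?_
  · have hroot : (Complex.exp (2 * Real.pi * Complex.I / n) ^ (j : ℕ) * w ^ ((n : ℂ)⁻¹)) ^ n = w :=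
      (pow_mul_pow hη j _).trans (Complex.cpow_nat_inv_pow _ hn.ne')
    rw [norm_div, norm_mul, norm_pow, norm_pow_sub_one hn hroot, Complex.norm_natCast,
      Real.rpow_neg (norm_nonneg _), mul_comm (n : ℝ), ← div_div, ← div_eq_mul_inv]
    have := hB _ (add_root_mem_closure (s₁ := s₁) hn hs₃ hroot hw)
    gcongr
  · rw [Finset.sum_const, Finset.card_univ, Fintype.card_fin, nsmul_eq_mul]
    exact (mul_div_cancel₀ _ hn'.ne').le

/-- The integrand over the circle of radius `ρ` around `s₂`. -/
theorem integral_circle (hs₃ : 0 < s₃) (hs : s₂ ≠ 0 ∨ n = 1) {B : ℝ}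
    (hB : ∀ z ∈ closure (quadDomain n s₁ s₂ s₃), ‖F z‖ ≤ B) {ρ : ℝ} (hρ : 0 < ρ) (hρ3 : ρ < s₃)
    (hρ2 : ρ ≠ ‖s₂‖) :
    ∫ φ in (0 : ℝ)..(2 * Real.pi), Complex.I *
        (conj s₂ * (ρ * Complex.exp (Complex.I * φ)) + s₃ ^ 2) *
          pushforward n s₁ F (s₂ + ρ * Complex.exp (Complex.I * φ)) =
      2 * Real.pi * Complex.I * (s₃ ^ 2 * pushforward n s₁ F s₂) := by
  set G := pushforward n s₁ F with hG
  have hn' : (0 : ℝ) < n := by exact_mod_cast hn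
  have hev : ∀ w ∈ Metric.ball s₂ s₃, ∀ᶠ z in 𝓝[≠] w, DifferentiableAt ℂ G z := fun w hw => by
    filter_upwards [eventually_notMem_of_finite (finite_singleton 0) w,
      mem_nhdsWithin_of_mem_nhds (Metric.isOpen_ball.mem_nhds hw)] with z hz0 hz
    exact differentiableAt_pushforward hn hF (Or.inl hz0) hz
  have hfd : ∀ w ∈ Metric.ball s₂ s₃, DifferentiableAt ℂ (fillIn G) w := by
    intro w hw
    -- At `0` the growth bound gives `‖z G z‖ ≤ B ‖z‖^{1/n} → 0`.
    refine differentiableAt_fillIn (hev w hw) ?_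
    by_cases hw0 : w = 0
    · subst hw0
      have hle : ∀ᶠ z in 𝓝[≠] (0 : ℂ), ‖(z - 0) * G z‖ ≤ B * ‖z‖ ^ ((n : ℝ)⁻¹) := by
        filter_upwards [self_mem_nhdsWithin,
          mem_nhdsWithin_of_mem_nhds (Metric.isOpen_ball.mem_nhds hw)] with z hz0 hz
        have hpos : 0 < ‖z‖ := norm_pos_iff.2 hz0
        have := norm_pushforward_le hn hs₃ hB (Metric.ball_subset_closedBall hz)
        rw [sub_zero, norm_mul]
        calc ‖z‖ * ‖G z‖ ≤ ‖z‖ * (B * ‖z‖ ^ (-(((n : ℝ) - 1) / n))) := by gcongr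
          _ = B * (‖z‖ ^ (1 : ℝ) * ‖z‖ ^ (-(((n : ℝ) - 1) / n))) := by rw [Real.rpow_one]; ring
          _ = B * ‖z‖ ^ ((n : ℝ)⁻¹) := by
            rw [← Real.rpow_add hpos]
            congr 2
            field_simp
            ring
      refine squeeze_zero_norm' hle ?_
      have h1 : Tendsto (fun z : ℂ => ‖z‖ ^ ((n : ℝ)⁻¹)) (𝓝 0) (𝓝 0) := by
        have : ContinuousAt (fun x : ℝ => x ^ ((n : ℝ)⁻¹)) 0 :=
          Real.continuousAt_rpow_const _ _ (Or.inr (by positivity))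
        have h2 := this.tendsto.comp (tendsto_norm_zero (E := ℂ))
        rwa [Real.zero_rpow (by positivity)] at h2
      simpa using (h1.const_mul B).mono_left nhdsWithin_le_nhds
    · exact tendsto_mul_of_differentiableAt
        (differentiableAt_pushforward hn hF (Or.inl hw0) hw).continuousAt
  have hval : ∀ w ∈ Metric.ball s₂ s₃, w ≠ 0 ∨ n = 1 → fillIn G w = G w := fun w hw hw0 =>
    fillIn_eq_of_continuousAt (differentiableAt_pushforward hn hF hw0 hw).continuousAt
  -- With `w - s₂ = ρ e^{iφ}` and `dw = i (w - s₂) dφ`, the integral is Cauchy's formula at the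
  -- centre, where the prefactor equals `s₃²`.
  have hC := DifferentiableOn.circleIntegral_sub_inv_smul (R := ρ) (c := s₂) (w := s₂)
    (f := fun w => (conj s₂ * (w - s₂) + s₃ ^ 2) * fillIn G w)
    (fun w hw => DifferentiableAt.differentiableWithinAt (by
      have := hfd w (Metric.closedBall_subset_ball hρ3 hw)
      fun_prop)) (Metric.mem_ball_self hρ)
  rw [circleIntegral] at hC
  have e0 : fillIn G s₂ = G s₂ := hval s₂ (Metric.mem_ball_self hs₃) hs
  simp only [sub_self, mul_zero, zero_add, e0, smul_eq_mul] at hC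
  rw [← hC]
  refine intervalIntegral.integral_congr fun φ _ => ?_
  have hc : circleMap s₂ ρ φ = s₂ + ρ * Complex.exp (Complex.I * φ) := by
    rw [circleMap, mul_comm (φ : ℂ)]
  have hρC : (ρ : ℂ) ≠ 0 := by exact_mod_cast hρ.ne'
  have hnorm : ‖(ρ : ℂ) * Complex.exp (Complex.I * φ)‖ = ρ := by
    rw [norm_mul, mul_comm Complex.I, Complex.norm_exp_ofReal_mul_I, mul_one, Complex.norm_real,
      Real.norm_of_nonneg hρ.le]
  have hne : s₂ + ρ * Complex.exp (Complex.I * φ) ≠ 0 := fun h0 => hρ2 (by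
    rw [← hnorm, ← norm_neg s₂, neg_eq_of_add_eq_zero_right h0])
  have hmem : s₂ + ρ * Complex.exp (Complex.I * φ) ∈ Metric.ball s₂ s₃ := by
    rw [Metric.mem_ball, dist_eq_norm, add_sub_cancel_left, hnorm]
    exact hρ3
  have hexp := Complex.exp_ne_zero (Complex.I * φ)
  simp only [deriv_circleMap, hc, hval _ hmem (Or.inl hne)]
  rw [circleMap, zero_add, mul_comm (φ : ℂ), add_sub_cancel_left]
  field_simp

/-- The integral over the boundary of the quadrature domain. -/
theorem boundaryIntegral_eq (hs₃ : 0 < s₃) {ζ : Fin n → ℂ} (hinj : Function.Injective ζ)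
    (hζ : ∀ j, (ζ j - s₁) ^ n = s₂) :
    boundaryIntegral n s₁ s₂ s₃ (fun w => (conj w - conj s₁) ^ n * F w) =
      2 * Real.pi * Complex.I *
        ∑ j, s₃ ^ 2 * F (ζ j) / ∏ k ∈ Finset.univ.erase j, (ζ j - ζ k) := by
  -- If `s₂ = 0`, all roots coincide with `s₁`, so injectivity of `ζ` forces `n = 1`.
  have hs : s₂ ≠ 0 ∨ n = 1 := by
    by_contra! h
    obtain ⟨h0, h1⟩ := h
    have hz : ∀ j, ζ j = s₁ := fun j => by
      have := hζ j
      rw [h0, pow_eq_zero_iff hn.ne', sub_eq_zero] at this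
      exact this
    have h2 : 1 < n := by omega
    have := hinj ((hz ⟨0, hn⟩).trans (hz ⟨1, h2⟩).symm)
    simp at this
  obtain ⟨B, hB⟩ := (isCompact_closure_quadDomain (s₁ := s₁) (s₂ := s₂) hn hs₃).exists_bound_of_continuousOn
    hF.continuousOn
  have hB0 : 0 ≤ B := (norm_nonneg _).trans (hB _ (boundaryArc_mem hn hs₃ ⟨0, hn⟩ 0))
  set G := pushforward n s₁ F with hG
  have hn' : (0 : ℝ) < n := by exact_mod_cast hn
  have hn1 : (1 : ℝ) ≤ n := by exact_mod_cast hn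
  set a := ((n : ℝ) - 1) / n with ha
  have ha0 : 0 ≤ a := div_nonneg (by linarith) hn'.le
  have ha1 : a < 1 := by rw [ha, div_lt_one hn']; linarith
  obtain ⟨κ, hκ, hκle⟩ := exists_weight ha0 ha1 (s₂ := s₂) (hs.imp_right fun h => by
    rw [ha, h]; simp) 0 (2 * Real.pi)
  have hπ := Real.pi_pos
  have hnorm : ∀ (ρ φ : ℝ), 0 < ρ → ‖(ρ : ℂ) * Complex.exp (Complex.I * φ)‖ = ρ :=
    fun ρ φ hρ => by
      rw [norm_mul, mul_comm Complex.I, Complex.norm_exp_ofReal_mul_I, mul_one, Complex.norm_real,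
        Real.norm_of_nonneg hρ.le]
  -- The constant `s₃²` is not scaled with `ρ`: the conjugate has already been replaced by its
  -- meromorphic expression on the outer circle, so the integral is the same for all admissible
  -- radii.
  let Φ : ℝ → ℝ → ℂ := fun ρ φ => Complex.I *
    (conj s₂ * (ρ * Complex.exp (Complex.I * φ)) + s₃ ^ 2) *
      G (s₂ + ρ * Complex.exp (Complex.I * φ))
  have hmem : ∀ (ρ φ : ℝ), 0 < ρ → ρ ≤ s₃ →
      s₂ + ρ * Complex.exp (Complex.I * φ) ∈ Metric.closedBall s₂ s₃ := fun ρ φ hρ hρ3 => by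
    rw [Metric.mem_closedBall, dist_eq_norm, add_sub_cancel_left, hnorm ρ φ hρ]
    exact hρ3
  -- the integral over the largest circle
  have hlim : ∫ φ in (0 : ℝ)..(2 * Real.pi), Φ s₃ φ =
      2 * Real.pi * Complex.I * (s₃ ^ 2 * G s₂) := by
    -- The circle of radius `‖s₂‖` passes through the branch point `0` and is avoided.
    have hρev : ∀ᶠ ρ in 𝓝[<] s₃, 0 < ρ ∧ ρ < s₃ ∧ ρ ≠ ‖s₂‖ := by
      rcases lt_or_ge ‖s₂‖ s₃ with h | h
      · filter_upwards [Ioo_mem_nhdsLT h] with ρ hρ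
        exact ⟨(norm_nonneg _).trans_lt hρ.1, hρ.2, hρ.1.ne'⟩
      · filter_upwards [Ioo_mem_nhdsLT hs₃] with ρ hρ
        exact ⟨hρ.1, hρ.2, (hρ.2.trans_le h).ne⟩
    have ht : Tendsto (fun ρ => ∫ φ in (0 : ℝ)..(2 * Real.pi), Φ ρ φ) (𝓝[<] s₃)
        (𝓝 (∫ φ in (0 : ℝ)..(2 * Real.pi), Φ s₃ φ)) := by
      refine intervalIntegral.tendsto_integral_filter_of_dominated_convergence
        (fun φ => (‖s₂‖ * s₃ + s₃ ^ 2) * (B * κ φ)) ?_ ?_ ((hκ.const_mul B).const_mul _) ?_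
      · filter_upwards [hρev] with ρ hρ
        refine Continuous.aestronglyMeasurable ?_
        have hG' : Continuous fun φ : ℝ => G (s₂ + ρ * Complex.exp (Complex.I * φ)) := by
          refine continuous_iff_continuousAt.2 fun φ => ?_
          have hne : s₂ + ρ * Complex.exp (Complex.I * φ) ≠ 0 := fun h0 => hρ.2.2 (by
            rw [← hnorm ρ φ hρ.1, ← norm_neg s₂, neg_eq_of_add_eq_zero_right h0])
          have hb : s₂ + ρ * Complex.exp (Complex.I * φ) ∈ Metric.ball s₂ s₃ := by
            rw [Metric.mem_ball, dist_eq_norm, add_sub_cancel_left, hnorm ρ φ hρ.1]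
            exact hρ.2.1
          exact ContinuousAt.comp (f := fun φ : ℝ => s₂ + ρ * Complex.exp (Complex.I * φ))
            (differentiableAt_pushforward hn hF (Or.inl hne) hb).continuousAt (by fun_prop)
        exact (by fun_prop : Continuous fun φ : ℝ => Complex.I *
          (conj s₂ * (ρ * Complex.exp (Complex.I * φ)) + s₃ ^ 2)).mul hG'
      · filter_upwards [hρev] with ρ hρ
        filter_upwards [hκle] with φ hφ _
        have h1 := norm_pushforward_le hn hs₃ hB (hmem ρ φ hρ.1 hρ.2.1.le)
        have h2 : ‖G (s₂ + ρ * Complex.exp (Complex.I * φ))‖ ≤ B * κ φ :=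
          h1.trans (mul_le_mul_of_nonneg_left (hφ ρ hρ.1).2 hB0)
        have h3 : ‖conj s₂ * (ρ * Complex.exp (Complex.I * φ)) + (s₃ : ℂ) ^ 2‖ ≤
            ‖s₂‖ * s₃ + s₃ ^ 2 := by
          refine (norm_add_le _ _).trans (add_le_add ?_ ?_)
          · rw [norm_mul, Complex.norm_conj, hnorm ρ φ hρ.1]
            exact mul_le_mul_of_nonneg_left hρ.2.1.le (norm_nonneg _)
          · rw [norm_pow, Complex.norm_real, Real.norm_of_nonneg hs₃.le]
        simp only [Φ]
        rw [norm_mul, norm_mul, Complex.norm_I, one_mul]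
        exact mul_le_mul h3 h2 (norm_nonneg _) (by positivity)
      · filter_upwards [hκle] with φ hφ _
        have hc : Tendsto (fun ρ : ℝ => s₂ + ρ * Complex.exp (Complex.I * φ)) (𝓝[<] s₃)
            (𝓝[Metric.closedBall s₂ s₃] (s₂ + s₃ * Complex.exp (Complex.I * φ))) := by
          refine tendsto_nhdsWithin_iff.2 ⟨?_, hρev.mono fun ρ hρ => hmem ρ φ hρ.1 hρ.2.1.le⟩
          have : Continuous fun ρ : ℝ => s₂ + ρ * Complex.exp (Complex.I * φ) := by fun_prop
          exact (this.tendsto s₃).mono_left nhdsWithin_le_nhds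
        have hG' := (continuousWithinAt_pushforward hn hF hs₃ (Or.inl (hφ s₃ hs₃).1)
          (hmem s₃ φ hs₃ le_rfl)).tendsto.comp hc
        refine Tendsto.mul ?_ hG'
        have : Continuous fun ρ : ℝ => Complex.I *
          (conj s₂ * (ρ * Complex.exp (Complex.I * φ)) + s₃ ^ 2) := by fun_prop
        exact (this.tendsto s₃).mono_left nhdsWithin_le_nhds
    refine tendsto_nhds_unique ht (tendsto_const_nhds.congr' ?_)
    filter_upwards [hρev] with ρ hρ
    exact (integral_circle hn hF hs₃ hs hB hρ.1 hρ.2.1 hρ.2.2).symm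
  -- the boundary arcs
  have hterm : ∀ j : Fin n, IntervalIntegrable (fun φ =>
      (conj (boundaryArc n s₁ s₂ s₃ j φ) - conj s₁) ^ n * F (boundaryArc n s₁ s₂ s₃ j φ) *
        deriv (boundaryArc n s₁ s₂ s₃ j) φ) volume 0 (2 * Real.pi) := by
    intro j
    refine (hκ.const_mul ((‖s₂‖ + s₃) * B * s₃)).mono_fun' ?_ ?_
    · refine Measurable.aestronglyMeasurable ?_
      have hA := measurable_boundaryArc (s₁ := s₁) (s₂ := s₂) (s₃ := s₃) j
      -- Continuity of `F` is only known on the closed domain, so the arc is regarded as a map into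
      -- it.
      have hFA : Measurable fun φ => F (boundaryArc n s₁ s₂ s₃ j φ) :=
        (continuousOn_iff_continuous_domRestrict.1 hF.continuousOn).measurable.comp
          (hA.subtype_mk (h := fun φ => boundaryArc_mem hn hs₃ j φ))
      exact ((((Complex.continuous_conj.measurable.comp hA).sub_const _).pow_const n).mul hFA).mul
        (measurable_deriv _)
    · refine ae_restrict_of_ae ?_
      filter_upwards [hκle] with φ hφ
      obtain ⟨h0, h1⟩ := hφ s₃ hs₃
      have hspec := boundaryArc_spec n hn s₁ s₂ s₃ hs₃ j φ
      have hFb := hB _ (boundaryArc_mem (s₁ := s₁) (s₂ := s₂) hn hs₃ j φ)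
      have hexp : ‖Complex.exp (Complex.I * φ)‖ = 1 := by
        rw [mul_comm, Complex.norm_exp_ofReal_mul_I]
      rw [deriv_boundaryArc hn hs₃ j h0, ← map_sub, ← map_pow, hspec, norm_mul, norm_mul,
        Complex.norm_conj, norm_div, norm_mul, norm_mul, norm_mul, Complex.norm_I, hexp, one_mul,
        mul_one, norm_pow, norm_pow_sub_one hn hspec, Complex.norm_natCast, Complex.norm_real,
        Real.norm_of_nonneg hs₃.le, ← ha]
      have h2 : ‖s₂ + s₃ * Complex.exp (Complex.I * φ)‖ ≤ ‖s₂‖ + s₃ :=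
        (norm_add_le _ _).trans (by rw [hnorm s₃ φ hs₃])
      have hpos : 0 < ‖s₂ + s₃ * Complex.exp (Complex.I * φ)‖ ^ a :=
        Real.rpow_pos_of_pos (norm_pos_iff.2 h0) _
      have h3 : s₃ / (n * ‖s₂ + s₃ * Complex.exp (Complex.I * φ)‖ ^ a) ≤ s₃ * κ φ := by
        calc s₃ / (n * ‖s₂ + s₃ * Complex.exp (Complex.I * φ)‖ ^ a)
            ≤ s₃ / (1 * ‖s₂ + s₃ * Complex.exp (Complex.I * φ)‖ ^ a) := by gcongr
          _ = s₃ * ‖s₂ + s₃ * Complex.exp (Complex.I * φ)‖ ^ (-a) := by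
            rw [one_mul, Real.rpow_neg (norm_nonneg _), div_eq_mul_inv]
          _ ≤ s₃ * κ φ := by gcongr
      calc _ ≤ (‖s₂‖ + s₃) * B * (s₃ * κ φ) := by gcongr
        _ = _ := by ring
  have hsum : boundaryIntegral n s₁ s₂ s₃ (fun w => (conj w - conj s₁) ^ n * F w) =
      ∫ φ in (0 : ℝ)..(2 * Real.pi), Φ s₃ φ := by
    rw [boundaryIntegral, ← intervalIntegral.integral_finsetSum fun j _ => hterm j]
    refine intervalIntegral.integral_congr_ae ?_
    filter_upwards [hκle] with φ hφ _
    obtain ⟨h0, -⟩ := hφ s₃ hs₃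
    have hA0 : boundaryArc n s₁ s₂ s₃ ⟨0, hn⟩ φ - s₁ ≠ 0 := fun h => h0 (by
      rw [← boundaryArc_spec n hn s₁ s₂ s₃ hs₃ ⟨0, hn⟩ φ, h, zero_pow hn.ne'])
    have hAinj : Function.Injective fun j => boundaryArc n s₁ s₂ s₃ j φ := fun i j hij => by
      have : boundaryArc n s₁ s₂ s₃ i φ - s₁ = boundaryArc n s₁ s₂ s₃ j φ - s₁ :=
        congrArg (· - s₁) hij
      rw [boundaryArc_eq hn i, boundaryArc_eq hn j] at this
      exact pow_mul_injective (Complex.isPrimitiveRoot_exp n hn.ne') hA0 this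
    simp only [Φ]
    rw [hG, pushforward_eq_sum hn hAinj fun j => boundaryArc_spec n hn s₁ s₂ s₃ hs₃ j φ,
      Finset.mul_sum]
    refine Finset.sum_congr rfl fun j _ => ?_
    have hce : conj (Complex.exp (Complex.I * φ)) * Complex.exp (Complex.I * φ) = 1 := by
      rw [← Complex.exp_conj, ← Complex.exp_add]
      simp
    rw [deriv_boundaryArc hn hs₃ j h0, ← map_sub, ← map_pow,
      boundaryArc_spec n hn s₁ s₂ s₃ hs₃ j φ, map_add, map_mul, Complex.conj_ofReal]
    -- The identity `s₂* (w - s₂) + s₃² = w* (w - s₂)` on the circle `|w - s₂| = s₃`.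
    rw [show (conj s₂ * (s₃ * Complex.exp (Complex.I * φ)) + (s₃ : ℂ) ^ 2) =
      (conj s₂ + s₃ * conj (Complex.exp (Complex.I * φ))) * (s₃ * Complex.exp (Complex.I * φ)) by
        linear_combination -(s₃ : ℂ) ^ 2 * hce]
    ring
  rw [hsum, hlim, hG, pushforward_eq_sum hn hinj hζ, Finset.mul_sum]
  congr 1
  refine Finset.sum_congr rfl fun j _ => ?_
  rw [prod_erase_sub hinj hζ, mul_div_assoc]

end Pushforward

end

section

/-! ### The jumps are finite sums of poles -/

variable {n : ℕ} {s₁ s₂ : ℂ} {s₃ : ℝ}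

theorem boundaryIntegralConj_eq (g : ℂ → ℂ) : boundaryIntegralConj n s₁ s₂ s₃ g =
    conj (boundaryIntegral n s₁ s₂ s₃ fun w => conj (g w)) := by
  simp only [boundaryIntegral, boundaryIntegralConj, map_sum]
  refine Finset.sum_congr rfl fun j _ => ?_
  simp [intervalIntegral.integral_of_le Real.two_pi_pos.le, ← integral_conj]

theorem boundaryIntegral_neg (g : ℂ → ℂ) : boundaryIntegral n s₁ s₂ s₃ (fun w => -g w) =
    -boundaryIntegral n s₁ s₂ s₃ g := by
  simp [boundaryIntegral, Finset.sum_neg_distrib]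

theorem conj_exp_theta (y t : ℝ) (z : ℂ) : conj (Complex.exp (-2 * Complex.I * theta y t z)) =
    Complex.exp (2 * Complex.I * theta y t (conj z)) := by
  rw [theta_conj, ← Complex.exp_conj]
  simp [map_ofNat]

/-- Schwarz symmetry, with the analogous identity for the pole sums in `lowerPoleSum_eq`. It reduces
the eight integrals to the four taken with respect to `dζ`. -/
theorem lowerJump_eq (r₁ : ℂ → ℂ) (y t : ℝ) (z : ℂ) (k : Fin 4) :
    lowerJump n s₁ s₂ s₃ r₁ y t z k = -conj (upperJump n s₁ s₂ s₃ r₁ y t (conj z) k) := by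
  fin_cases k <;>
    simp [lowerJump, upperJump, boundaryIntegralConj_eq, ← Complex.exp_conj, ← theta_conj, div_neg,
      boundaryIntegral_neg, map_ofNat]

theorem lowerPoleSum_eq (ζ c : Fin n → ℂ) (y t : ℝ) (k : Fin 4) (z : ℂ) :
    lowerPoleSum ζ c y t k z = -conj (upperPoleSum ζ c y t k (conj z)) := by
  simp only [lowerPoleSum, upperPoleSum, map_sum, ← Finset.sum_neg_distrib]
  refine Finset.sum_congr rfl fun j _ => ?_
  rw [map_div₀, map_mul, conj_exp_theta, ← lowerPole_eq_conj, map_sub, ← lowerPole_eq_conj,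
    Complex.conj_conj, ← neg_div, ← neg_mul]
  congr 3
  fin_cases k <;> simp [lowerConst, upperConst]

theorem differentiableAt_exp_theta (y t : ℝ) {w : ℂ} (h0 : w ≠ 0) (h1 : w ≠ Complex.I)
    (h2 : w ≠ -Complex.I) :
    DifferentiableAt ℂ (fun w => Complex.exp (-2 * Complex.I * theta y t w)) w := by
  have hl : lamFun w ≠ 0 := by
    intro h
    have : (w - Complex.I) * (w + Complex.I) = 0 := by
      have e : w * lamFun w * 2 = (w - Complex.I) * (w + Complex.I) := by
        simp only [lamFun]
        field_simp
        linear_combination Complex.I_sq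
      rw [← e, h]; ring
    rcases mul_eq_zero.1 this with h | h
    · exact h1 (sub_eq_zero.1 h)
    · exact h2 (eq_neg_of_add_eq_zero_left h)
  have hi : DifferentiableAt ℂ (fun w : ℂ => 1 / w) w := (differentiableAt_const _).fun_div differentiableAt_id h0
  have hk : DifferentiableAt ℂ kFun w := (differentiableAt_id.fun_sub hi).const_mul _
  have hL : DifferentiableAt ℂ lamFun w := (differentiableAt_id.fun_add hi).const_mul _
  have hinv : DifferentiableAt ℂ (fun w => (lamFun w ^ 2)⁻¹) w :=
    (hL.fun_pow 2).fun_inv (pow_ne_zero 2 hl)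
  unfold theta
  fun_prop

/-- The residue evaluation with `F = r₁ e / D`, in the shape shared by the four integrals: `e` is
the exponential and `D` the Cauchy kernel together with its Jacobian factor. -/
theorem boundaryIntegral_kernel (hn : 0 < n) (hs₃ : 0 < s₃) {r₁ : ℂ → ℂ}
    (hr₁ : DiffContOnCl ℂ r₁ (quadDomain n s₁ s₂ s₃)) {ζ : Fin n → ℂ}
    (hinj : Function.Injective ζ) (hζ : ∀ j, (ζ j - s₁) ^ n = s₂) {e D : ℂ → ℂ}
    (he : ∀ w ∈ closure (quadDomain n s₁ s₂ s₃), DifferentiableAt ℂ e w)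
    (hD : ∀ w ∈ closure (quadDomain n s₁ s₂ s₃), DifferentiableAt ℂ D w)
    (hD0 : ∀ w ∈ closure (quadDomain n s₁ s₂ s₃), D w ≠ 0) :
    boundaryIntegral n s₁ s₂ s₃ (fun w => (conj w - conj s₁) ^ n * r₁ w * e w / D w) =
      2 * Real.pi * Complex.I * ∑ j, normingConst s₃ r₁ ζ j * e (ζ j) / D (ζ j) := by
  have hF : DiffContOnCl ℂ (fun w => r₁ w * (e w / D w)) (quadDomain n s₁ s₂ s₃) := by
    have hd : ∀ w ∈ closure (quadDomain n s₁ s₂ s₃), DifferentiableAt ℂ (fun w => e w / D w) w :=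
      fun w hw => (he w hw).fun_div (hD w hw) (hD0 w hw)
    exact ⟨hr₁.1.fun_mul fun w hw => (hd w (subset_closure hw)).differentiableWithinAt,
      hr₁.2.mul fun w hw => (hd w hw).continuousAt.continuousWithinAt⟩
  have := boundaryIntegral_eq hn hF hs₃ hinj hζ
  simp only [mul_div_assoc, mul_assoc] at this ⊢
  rw [this]
  simp only [normingConst]
  refine congrArg _ (congrArg _ (congrArg _ (Finset.sum_congr rfl fun j _ => ?_)))
  ring

variable (hn : 0 < n) (hs₃ : 0 < s₃) (hΩ : quadDomain n s₁ s₂ s₃ ⊆ regionD) {r₁ : ℂ → ℂ}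
  (hr₁ : DiffContOnCl ℂ r₁ (quadDomain n s₁ s₂ s₃)) {ζ c : Fin n → ℂ}
  (hinj : Function.Injective ζ) (hζ : ∀ j, (ζ j - s₁) ^ n = s₂)
  (hc : ∀ j, c j = normingConst s₃ r₁ ζ j) (hI : Complex.I ∉ closure (quadDomain n s₁ s₂ s₃))
include hΩ

theorem one_le_norm_of_mem_closure {w : ℂ} (hw : w ∈ closure (quadDomain n s₁ s₂ s₃)) :
    1 ≤ ‖w‖ ∧ 0 ≤ w.im := by
  have hcl : IsClosed {w : ℂ | 1 ≤ ‖w‖ ∧ 0 ≤ w.im} :=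
    (isClosed_le continuous_const continuous_norm).inter
      (isClosed_le continuous_const Complex.continuous_im)
  refine closure_minimal (fun w hw => ?_) hcl hw
  rw [mem_ofPred_eq]
  exact ⟨(hΩ hw).2.2.le, (im_pos_of_mem_regionD (hΩ hw)).le⟩

theorem ne_zero_of_mem_closure {w : ℂ} (hw : w ∈ closure (quadDomain n s₁ s₂ s₃)) : w ≠ 0 := by
  rintro rfl
  have := (one_le_norm_of_mem_closure hΩ hw).1
  norm_num at this

include hI in
theorem differentiableAt_exp_theta_of_mem_closure (y t : ℝ) {w : ℂ}
    (hw : w ∈ closure (quadDomain n s₁ s₂ s₃)) :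
    DifferentiableAt ℂ (fun w => Complex.exp (-2 * Complex.I * theta y t w)) w := by
  refine differentiableAt_exp_theta y t (ne_zero_of_mem_closure hΩ hw) (fun h => hI (h ▸ hw)) ?_
  rintro rfl
  have := (one_le_norm_of_mem_closure hΩ hw).2
  norm_num at this

omit hΩ in
theorem two_pi_I_mul_ne_zero {x : ℂ} (hx : x ≠ 0) : 2 * Real.pi * Complex.I * x ≠ 0 :=
  mul_ne_zero Complex.two_pi_I_ne_zero hx

include hn hs₃ hr₁ hinj hζ hc hI

theorem upperJump_zero (y t : ℝ) {z : ℂ}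
    (hz : z ∉ (fun w => upperPole w 0) '' closure (quadDomain n s₁ s₂ s₃)) :
    upperJump n s₁ s₂ s₃ r₁ y t z 0 = -upperPoleSum ζ c y t 0 z := by
  change -boundaryIntegral n s₁ s₂ s₃ (fun w => (conj w - conj s₁) ^ n * r₁ w
      * Complex.exp (-2 * Complex.I * theta y t w)
      / (2 * Real.pi * Complex.I * (z - w))) = -∑ j, c j *
        Complex.exp (-2 * Complex.I * theta y t (ζ j)) / (z - ζ j)
  rw [boundaryIntegral_kernel hn hs₃ hr₁ hinj hζ
    (fun w hw => differentiableAt_exp_theta_of_mem_closure hΩ hI y t hw)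
    (D := fun w => 2 * Real.pi * Complex.I * (z - w))
    (fun w hw => by fun_prop) (fun w hw => two_pi_I_mul_ne_zero
      (sub_ne_zero.2 fun h => hz ⟨w, hw, h.symm⟩)), Finset.mul_sum]
  congr 1
  refine Finset.sum_congr rfl fun j _ => ?_
  rw [hc, ← mul_div_assoc, mul_div_mul_left _ _ Complex.two_pi_I_ne_zero]

theorem lowerJump_one (y t : ℝ) {z : ℂ}
    (hz : z ∉ (fun w => lowerPole w 1) '' closure (quadDomain n s₁ s₂ s₃)) :
    lowerJump n s₁ s₂ s₃ r₁ y t z 1 = -lowerPoleSum ζ c y t 1 z := by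
  change boundaryIntegral n s₁ s₂ s₃ (fun w => (conj w - conj s₁) ^ n * r₁ w
      * Complex.exp (2 * Complex.I * theta y t (-w))
      / (2 * Real.pi * Complex.I * (z + w))) = -∑ j, -c j *
        Complex.exp (2 * Complex.I * theta y t (-ζ j)) / (z - -ζ j)
  simp only [theta_neg, mul_neg, ← neg_mul]
  rw [boundaryIntegral_kernel hn hs₃ hr₁ hinj hζ
    (fun w hw => differentiableAt_exp_theta_of_mem_closure hΩ hI y t hw)
    (fun w hw => by fun_prop) (fun w hw => two_pi_I_mul_ne_zero
      fun h => hz ⟨w, hw, (eq_neg_of_add_eq_zero_left h).symm⟩), Finset.mul_sum,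
    ← Finset.sum_neg_distrib]
  refine Finset.sum_congr rfl fun j _ => ?_
  rw [hc, ← mul_div_assoc, mul_div_mul_left _ _ Complex.two_pi_I_ne_zero, sub_neg_eq_add]
  ring

theorem upperJump_three (y t : ℝ) {z : ℂ}
    (hz : z ∉ (fun w => upperPole w 3) '' closure (quadDomain n s₁ s₂ s₃)) :
    upperJump n s₁ s₂ s₃ r₁ y t z 3 = -upperPoleSum ζ c y t 3 z := by
  change boundaryIntegral n s₁ s₂ s₃ (fun w => (conj w - conj s₁) ^ n * r₁ w
      * Complex.exp (-2 * Complex.I * theta y t (-1 / w))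
      / (2 * Real.pi * Complex.I * (z + 1 / w) * w ^ 2)) = -∑ j, -(c j / ζ j ^ 2) *
        Complex.exp (-2 * Complex.I * theta y t (-1 / ζ j)) / (z - -1 / ζ j)
  simp only [theta_neg_inv, mul_assoc (2 * Real.pi * Complex.I : ℂ)]
  rw [boundaryIntegral_kernel hn hs₃ hr₁ hinj hζ
    (fun w hw => differentiableAt_exp_theta_of_mem_closure hΩ hI y t hw)
    (fun w hw => by have := ne_zero_of_mem_closure hΩ hw; fun_prop (disch := assumption))
    (fun w hw => two_pi_I_mul_ne_zero (mul_ne_zero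
      (fun h => hz ⟨w, hw, by rw [eq_neg_of_add_eq_zero_left h]; exact neg_div _ _⟩)
      (pow_ne_zero 2 (ne_zero_of_mem_closure hΩ hw)))), Finset.mul_sum,
    ← Finset.sum_neg_distrib]
  refine Finset.sum_congr rfl fun j _ => ?_
  rw [hc, ← mul_div_assoc, mul_div_mul_left _ _ Complex.two_pi_I_ne_zero, neg_div _ 1, sub_neg_eq_add,
    mul_comm (z + _), ← div_div]
  ring

theorem lowerJump_two (y t : ℝ) {z : ℂ}
    (hz : z ∉ (fun w => lowerPole w 2) '' closure (quadDomain n s₁ s₂ s₃)) :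
    lowerJump n s₁ s₂ s₃ r₁ y t z 2 = -lowerPoleSum ζ c y t 2 z := by
  change -boundaryIntegral n s₁ s₂ s₃ (fun w => (conj w - conj s₁) ^ n * r₁ w
      * Complex.exp (2 * Complex.I * theta y t (1 / w))
      / (2 * Real.pi * Complex.I * (z - 1 / w) * w ^ 2)) = -∑ j, c j / ζ j ^ 2 *
        Complex.exp (2 * Complex.I * theta y t (1 / ζ j)) / (z - 1 / ζ j)
  simp only [theta_inv, mul_neg, ← neg_mul, mul_assoc (2 * Real.pi * Complex.I : ℂ)]
  rw [boundaryIntegral_kernel hn hs₃ hr₁ hinj hζ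
    (fun w hw => differentiableAt_exp_theta_of_mem_closure hΩ hI y t hw)
    (D := fun w => 2 * Real.pi * Complex.I * ((z - 1 / w) * w ^ 2))
    (fun w hw => by have := ne_zero_of_mem_closure hΩ hw; fun_prop (disch := assumption))
    (fun w hw => two_pi_I_mul_ne_zero (mul_ne_zero
      (sub_ne_zero.2 fun h => hz ⟨w, hw, h.symm⟩)
      (pow_ne_zero 2 (ne_zero_of_mem_closure hΩ hw)))), Finset.mul_sum]
  congr 1
  refine Finset.sum_congr rfl fun j _ => ?_
  rw [hc, ← mul_div_assoc, mul_div_mul_left _ _ Complex.two_pi_I_ne_zero,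
    mul_comm (z - _), ← div_div]
  ring

omit hn hs₃ hΩ hr₁ hinj hζ hc hI in
theorem conj_notMem_image {z : ℂ} {k : Fin 4} {s : Set ℂ} :
    conj z ∉ (fun w => upperPole w k) '' s ↔ z ∉ (fun w => lowerPole w k) '' s := by
  simp only [mem_image, lowerPole_eq_conj]
  refine not_congr (exists_congr fun w => and_congr_right fun _ => ?_)
  rw [← (starRingEnd ℂ).injective.eq_iff, Complex.conj_conj]

theorem upperJump_eq (y t : ℝ) (k : Fin 4) {z : ℂ}
    (hz : z ∉ (fun w => upperPole w k) '' closure (quadDomain n s₁ s₂ s₃)) :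
    upperJump n s₁ s₂ s₃ r₁ y t z k = -upperPoleSum ζ c y t k z := by
  -- For the indices `1` and `2` the upper integral runs over `dζ*`; its conjugate is the lower
  -- integral over `dζ`, evaluated directly.
  have key : ∀ k, lowerJump n s₁ s₂ s₃ r₁ y t (conj z) k = -lowerPoleSum ζ c y t k (conj z) →
      upperJump n s₁ s₂ s₃ r₁ y t z k = -upperPoleSum ζ c y t k z := by
    intro k h
    rw [lowerJump_eq, lowerPoleSum_eq, Complex.conj_conj, neg_inj] at h
    rw [← (starRingEnd ℂ).injective.eq_iff, h, map_neg]
  have hz' : conj z ∉ (fun w => lowerPole w k) '' closure (quadDomain n s₁ s₂ s₃) :=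
    conj_notMem_image.1 (by rwa [Complex.conj_conj])
  fin_cases k
  · exact upperJump_zero hn hs₃ hΩ hr₁ hinj hζ hc hI y t hz
  · exact key 1 (lowerJump_one hn hs₃ hΩ hr₁ hinj hζ hc hI y t hz')
  · exact key 2 (lowerJump_two hn hs₃ hΩ hr₁ hinj hζ hc hI y t hz')
  · exact upperJump_three hn hs₃ hΩ hr₁ hinj hζ hc hI y t hz

theorem lowerJump_eq_neg_lowerPoleSum (y t : ℝ) (k : Fin 4) {z : ℂ}
    (hz : z ∉ (fun w => lowerPole w k) '' closure (quadDomain n s₁ s₂ s₃)) :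
    lowerJump n s₁ s₂ s₃ r₁ y t z k = -lowerPoleSum ζ c y t k z := by
  rw [lowerJump_eq, lowerPoleSum_eq,
    upperJump_eq hn hs₃ hΩ hr₁ hinj hζ hc hI y t k (conj_notMem_image.2 hz), map_neg]

end

end MCH

end

theorem mainTheorem2 (n : ℕ) (hn : 0 < n) (s₁ s₂ : ℂ) (s₃ : ℝ) (hs₃ : 0 < s₃)
    (hΩ : MCH.quadDomain n s₁ s₂ s₃ ⊆ MCH.regionD)
    (r₁ : ℂ → ℂ) (hr₁ : DiffContOnCl ℂ r₁ (MCH.quadDomain n s₁ s₂ s₃))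
    (Gp Gm : Fin 4 → Set ℂ) (hG : MCH.IsContourSystem n s₁ s₂ s₃ Gp Gm)
    (ζ : Fin n → ℂ) (hζ_inj : Function.Injective ζ) (hζ : ∀ j, (ζ j - s₁) ^ n = s₂)
    (c : Fin n → ℂ) (hc : ∀ j, c j = MCH.normingConst s₃ r₁ ζ j) :
    -- the boundary integrals in the jump matrices reduce to finite sums of poles
    (∀ (y t : ℝ) (k : Fin 4) (z : ℂ),
      (z ∉ (fun w => MCH.upperPole w k) '' closure (MCH.quadDomain n s₁ s₂ s₃) →
        MCH.upperJump n s₁ s₂ s₃ r₁ y t z k = -MCH.upperPoleSum ζ c y t k z) ∧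
      (z ∉ (fun w => MCH.lowerPole w k) '' closure (MCH.quadDomain n s₁ s₂ s₃) →
        MCH.lowerJump n s₁ s₂ s₃ r₁ y t z k = -MCH.lowerPoleSum ζ c y t k z)) ∧
    -- the limiting Riemann-Hilbert problem is the `n`-soliton Riemann-Hilbert problem
    (∀ y t : ℝ,
      (∀ M : ℂ → MCH.Mat, MCH.IsLimitRH n s₁ s₂ s₃ r₁ Gp Gm y t M →
        ∃ M0 : ℂ → MCH.Mat, MCH.IsSolitonRH ζ c y t M0 ∧
          MCH.IsInterpolation ζ c Gp Gm y t M0 M) ∧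
      (∀ M0 : ℂ → MCH.Mat, MCH.IsSolitonRH ζ c y t M0 →
        ∃ M : ℂ → MCH.Mat, MCH.IsLimitRH n s₁ s₂ s₃ r₁ Gp Gm y t M ∧
          MCH.IsInterpolation ζ c Gp Gm y t M0 M)) ∧
    -- the function recovered from the limiting problem is the `n`-soliton solution
    (∀ M : ℝ → ℝ → ℂ → MCH.Mat,
      (∀ y t, MCH.IsLimitRH n s₁ s₂ s₃ r₁ Gp Gm y t (M y t)) →
        (∃! u : ℝ → ℝ → ℝ, MCH.Recovers M u) ∧
        ∀ u : ℝ → ℝ → ℝ, MCH.Recovers M u → MCH.IsNSolitonSolution ζ c u) := by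
  have hmem : ∀ j, ζ j ∈ MCH.quadDomain n s₁ s₂ s₃ := fun j => by
    simpa [MCH.quadDomain, hζ j] using hs₃
  -- The phase is singular at `i`, which could lie on the boundary of the region. The contour system
  -- excludes it, because `upperPole · 0` is the identity.
  have hI : Complex.I ∉ closure (MCH.quadDomain n s₁ s₂ s₃) := fun h =>
    hG.I_notMem_upper 0 (subset_closure (hG.subset_upper 0 ⟨_, h, rfl⟩))
  have hup := fun y t k z => @MCH.upperJump_eq n s₁ s₂ s₃ hn hs₃ hΩ r₁ hr₁ ζ c hζ_inj hζ hc hI y t k z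
  have hlo := fun y t k z =>
    @MCH.lowerJump_eq_neg_lowerPoleSum n s₁ s₂ s₃ hn hs₃ hΩ r₁ hr₁ ζ c hζ_inj hζ hc hI y t k z
  have hfr : ∀ {G : Set ℂ}, MCH.IsJordanDomain G → ∀ z ∈ frontier G, z ∉ G := fun h z hz hzG => by
    rw [h.1.frontier_eq] at hz
    exact hz.2 hzG
  -- A contour is the frontier of an open domain containing the image of the closed quadrature
  -- domain, so its points avoid that image.
  have hJ : ∀ y t, MCH.JumpsArePoleSums r₁ s₁ s₂ s₃ Gp Gm ζ c y t := fun y t k =>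
    ⟨fun z hz => hup y t k z fun h => hfr (hG.jordan_upper k) z hz (hG.subset_upper k h),
      fun z hz => hlo y t k z fun h => hfr (hG.jordan_lower k) z hz (hG.subset_lower k h)⟩
  refine ⟨fun y t k z => ⟨hup y t k z, hlo y t k z⟩, fun y t =>
    ⟨fun M hM => MCH.IsLimitRH.exists_isSolitonRH hG hζ_inj hmem (hJ y t) hM,
      fun M0 hM0 => MCH.IsSolitonRH.exists_isLimitRH hG hζ_inj hmem (hJ y t) hM0⟩, fun M hM => ?_⟩
  choose M0 hM0 hint using fun y t =>
    MCH.IsLimitRH.exists_isSolitonRH hG hζ_inj hmem (hJ y t) (hM y t)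
  -- Recovery depends on `M` near `i` only, and `i` lies outside all contours, where `M` equals the
  -- soliton solution.
  refine MCH.existsUnique_recovers hζ_inj (fun j => hΩ (hmem j)) hM0 fun y t => ?_
  filter_upwards [MCH.eventually_outside_I hG] with z hz
  exact (hint y t).outside z hz.1 hz.2
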